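/- Let $k$ be an algebraically closed field of characteristic $0$, let $X=X_\Sigma$ be a complete toric variety over $k$ with dense torus $T$ and Cox ring $S=k[x_\rho\mid\rho\in\Sigma(1)]=\bigoplus_{\beta\in \mathrm{Cl}(X)}S_\beta$, and let $q:\mathbb A^{\Sigma(1)}\setminus Z\to X$ be the Cox quotient morphism. Let $\alpha\in\mathrm{Cl}(X)$ be a class with $|\alpha|=\mathbb P(S_\alpha)$ non-empty, and let $G=\mathrm{Aut}_\alpha(X)$ be the group of automorphisms of the variety $X$ that preserve $\alpha$; it acts on $|\alpha|$ by push-forward of divisors. Let $A$ be the matrix whose columns are the exponents of the monomials in $S_\alpha$. The $A$-discriminant locus $\nabla_A\subset\mathbb P(S_\alpha)$ is the Zariski closure of the set of $[f]$ for which there is $z\in (k^*)^{\Sigma(1)}$ with $f(z)=\frac{\partial f}{\partial x_\rho}(z)=0$ for all $\rho$. The $A$-discriminant $\Delta_A$ is the polynomial on $S_\alpha$ (unique up to a scalar) generating the ideal of the affine cone over $\nabla_A$ if $\nabla_A$ has codimension $1$, and $\Delta_A=1$ if the codimension is greater than $1$. Then: 1. $\nabla_A$ is the Zariski closure of the set of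 $[f]\in\mathbb P(S_\alpha)$ for which there are a point $x\in G\cdot T=\bigcup_{g\in G}g(T)$ and a point $z\in q^{-1}(x)$ with $f(z)=0$ and $\frac{\partial f}{\partial x_\rho}(z)=0$ for all $\rho\in\Sigma(1)$. If $\alpha\neq0$, the condition $f(z)=0$ may be omitted. 2. $G$ acts on $\mathbb P(S_\alpha)$ by projective linear transformations, and $\nabla_A$ is $G$-invariant. 3. Let $\widetilde G$ be the group of pairs $(g,L)$ with $g\in G$ and $L\in\mathrm{GL}(S_\alpha)$ inducing the action of $g$ on $\mathbb P(S_\alpha)$. By 2, $\widetilde G$ is a central extension of $G$ by $k^*$. Then $\Delta_A$ is homogeneous, and it is a semi-invariant: there is a character $\chi:\widetilde G\to k^*$, given by a polynomial in the matrix entries of $L^{-1}$, such that $\Delta_A(L^{-1}f)=\chi(g,L)\,\Delta_A(f)$ for all $(g,L)\in\widetilde G$ and $f\in S_\alpha$. 4. Let $U\subset G$ be the unipotent radical of $G$. Every $u\in U$ has a unique unipotent lift $\Lambda(u)\in\mathrm{GL}(S_\alpha)$ of its action on $\mathbb P(S_\alpha)$, the map $\Lambda:U\to\mathrm{GL}(S_\alpha)$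 is a group homomorphism, and $\Delta_A$ is a true invariant of $U$: $\Delta_A(\Lambda(u)^{-1}f)=\Delta_A(f)$ for all $u\in U$ and $f\in S_\alpha$. -/

import Mathlib

open MvPolynomial
open scoped LinearAlgebra.Projectivization

namespace ToricDiscriminant

noncomputable section

/-! ### Fans

The lattice of one-parameter subgroups is `ℤⁿ`, the character lattice is `ℤⁿ`, and the pairing
is the dot product. -/

/-- The cone in `ℝⁿ` generated by the vectors `u ρ`, `ρ ∈ σ`. -/
def realCone {n : ℕ} {R : Type*} [Fintype R] (u : R → Fin n → ℤ) (σ : Finset R) :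
    Set (Fin n → ℝ) :=
  {v | ∃ c : R → ℝ, (∀ ρ, 0 ≤ c ρ) ∧ (∀ ρ, ρ ∉ σ → c ρ = 0) ∧
    v = ∑ ρ, c ρ • (fun i => (u ρ i : ℝ))}

/-- `τ` consists of the generators in `σ` of a face of the cone generated by `σ`, i.e. the face
cut out by a linear form `m` that is non-negative on this cone. (The cones are rational, so
integral forms suffice.) -/
def IsFaceOf {n : ℕ} {R : Type*} (u : R → Fin n → ℤ) (τ σ : Finset R) : Prop :=
  ∃ m : Fin n → ℤ, (∀ ρ ∈ σ, 0 ≤ m ⬝ᵥ u ρ) ∧ ∀ ρ, ρ ∈ τ ↔ ρ ∈ σ ∧ m ⬝ᵥ u ρ = 0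

/-- A fan of strongly convex rational polyhedral cones in `ℝⁿ`. The type `R` indexes the rays
`Σ(1)`, the vector `gen ρ` is the primitive lattice generator of the ray `ρ`, and a cone is
recorded by the set `σ(1)` of its rays. -/
structure Fan (n : ℕ) (R : Type*) [Fintype R] [DecidableEq R] where
  gen : R → Fin n → ℤ
  cones : Finset (Finset R)
  primitive : ∀ (ρ : R) (d : ℤ) (v : Fin n → ℤ), gen ρ = d • v → IsUnit d
  empty_mem : ∅ ∈ cones
  ray_mem : ∀ ρ, {ρ} ∈ cones
  strongly_convex : ∀ σ ∈ cones, ∀ v ∈ realCone gen σ, -v ∈ realCone gen σ → v = 0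
  face_mem : ∀ σ ∈ cones, ∀ τ, IsFaceOf gen τ σ → τ ∈ cones
  inter_face : ∀ σ ∈ cones, ∀ τ ∈ cones, IsFaceOf gen (σ ∩ τ) σ
  inter_cone : ∀ σ ∈ cones, ∀ τ ∈ cones,
    realCone gen σ ∩ realCone gen τ = realCone gen (σ ∩ τ)

/-- The fan is complete: its cones cover `ℝⁿ`. Equivalently, the toric variety is complete. -/
def Fan.IsComplete {n : ℕ} {R : Type*} [Fintype R] [DecidableEq R] (F : Fan n R) : Prop :=
  ∀ v : Fin n → ℝ, ∃ σ ∈ F.cones, v ∈ realCone F.gen σ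

variable {n : ℕ} {R : Type*} [Fintype R] [DecidableEq R]

/-- The dual cone of `σ` intersected with the character lattice. -/
def Fan.dual (F : Fan n R) (σ : Finset R) : Set (Fin n → ℤ) :=
  {m | ∀ ρ ∈ σ, 0 ≤ m ⬝ᵥ F.gen ρ}

/-- The characters vanishing on `σ`. -/
def Fan.perp (F : Fan n R) (σ : Finset R) : Set (Fin n → ℤ) :=
  {m | ∀ ρ ∈ σ, m ⬝ᵥ F.gen ρ = 0}

/-! ### The toric variety of a fan, as a classical variety -/

/-- The (closed) points of the toric variety `X_Σ` over the algebraically closed field `k`.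
By the orbit-cone correspondence a point is a cone `σ` of the fan together with a homomorphism
`σ^⊥ ∩ M → kˣ`. The latter is stored as a function `val` on `M` that is zero off `σ^⊥`, so that
`val m` is the value of the character `m` at the point for every `m` that is regular there. -/
@[ext]
structure Point (F : Fan n R) (k : Type*) [Field k] where
  cone : Finset R
  cone_mem : cone ∈ F.cones
  val : (Fin n → ℤ) → k
  val_zero : val 0 = 1
  val_add : ∀ m ∈ F.perp cone, ∀ m' ∈ F.perp cone, val (m + m') = val m * val m'
  val_eq_zero : ∀ m, m ∉ F.perp cone → val m = 0

variable {k : Type*} [Field k]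

/-- The affine chart `U_σ = Spec k[σ^∨ ∩ M]`: the union of the orbits of the faces of `σ`. -/
def chart (F : Fan n R) (k : Type*) [Field k] (σ : Finset R) : Set (Point F k) :=
  {x | x.cone ⊆ σ}

/-- The dense torus `T ⊆ X`, the open orbit. -/
def torus (F : Fan n R) (k : Type*) [Field k] : Set (Point F k) := {x | x.cone = ∅}

/-- The value at a point of `U_σ` of an element of the coordinate ring `k[σ^∨ ∩ M]`. -/
def evalAt {F : Fan n R} {σ : Finset R} (P : F.dual σ →₀ k) (x : Point F k) : k :=
  P.sum fun m c => c * x.val m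

/-- The Zariski topology on `X_Σ`, with the principal open subsets of the charts as a base. -/
instance (F : Fan n R) : TopologicalSpace (Point F k) :=
  TopologicalSpace.generateFrom
    {D | ∃ σ ∈ F.cones, ∃ Q : F.dual σ →₀ k, D = {x | x ∈ chart F k σ ∧ evalAt Q x ≠ 0}}

/-- `h` is a regular function on `V`: locally a quotient of elements of the coordinate ring of a
chart. -/
def RegularOn {F : Fan n R} (h : Point F k → k) (V : Set (Point F k)) : Prop :=
  ∀ x ∈ V, ∃ σ ∈ F.cones, x ∈ chart F k σ ∧ ∃ P Q : F.dual σ →₀ k, evalAt Q x ≠ 0 ∧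
    ∀ y ∈ V, y ∈ chart F k σ → evalAt Q y ≠ 0 → h y * evalAt Q y = evalAt P y

/-- Morphisms `X_Σ → X_Σ` of varieties: continuous maps that pull back regular functions to
regular functions. -/
def IsMorphism {F : Fan n R} (φ : Point F k → Point F k) : Prop :=
  Continuous φ ∧ ∀ (V : Set (Point F k)) (h : Point F k → k),
    IsOpen V → RegularOn h V → RegularOn (h ∘ φ) (φ ⁻¹' V)

/-- The automorphism group `Aut(X)` of the variety `X = X_Σ`. -/
def autX (F : Fan n R) (k : Type*) [Field k] : Subgroup (Equiv.Perm (Point F k)) where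
  carrier := {g | IsMorphism g ∧ IsMorphism g.symm}
  one_mem' := ⟨⟨continuous_id, fun _ _ _ h => h⟩, ⟨continuous_id, fun _ _ _ h => h⟩⟩
  mul_mem' := by
    rintro a b ⟨ha, ha'⟩ ⟨hb, hb'⟩
    refine ⟨⟨ha.1.comp hb.1, fun V h hV hh => ?_⟩, ⟨hb'.1.comp ha'.1, fun V h hV hh => ?_⟩⟩
    · exact hb.2 (a ⁻¹' V) (h ∘ a) (hV.preimage ha.1) (ha.2 V h hV hh)
    · exact ha'.2 (b.symm ⁻¹' V) (h ∘ b.symm) (hV.preimage hb'.1) (hb'.2 V h hV hh)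
  inv_mem' := by
    rintro a ⟨ha, ha'⟩
    exact ⟨ha', ha⟩

/-! ### Class group and Cox ring -/

/-- The map `M → ℤ^{Σ(1)}` sending a character to its divisor. -/
def divHom (F : Fan n R) : (Fin n → ℤ) →+ (R → ℤ) where
  toFun m := fun ρ => m ⬝ᵥ F.gen ρ
  map_zero' := by ext; simp
  map_add' m m' := by ext; simp [add_dotProduct]

/-- The class group of `X_Σ`, with torus-invariant divisors `ℤ^{Σ(1)}` modulo the divisors of
characters. -/
abbrev Cl (F : Fan n R) : Type _ := (R → ℤ) ⧸ (divHom F).range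

/-- The degree in the class group of the variable `x_ρ`: the class of the divisor `D_ρ`. -/
def varDeg (F : Fan n R) (ρ : R) : Cl F := QuotientAddGroup.mk (Pi.single ρ 1)

/-- The graded piece `S_α` of the Cox ring `S = k[x_ρ | ρ ∈ Σ(1)]`. -/
abbrev CoxPiece (F : Fan n R) (k : Type*) [Field k] (α : Cl F) :
    Submodule k (MvPolynomial R k) :=
  weightedHomogeneousSubmodule k (varDeg F) α

/-- The graph of the Cox quotient morphism `q : 𝔸^{Σ(1)} ∖ Z → X_Σ`. Here `z ∉ Z` means that the
`ρ` with `z_ρ = 0` are contained in a cone `σ` of the fan, and then `q z` is the point of `U_σ` at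
which a character `m ∈ σ^∨ ∩ M` has the value `∏ z_ρ ^ ⟨m, u_ρ⟩`. -/
def LiesOver {F : Fan n R} (z : R → k) (x : Point F k) : Prop :=
  ∃ σ ∈ F.cones, (∀ ρ, z ρ = 0 → ρ ∈ σ) ∧ x ∈ chart F k σ ∧
    ∀ m ∈ F.dual σ, x.val m = ∏ ρ, z ρ ^ (m ⬝ᵥ F.gen ρ)

/-! ### Hypersurfaces as divisors, and the automorphisms preserving a class -/

/-- The divisor `div f` of zeros on `X` of a nonzero homogeneous element `f` of the Cox ring,
given by its local equations: all `(V, h)` with `V` open, `h` a regular function on `V`, and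
`q^* h = f · (unit)` on `q⁻¹ V`. This datum determines the Weil divisor, since every Weil divisor
of the normal variety `X` is principal on the open charts of the rays, which cover `X` up to
codimension two. -/
def divisor {F : Fan n R} (f : MvPolynomial R k) : Set (Set (Point F k) × (Point F k → k)) :=
  {p | IsOpen p.1 ∧ RegularOn p.2 p.1 ∧
    ∀ z : R → k, ∀ x ∈ p.1, LiesOver z x → ∃ P Q : MvPolynomial R k,
      eval z P ≠ 0 ∧ eval z Q ≠ 0 ∧
      ∀ w : R → k, ∀ y ∈ p.1, LiesOver w y → eval w P ≠ 0 → eval w Q ≠ 0 →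
        p.2 y * eval w Q = eval w f * eval w P}

/-- Transport of local equations along an automorphism. -/
def transport {F : Fan n R} (g : Equiv.Perm (Point F k))
    (p : Set (Point F k) × (Point F k → k)) : Set (Point F k) × (Point F k → k) :=
  (g '' p.1, p.2 ∘ g.symm)

/-- The push-forward of divisors along an automorphism. -/
def pushDivisor {F : Fan n R} (g : Equiv.Perm (Point F k))
    (D : Set (Set (Point F k) × (Point F k → k))) : Set (Set (Point F k) × (Point F k → k)) :=
  transport g '' D

lemma pushDivisor_one {F : Fan n R} (D : Set (Set (Point F k) × (Point F k → k))) :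
    pushDivisor 1 D = D := by
  have : transport (1 : Equiv.Perm (Point F k)) = id := by
    funext p
    refine Prod.ext ?_ ?_
    · exact Set.image_id _
    · rfl
  simp [pushDivisor, this]

lemma pushDivisor_mul {F : Fan n R} (g h : Equiv.Perm (Point F k))
    (D : Set (Set (Point F k) × (Point F k → k))) :
    pushDivisor (g * h) D = pushDivisor g (pushDivisor h D) := by
  have : transport (g * h) = transport g ∘ transport h := by
    funext p
    refine Prod.ext ?_ ?_
    · exact Set.image_comp g h p.1
    · rfl
  rw [pushDivisor, this, Set.image_comp]
  rfl

/-- The complete linear system `|α|`: the divisors of the nonzero elements of `S_α`. -/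
def linearSystem (F : Fan n R) (k : Type*) [Field k] (α : Cl F) :
    Set (Set (Set (Point F k) × (Point F k → k))) :=
  {D | ∃ f ∈ CoxPiece F k α, f ≠ 0 ∧ D = divisor f}

/-- The group `Aut_α(X)` of the automorphisms of `X` that preserve the class `α`. It is only used
for `α` with non-empty linear system; then `g_* α = α` holds if and only if `g_*` maps the set
`|α|` of the effective divisors of class `α` onto itself. -/
def autClass (F : Fan n R) (k : Type*) [Field k] (α : Cl F) :
    Subgroup (Equiv.Perm (Point F k)) where
  carrier := {g | g ∈ autX F k ∧ pushDivisor g '' linearSystem F k α = linearSystem F k α}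
  one_mem' := by
    refine ⟨one_mem _, ?_⟩
    have : (pushDivisor (1 : Equiv.Perm (Point F k))) = id := funext pushDivisor_one
    rw [this, Set.image_id]
  mul_mem' := by
    rintro a b ⟨ha, ha'⟩ ⟨hb, hb'⟩
    refine ⟨mul_mem ha hb, ?_⟩
    have : pushDivisor (a * b) = pushDivisor a ∘ pushDivisor b :=
      funext (pushDivisor_mul a b)
    rw [this, Set.image_comp, hb', ha']
  inv_mem' := by
    rintro a ⟨ha, ha'⟩
    refine ⟨inv_mem ha, ?_⟩
    conv_lhs => rw [← ha']
    rw [← Set.image_comp]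
    have : pushDivisor a⁻¹ ∘ pushDivisor a = id := by
      funext D
      rw [Function.comp_apply, ← pushDivisor_mul, inv_mul_cancel, pushDivisor_one]
      rfl
    rw [this, Set.image_id]

/-- The sweep `G · T ⊆ X` of the torus under `G = Aut_α(X)`. -/
def sweep (F : Fan n R) (k : Type*) [Field k] (α : Cl F) : Set (Point F k) :=
  {x | ∃ g ∈ autClass F k α, ∃ t ∈ torus F k, x = g t}

/-! ### The `A`-discriminant -/

/-- The columns of the matrix `A = A_{Σ,α}`: the exponents of the monomials of degree `α`. -/
abbrev Exps (F : Fan n R) (α : Cl F) : Type _ :=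
  {a : R →₀ ℕ // Finsupp.weight (varDeg F) a = α}

/-- The coefficients of `f ∈ S_α = k^A`. -/
def coords {F : Fan n R} {α : Cl F} (f : CoxPiece F k α) : Exps F α → k :=
  fun a => coeff a.1 (f : MvPolynomial R k)

/-- Zariski closure in `ℙ(S_α)`. -/
def zariskiClosure {F : Fan n R} {α : Cl F} (Y : Set (ℙ k (CoxPiece F k α))) :
    Set (ℙ k (CoxPiece F k α)) :=
  {p | ∀ (H : MvPolynomial (Exps F α) k) (d : ℕ), H.IsHomogeneous d →
    (∀ q ∈ Y, eval (coords q.rep) H = 0) → eval (coords p.rep) H = 0}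

/-- All partial derivatives of `f` vanish at `z`. -/
def GradVanishes (f : MvPolynomial R k) (z : R → k) : Prop :=
  ∀ ρ, eval z (pderiv ρ f) = 0

/-- The set `∇_A°` of the `[f]` with a singular point on the torus `(kˣ)^{Σ(1)}`. -/
def discOpen (F : Fan n R) (k : Type*) [Field k] (α : Cl F) : Set (ℙ k (CoxPiece F k α)) :=
  {p | ∃ z : R → k, (∀ ρ, z ρ ≠ 0) ∧
    eval z (p.rep : MvPolynomial R k) = 0 ∧ GradVanishes (p.rep : MvPolynomial R k) z}

/-- The `A`-discriminant locus `∇_A`. -/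
def discLocus (F : Fan n R) (k : Type*) [Field k] (α : Cl F) : Set (ℙ k (CoxPiece F k α)) :=
  zariskiClosure (discOpen F k α)

/-- The ideal of the polynomials in the coefficients `a_ω`, `ω ∈ A`, that vanish on the affine
cone over `∇_A` in `k^A`. -/
def discIdeal (F : Fan n R) (k : Type*) [Field k] (α : Cl F) :
    Ideal (MvPolynomial (Exps F α) k) :=
  vanishingIdeal k {v | ∃ f : CoxPiece F k α, v = coords f ∧
    (f = 0 ∨ ∃ hf : f ≠ 0, Projectivization.mk k f hf ∈ discLocus F k α)}

/-- `Δ` is an `A`-discriminant: the polynomial defining `∇_A` if `∇_A` has codimension one (that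
is, if the defect of `A` is zero), and `1` if the codimension is greater than one. -/
def IsDiscriminant {F : Fan n R} {α : Cl F} (Δ : MvPolynomial (Exps F α) k) : Prop :=
  ((discIdeal F k α).height = 1 ∧ discIdeal F k α = Ideal.span {Δ}) ∨
    (1 < (discIdeal F k α).height ∧ Δ = 1)

/-! ### The action of `G` on `ℙ(S_α)` and its linearisation -/

/-- The pairs `(g, L)` of an automorphism `g ∈ G = Aut_α(X)` and a linear automorphism `L` of
`S_α` that induces the action of `g` on `|α| = ℙ(S_α)`, i.e. `g_* (div f) = div (L f)`. This is
the central extension of `G` by `kˣ` that acts on `S_α`, through which every linear action on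
`S_α` that lifts the action on `ℙ(S_α)` factors. -/
def linearGroup (F : Fan n R) (k : Type*) [Field k] (α : Cl F) :
    Subgroup (Equiv.Perm (Point F k) × (CoxPiece F k α ≃ₗ[k] CoxPiece F k α)) where
  carrier := {p | p.1 ∈ autClass F k α ∧ ∀ f : CoxPiece F k α, f ≠ 0 →
    pushDivisor p.1 (divisor (f : MvPolynomial R k)) = divisor (p.2 f : MvPolynomial R k)}
  one_mem' := ⟨one_mem _, fun f _ => pushDivisor_one _⟩
  mul_mem' := by
    rintro a b ⟨ha, ha'⟩ ⟨hb, hb'⟩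
    refine ⟨mul_mem ha hb, fun f hf => ?_⟩
    rw [Prod.fst_mul, pushDivisor_mul, hb' f hf, ha' _ (by simpa using hf)]
    rfl
  inv_mem' := by
    rintro a ⟨ha, ha'⟩
    refine ⟨inv_mem ha, fun f hf => ?_⟩
    have h := ha' (a.2⁻¹ f) (by
      intro h0
      exact hf (a.2.symm.map_eq_zero_iff.mp h0))
    have h1 : a.2 (a.2⁻¹ f) = f := a.2.apply_symm_apply f
    rw [h1] at h
    rw [Prod.fst_inv, Prod.snd_inv, ← h, ← pushDivisor_mul, inv_mul_cancel, pushDivisor_one]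

/-- The monomial with exponent `b`, as an element of `S_α`. -/
def monomialElt {F : Fan n R} {α : Cl F} (b : Exps F α) : CoxPiece F k α :=
  ⟨monomial b.1 1, isWeightedHomogeneous_monomial _ _ _ b.2⟩

/-- The matrix entries of a linear automorphism of `S_α` in the monomial basis. -/
def entries {F : Fan n R} {α : Cl F} (L : CoxPiece F k α ≃ₗ[k] CoxPiece F k α) :
    Exps F α × Exps F α → k :=
  fun ab => coords (L (monomialElt ab.2)) ab.1

/-- A linear automorphism is unipotent. -/
def IsUnipotentMap {V : Type*} [AddCommGroup V] [Module k V] (L : V ≃ₗ[k] V) : Prop :=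
  IsNilpotent ((L : V →ₗ[k] V) - LinearMap.id : Module.End k V)

/-! ### Unipotent algebraic groups of automorphisms, and the unipotent radical -/

/-- `H` is Zariski closed in `GL_r(k)`. -/
def IsClosedInGL {r : ℕ} (H : Subgroup (GL (Fin r) k)) : Prop :=
  ∃ I : Set (MvPolynomial (Fin r × Fin r) k), ∀ h : GL (Fin r) k,
    h ∈ H ↔ ∀ p ∈ I, eval (fun ij => (h : Matrix (Fin r) (Fin r) k) ij.1 ij.2) p = 0

/-- The value at `(h, x)`, for `h ∈ GL_r(k)` and `x ∈ U_σ`, of an element of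
`k[GL_r entries] ⊗ k[σ^∨ ∩ M]`. -/
def evalAt₂ {F : Fan n R} {r : ℕ} {σ : Finset R}
    (P : F.dual σ →₀ MvPolynomial (Fin r × Fin r) k) (h : GL (Fin r) k) (x : Point F k) : k :=
  P.sum fun m c => eval (fun ij => (h : Matrix (Fin r) (Fin r) k) ij.1 ij.2) c * x.val m

/-- The action of `H` on `X` through `act` is algebraic: `H × X → X` is a morphism of varieties.
In detail: if `h₀ x₀ ∈ U_τ` and `m ∈ τ^∨ ∩ M`, then near `(h₀, x₀)` the map takes values in `U_τ`
and the pull-back of the character `m` is a quotient of regular functions. -/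
def IsAlgebraicAction {F : Fan n R} {r : ℕ} {H : Subgroup (GL (Fin r) k)}
    (act : H →* Equiv.Perm (Point F k)) : Prop :=
  ∀ (h₀ : H) (x₀ : Point F k), ∀ τ ∈ F.cones, act h₀ x₀ ∈ chart F k τ → ∀ m ∈ F.dual τ,
    ∃ σ ∈ F.cones, x₀ ∈ chart F k σ ∧
      ∃ P Q : F.dual σ →₀ MvPolynomial (Fin r × Fin r) k, evalAt₂ Q (h₀ : GL (Fin r) k) x₀ ≠ 0 ∧
        ∀ (h : H) (x : Point F k), x ∈ chart F k σ → evalAt₂ Q (h : GL (Fin r) k) x ≠ 0 →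
          act h x ∈ chart F k τ ∧
          (act h x).val m * evalAt₂ Q (h : GL (Fin r) k) x = evalAt₂ P (h : GL (Fin r) k) x

/-- `N` is a unipotent algebraic group of transformations of `X`: the image of a closed unipotent
subgroup of some `GL_r(k)` acting algebraically on `X`. (In characteristic zero, closed unipotent
groups are connected.) -/
def IsUnipotentAlgebraic {F : Fan n R} (N : Subgroup (Equiv.Perm (Point F k))) : Prop :=
  ∃ (r : ℕ) (H : Subgroup (GL (Fin r) k)) (act : H →* Equiv.Perm (Point F k)),
    IsClosedInGL H ∧
    (∀ h ∈ H, IsNilpotent ((h : Matrix (Fin r) (Fin r) k) - 1)) ∧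
    IsAlgebraicAction act ∧ act.range = N

/-- `N` is a normal unipotent algebraic subgroup of `G`. -/
def IsNormalUnipotent {F : Fan n R} (G N : Subgroup (Equiv.Perm (Point F k))) : Prop :=
  N ≤ G ∧ (∀ g ∈ G, ∀ u ∈ N, g * u * g⁻¹ ∈ N) ∧ IsUnipotentAlgebraic N

/-- `U` is the unipotent radical of `G` (in characteristic zero): the largest normal unipotent
algebraic subgroup. -/
def IsUnipotentRadical {F : Fan n R} (G U : Subgroup (Equiv.Perm (Point F k))) : Prop :=
  IsNormalUnipotent G U ∧ ∀ N, IsNormalUnipotent G N → N ≤ U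

end

end ToricDiscriminant

open ToricDiscriminant

namespace ToricDiscriminant

noncomputable section

set_option linter.unusedSectionVars false

variable {n : ℕ} {R : Type*} [Fintype R] [DecidableEq R] {k : Type*} [Field k]

/-! ### Cones, faces and characters -/

section Fan

variable (F : Fan n R)

/-! Everything is computed in Cox coordinates: regular functions on `X` are locally quotients of
forms of equal degree (`RegularAt.exists_cox`), and a form of degree `α` becomes a function on a
chart after division by a Laurent monomial of class `α` (`exists_dehom`).

Linearity of the action. If `g` carries `div f₁`, `div f₂` to `div f₁'`, `div f₂'`, then `(f₁'/f₂')
∘ g` and `f₁/f₂` differ by a constant (`exists_ratio`): `g` transports local equations, so the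
discrepancy is a unit at every prime of the factorial Cox ring, hence a constant. Normalising
against a fixed form turns push-forward of divisors into a linear map `L` on `S_α`
(`exists_lift_aux`), unique up to a scalar (`lift_unique`).

Transport of singular points. If `L f` is singular at some `z` over `g t` with `t ∈ T`, then `f` is
singular at the points over `t` (`singular_of_lift`). The invariant vector fields of the torus,
carried along by `g`, preserve regularity at `g t`. After multiplication by a common denominator
they split into finitely many weights. A weight that is itself regular at `g t` lifts to a monomial
times a combination of the Euler fields `x_ρ ∂/∂x_ρ`; any other weight that occurs is a Demazure
root and lifts to a multiple of a single `∂/∂x_ρ` (`exists_tangent_of_weight`, `exists_tangent`). So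
the logarithmic derivatives of `f` over `t` are governed by the partial derivatives of `L f` at `z`,
which vanish.

Invariance of the locus. A form with a singular point on the torus can be translated by the torus so
that its singular point becomes general and is kept in `T` by `g`. A hypersurface containing `∇_A`
therefore contains the `L`-images of the general translates, and, as the translates form a
polynomial family, of all of them (`eval_lift_eq_zero`). The descriptions by the sweep `G · T` and
the invariance of `∇_A` follow; for `α ≠ 0` an Euler relation makes the condition `f(z) = 0`
redundant.

The discriminant. The ideal of the cone over `∇_A` is stable under substitution of `L`, so `Δ ∘ L`
is a multiple of `Δ` of no larger degree, that is, a constant multiple. The scalars in the linear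
group give homogeneity.

Unipotent elements. Powers of a unipotent matrix depend polynomially on the exponent, whereas `c ^
j` agrees with a nonzero rational function of `j` only if `c = 1` (`eq_one_of_pow_mul_eval_eq`).
Applied to `f / f'` along an orbit this gives a lift with the single eigenvalue `1`; applied to `Δ`
it gives invariance. Traces and determinants show that the unipotent lifts multiply
(`isUnipotentMap_mul`). -/

lemma Fan.zero_mem_dual (σ : Finset R) : (0 : Fin n → ℤ) ∈ F.dual σ := fun ρ _ => by simp

lemma Fan.add_mem_dual {σ : Finset R} {m m' : Fin n → ℤ} (h : m ∈ F.dual σ)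
    (h' : m' ∈ F.dual σ) : m + m' ∈ F.dual σ := fun ρ hρ => by
  rw [add_dotProduct]; exact add_nonneg (h ρ hρ) (h' ρ hρ)

lemma Fan.nsmul_mem_dual {σ : Finset R} {m : Fin n → ℤ} (h : m ∈ F.dual σ) (N : ℕ) :
    N • m ∈ F.dual σ := fun ρ hρ => by
  rw [smul_dotProduct]; exact nsmul_nonneg (h ρ hρ) N

lemma Fan.perp_subset_dual (σ : Finset R) : F.perp σ ⊆ F.dual σ := fun _ h ρ hρ => (h ρ hρ).ge

lemma Fan.dual_anti {σ τ : Finset R} (h : τ ⊆ σ) : F.dual σ ⊆ F.dual τ :=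
  fun _ hm ρ hρ => hm ρ (h hρ)

lemma Fan.zero_mem_perp (σ : Finset R) : (0 : Fin n → ℤ) ∈ F.perp σ := fun ρ _ => by simp

lemma Fan.add_mem_perp {σ : Finset R} {m m' : Fin n → ℤ} (h : m ∈ F.perp σ)
    (h' : m' ∈ F.perp σ) : m + m' ∈ F.perp σ := fun ρ hρ => by
  rw [add_dotProduct, h ρ hρ, h' ρ hρ, add_zero]

lemma Fan.neg_mem_perp {σ : Finset R} {m : Fin n → ℤ} (h : m ∈ F.perp σ) :
    -m ∈ F.perp σ := fun ρ hρ => by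
  rw [neg_dotProduct, h ρ hρ, neg_zero]

/-- Non-negative integers with sum zero are zero: `σ^⊥` is a face of the monoid `σ^∨`. -/
lemma Fan.perp_of_add_mem_perp {σ : Finset R} {m m' : Fin n → ℤ} (h : m ∈ F.dual σ)
    (h' : m' ∈ F.dual σ) (hs : m + m' ∈ F.perp σ) : m ∈ F.perp σ := fun ρ hρ => by
  have h1 := hs ρ hρ
  rw [add_dotProduct] at h1
  have h2 := h ρ hρ
  have h3 := h' ρ hρ
  omega

/-- A linear form that is non-negative on `σ` and cuts out the face `τ`. -/
lemma Fan.exists_face {σ τ : Finset R} (hσ : σ ∈ F.cones) (hτ : τ ∈ F.cones) (h : τ ⊆ σ) :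
    ∃ m ∈ F.dual σ, ∀ ρ ∈ σ, m ⬝ᵥ F.gen ρ = 0 ↔ ρ ∈ τ := by
  have h1 := F.inter_face σ hσ τ hτ
  rw [Finset.inter_eq_right.mpr h] at h1
  obtain ⟨m, hm, hm'⟩ := h1
  exact ⟨m, hm, fun ρ hρ => by rw [hm' ρ]; simp [hρ]⟩

lemma Fan.inter_mem {σ τ : Finset R} (hσ : σ ∈ F.cones) (hτ : τ ∈ F.cones) :
    σ ∩ τ ∈ F.cones :=
  F.face_mem σ hσ _ (F.inter_face σ hσ τ hτ)

/-- Adding a large multiple of a form that is positive on `σ ∖ τ` and zero on `τ`. -/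
lemma Fan.exists_add_nsmul_mem_dual {σ τ : Finset R} (hσ : σ ∈ F.cones) (hτ : τ ∈ F.cones)
    (h : τ ⊆ σ) : ∃ m₀ ∈ F.dual σ, m₀ ∈ F.perp τ ∧ (∀ ρ ∈ σ, ρ ∉ τ → 0 < m₀ ⬝ᵥ F.gen ρ) ∧
      ∀ m ∈ F.dual τ, ∃ N : ℕ, m + N • m₀ ∈ F.dual σ := by
  obtain ⟨m₀, hm₀, hz⟩ := F.exists_face hσ hτ h
  have hpos : ∀ ρ ∈ σ, ρ ∉ τ → 0 < m₀ ⬝ᵥ F.gen ρ := fun ρ hρ hρ' =>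
    lt_of_le_of_ne (hm₀ ρ hρ) fun h0 => hρ' ((hz ρ hρ).mp h0.symm)
  refine ⟨m₀, hm₀, fun ρ hρ => (hz ρ (h hρ)).mpr hρ, hpos, fun m hm => ?_⟩
  refine ⟨∑ ρ, (m ⬝ᵥ F.gen ρ).natAbs, fun ρ hρ => ?_⟩
  rw [add_dotProduct, smul_dotProduct, nsmul_eq_mul]
  by_cases hρ' : ρ ∈ τ
  · rw [(hz ρ hρ).mpr hρ', mul_zero, add_zero]; exact hm ρ hρ'
  · have h1 : (m ⬝ᵥ F.gen ρ).natAbs ≤ ∑ ρ, (m ⬝ᵥ F.gen ρ).natAbs :=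
      Finset.single_le_sum (f := fun ρ => (m ⬝ᵥ F.gen ρ).natAbs) (fun _ _ => Nat.zero_le _)
        (Finset.mem_univ ρ)
    have h2 := hpos ρ hρ hρ'
    generalize (∑ ρ, (m ⬝ᵥ F.gen ρ).natAbs) = N at *
    have h3 : (N : ℤ) * 1 ≤ N * (m₀ ⬝ᵥ F.gen ρ) := mul_le_mul_of_nonneg_left (by omega) (by omega)
    omega

end Fan

/-! ### Points of the toric variety and the Cox quotient map -/

section Points

variable {F : Fan n R}

lemma Point.val_ne_zero (x : Point F k) {m : Fin n → ℤ} (hm : m ∈ F.perp x.cone) :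
    x.val m ≠ 0 := fun h => by
  have := x.val_add m hm _ (F.neg_mem_perp hm)
  rw [add_neg_cancel, x.val_zero, h, zero_mul] at this
  exact one_ne_zero this

lemma Point.val_eq_zero_iff (x : Point F k) (m : Fin n → ℤ) :
    x.val m = 0 ↔ m ∉ F.perp x.cone :=
  ⟨fun h hm => x.val_ne_zero hm h, x.val_eq_zero m⟩

/-- Since `σ^⊥` is a face of `σ^∨`, extension by zero stays multiplicative on all of `σ^∨`. Thus a
point is a monoid homomorphism on the characters that are regular there. -/
lemma Point.val_add_dual (x : Point F k) {m m' : Fin n → ℤ} (hm : m ∈ F.dual x.cone)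
    (hm' : m' ∈ F.dual x.cone) : x.val (m + m') = x.val m * x.val m' := by
  by_cases h : m + m' ∈ F.perp x.cone
  · have h1 := F.perp_of_add_mem_perp hm hm' h
    rw [add_comm] at h
    have h2 := F.perp_of_add_mem_perp hm' hm h
    exact x.val_add m h1 m' h2
  · rw [x.val_eq_zero _ h]
    by_cases h1 : m ∈ F.perp x.cone
    · have h2 : m' ∉ F.perp x.cone := fun h2 => h (F.add_mem_perp h1 h2)
      rw [x.val_eq_zero _ h2, mul_zero]
    · rw [x.val_eq_zero _ h1, zero_mul]

lemma Point.val_nsmul (x : Point F k) {m : Fin n → ℤ} (hm : m ∈ F.dual x.cone) (N : ℕ) :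
    x.val (N • m) = x.val m ^ N := by
  induction N with
  | zero => simp [x.val_zero]
  | succ N ih => rw [succ_nsmul, x.val_add_dual (F.nsmul_mem_dual hm N) hm, ih, pow_succ]

lemma mem_chart {σ : Finset R} {x : Point F k} : x ∈ chart F k σ ↔ x.cone ⊆ σ := Iff.rfl

lemma mem_torus {x : Point F k} : x ∈ torus F k ↔ x.cone = ∅ := Iff.rfl

lemma torus_eq_chart : torus F k = chart F k ∅ := by
  ext x; rw [mem_torus, mem_chart, Finset.subset_empty]

lemma torus_subset_chart (σ : Finset R) : torus F k ⊆ chart F k σ := fun x hx => by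
  rw [mem_chart, mem_torus.mp hx]; exact Finset.empty_subset _

/-- The Laurent monomial `z ^ {div m}` on the Cox space. -/
def laurent (F : Fan n R) (z : R → k) (m : Fin n → ℤ) : k := ∏ ρ, z ρ ^ (m ⬝ᵥ F.gen ρ)

lemma laurent_zero (z : R → k) : laurent F z 0 = 1 := by simp [laurent]

/-- At a vanishing coordinate, exponents of opposite sign would break multiplicativity; membership
in `σ^∨` for a `σ` containing all the zeros excludes this. -/
lemma laurent_add (z : R → k) {σ : Finset R} (hz : ∀ ρ, z ρ = 0 → ρ ∈ σ) {m m' : Fin n → ℤ}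
    (hm : m ∈ F.dual σ) (hm' : m' ∈ F.dual σ) :
    laurent F z (m + m') = laurent F z m * laurent F z m' := by
  simp only [laurent, ← Finset.prod_mul_distrib]
  refine Finset.prod_congr rfl fun ρ _ => ?_
  rw [add_dotProduct]
  by_cases h : z ρ = 0
  · have h1 := hm ρ (hz ρ h)
    have h2 := hm' ρ (hz ρ h)
    rw [h]
    rcases h1.eq_or_lt with h1 | h1
    · rw [← h1]; simp
    · rw [zero_zpow _ h1.ne', zero_zpow _ (by omega), zero_mul]
  · exact zpow_add₀ h _ _

lemma laurent_ne_zero_iff (z : R → k) (m : Fin n → ℤ) :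
    laurent F z m ≠ 0 ↔ ∀ ρ, z ρ = 0 → m ⬝ᵥ F.gen ρ = 0 := by
  rw [laurent, Finset.prod_ne_zero_iff]
  constructor
  · intro h ρ hρ
    by_contra h1
    exact h ρ (Finset.mem_univ _) (by rw [hρ, zero_zpow _ h1])
  · intro h ρ _
    by_cases h0 : z ρ = 0
    · rw [h ρ h0]; simp
    · exact zpow_ne_zero _ h0

/-- A character of `σ^∨` that cuts out the cone of `x` is nonzero at `x`, so its Laurent monomial
has exponent zero at every vanishing coordinate. -/
lemma LiesOver.zeros_subset {z : R → k} {x : Point F k} (h : LiesOver z x) :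
    ∀ ρ, z ρ = 0 → ρ ∈ x.cone := by
  obtain ⟨σ, hσ, hz, hx, hv⟩ := h
  obtain ⟨m, hm, hf⟩ := F.exists_face hσ x.cone_mem hx
  intro ρ hρ
  have h1 : x.val m ≠ 0 := x.val_ne_zero fun ρ hρ => (hf ρ (hx hρ)).mpr hρ
  rw [hv m hm] at h1
  exact (hf ρ (hz ρ hρ)).mp ((laurent_ne_zero_iff z m).mp h1 ρ hρ)

/-- `LiesOver` prescribes values only on some larger chart. A multiple of a character that is
invertible at `x` moves `m` into the dual of that chart, and its value can be cancelled afterwards.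
-/
lemma LiesOver.val_eq {z : R → k} {x : Point F k} (h : LiesOver z x) {m : Fin n → ℤ}
    (hm : m ∈ F.dual x.cone) : x.val m = laurent F z m := by
  have hz' := h.zeros_subset
  obtain ⟨σ, hσ, hz, hx, hv⟩ := h
  obtain ⟨m₀, hm₀, hp, -, hN⟩ := F.exists_add_nsmul_mem_dual hσ x.cone_mem hx
  obtain ⟨N, hN⟩ := hN m hm
  have hp' := F.nsmul_mem_dual (F.perp_subset_dual _ hp) N
  have h1 : x.val (m + N • m₀) = laurent F z (m + N • m₀) := hv _ hN
  have h2 : x.val (N • m₀) = laurent F z (N • m₀) := hv _ (F.nsmul_mem_dual hm₀ N)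
  rw [x.val_add_dual hm hp', laurent_add z hz' hm hp', h2] at h1
  refine mul_right_cancel₀ ?_ h1
  rw [← h2, x.val_nsmul (F.perp_subset_dual _ hp)]
  exact pow_ne_zero _ (x.val_ne_zero hp)

lemma LiesOver.val_eq' {z : R → k} {x : Point F k} (h : LiesOver z x) {σ : Finset R}
    (hx : x ∈ chart F k σ) {m : Fin n → ℤ} (hm : m ∈ F.dual σ) : x.val m = laurent F z m :=
  h.val_eq (F.dual_anti hx hm)

/-- The character cutting out the face `σ ∩ x.cone` of `x.cone` has a nonzero monomial at `z`, hence
a nonzero value at `x`; so it is zero on all of `x.cone`, and the face is everything. -/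
lemma LiesOver.cone_subset {z : R → k} {x : Point F k} (h : LiesOver z x) {σ : Finset R}
    (hσ : σ ∈ F.cones) (hz : ∀ ρ, z ρ = 0 → ρ ∈ σ) : x.cone ⊆ σ := by
  obtain ⟨m, hm, hf⟩ := F.exists_face x.cone_mem (F.inter_mem hσ x.cone_mem)
    Finset.inter_subset_right
  have h1 : laurent F z m ≠ 0 := by
    rw [laurent_ne_zero_iff]
    intro ρ hρ
    have := h.zeros_subset ρ hρ
    exact (hf ρ this).mpr (Finset.mem_inter.mpr ⟨hz ρ hρ, this⟩)
  rw [← h.val_eq hm, Ne, x.val_eq_zero_iff, not_not] at h1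
  intro ρ hρ
  exact (Finset.mem_inter.mp ((hf ρ hρ).mp (h1 ρ hρ))).1

lemma LiesOver.mem_torus_iff {z : R → k} {x : Point F k} (h : LiesOver z x) :
    x ∈ torus F k ↔ ∀ ρ, z ρ ≠ 0 := by
  constructor
  · intro hx ρ hρ
    have := h.zeros_subset ρ hρ
    rw [mem_torus.mp hx] at this
    exact absurd this (Finset.notMem_empty _)
  · intro hz
    exact Finset.subset_empty.mp (h.cone_subset F.empty_mem fun ρ hρ => (hz ρ hρ).elim)

lemma exists_liesOver_point {z : R → k} {σ : Finset R} (hσ : σ ∈ F.cones)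
    (hz : ∀ ρ, z ρ = 0 → ρ ∈ σ) : ∃ x : Point F k, LiesOver z x := by
  classical
  -- the smallest cone containing the zeros of `z`
  obtain ⟨τ, hτ⟩ := Finset.exists_min_image (F.cones.filter fun σ => ∀ ρ, z ρ = 0 → ρ ∈ σ)
    Finset.card ⟨σ, Finset.mem_filter.mpr ⟨hσ, hz⟩⟩
  simp only [Finset.mem_filter] at hτ
  obtain ⟨⟨hτ, hzτ⟩, hmin⟩ := hτ
  have hval : ∀ m ∈ F.dual τ, m ∉ F.perp τ → laurent F z m = 0 := by
    intro m hm hm'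
    by_contra h
    have h := (laurent_ne_zero_iff z m).mp h
    -- The face of `τ` on which `m` vanishes still contains the zeros of `z`; minimality of `τ`
    -- makes it equal to `τ`.
    have hface : τ.filter (fun ρ => m ⬝ᵥ F.gen ρ = 0) ∈ F.cones :=
      F.face_mem τ hτ _ ⟨m, hm, fun ρ => by simp⟩
    have hle := hmin _ ⟨hface, fun ρ hρ => Finset.mem_filter.mpr ⟨hzτ ρ hρ, h ρ hρ⟩⟩
    have heq := Finset.eq_of_subset_of_card_le (Finset.filter_subset _ τ) hle
    apply hm'
    intro ρ hρ
    rw [← heq] at hρ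
    exact (Finset.mem_filter.mp hρ).2
  refine ⟨⟨τ, hτ, fun m => if m ∈ F.perp τ then laurent F z m else 0, ?_, ?_, ?_⟩,
    τ, hτ, hzτ, Finset.Subset.refl _, ?_⟩
  · rw [if_pos (F.zero_mem_perp τ), laurent_zero]
  · intro m hm m' hm'
    rw [if_pos hm, if_pos hm', if_pos (F.add_mem_perp hm hm')]
    exact laurent_add z hzτ (F.perp_subset_dual _ hm) (F.perp_subset_dual _ hm')
  · intro m hm
    rw [if_neg hm]
  · intro m hm
    change (if m ∈ F.perp τ then laurent F z m else 0) = laurent F z m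
    split_ifs with h
    · rfl
    · rw [hval m hm h]

lemma exists_liesOver_torus_point {z : R → k} (hz : ∀ ρ, z ρ ≠ 0) :
    ∃ x : Point F k, x ∈ torus F k ∧ LiesOver z x := by
  obtain ⟨x, hx⟩ := exists_liesOver_point (F := F) F.empty_mem (fun ρ h => (hz ρ h).elim)
  exact ⟨x, hx.mem_torus_iff.mpr hz, hx⟩

end Points

/-! ### Consequences of completeness -/

section Complete

variable {F : Fan n R}

/-- By completeness `m`, read as a vector of `ℝⁿ`, is a combination of the ray generators; pairing
it with itself gives zero. -/
lemma Fan.IsComplete.eq_zero_of_pairing (hF : F.IsComplete) {m : Fin n → ℤ}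
    (h : ∀ ρ, m ⬝ᵥ F.gen ρ = 0) : m = 0 := by
  obtain ⟨σ, -, c, -, -, hv⟩ := hF (fun i => (m i : ℝ))
  have h1 : (fun i => (m i : ℝ)) ⬝ᵥ (fun i => (m i : ℝ)) = 0 := by
    conv_lhs => rw [hv]
    rw [sum_dotProduct]
    refine Finset.sum_eq_zero fun ρ _ => ?_
    rw [smul_dotProduct]
    have := congrArg (Int.cast : ℤ → ℝ) (h ρ)
    simp only [dotProduct, Int.cast_sum, Int.cast_mul, Int.cast_zero] at this
    have h2 : (fun i => (F.gen ρ i : ℝ)) ⬝ᵥ (fun i => (m i : ℝ)) = 0 := by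
      rw [← this]; exact Finset.sum_congr rfl fun i _ => mul_comm _ _
    rw [← hv, h2, smul_zero]
  have h2 := dotProduct_self_eq_zero.mp h1
  funext i
  have h3 := congrFun h2 i
  simp only [Pi.zero_apply, Int.cast_eq_zero] at h3
  exact h3

lemma Fan.IsComplete.divHom_injective (hF : F.IsComplete) : Function.Injective (divHom F) := by
  rw [injective_iff_map_eq_zero]
  exact fun m hm => hF.eq_zero_of_pairing fun ρ => congrFun hm ρ

/-- A strictly positive relation between the rays. -/
lemma Fan.IsComplete.exists_pos_relation (hF : F.IsComplete) :
    ∃ c : R → ℝ, (∀ ρ, 1 ≤ c ρ) ∧ ∀ i, ∑ ρ, c ρ * (F.gen ρ i : ℝ) = 0 := by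
  have h : ∀ ρ₀ : R, ∃ c : R → ℝ, (∀ ρ, 0 ≤ c ρ) ∧ 1 ≤ c ρ₀ ∧
      ∀ i, ∑ ρ, c ρ * (F.gen ρ i : ℝ) = 0 := by
    intro ρ₀
    -- Expand `-u_{ρ₀}` in a cone and add `u_{ρ₀}`: a non-negative relation with coefficient at
    -- least `1` at `ρ₀`. The sum over all `ρ₀` is strictly positive.
    obtain ⟨σ, -, c, hc, -, hv⟩ := hF (fun i => -(F.gen ρ₀ i : ℝ))
    refine ⟨fun ρ => c ρ + if ρ = ρ₀ then 1 else 0, fun ρ => ?_, ?_, fun i => ?_⟩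
    · have := hc ρ; dsimp only; split_ifs <;> linarith
    · have := hc ρ₀; simp [this]
    · have := congrFun hv i
      simp only [Finset.sum_apply, Pi.smul_apply, smul_eq_mul] at this
      simp only [add_mul, Finset.sum_add_distrib, ← this, ite_mul, one_mul, zero_mul]
      simp
  choose c hc0 hc1 hc using h
  refine ⟨fun ρ => ∑ ρ₀, c ρ₀ ρ, fun ρ => ?_, fun i => ?_⟩
  · exact (hc1 ρ).trans (Finset.single_le_sum (f := fun ρ₀ => c ρ₀ ρ)
      (fun ρ₀ _ => hc0 ρ₀ ρ) (Finset.mem_univ ρ))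
  · simp only [Finset.sum_mul]
    rw [Finset.sum_comm]
    exact Finset.sum_eq_zero fun ρ₀ _ => hc ρ₀ i

/-- Homomorphisms to a divisible group extend from the characters to `ℤ^{Σ(1)}`. -/
lemma exists_extension {D : Type*} [AddCommGroup D] [DivisibleBy D ℤ] {M : Type*}
    [AddCommGroup M] (j : M →+ (R → ℤ)) (hj : Function.Injective j) (f : M →+ D) :
    ∃ l : R → D, ∀ m, f m = ∑ ρ, j m ρ • l ρ := by
  obtain ⟨h, hh⟩ := (Module.Baer.of_divisible D).extension_property_addMonoidHom j hj f
  refine ⟨fun ρ => h (Pi.single ρ 1), fun m => ?_⟩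
  rw [← hh, AddMonoidHom.comp_apply]
  have : j m = ∑ ρ, j m ρ • (Pi.single ρ 1 : R → ℤ) := by
    ext ρ'
    simp [Finset.sum_apply, Pi.single_apply]
  conv_lhs => rw [this]
  rw [map_sum]
  exact Finset.sum_congr rfl fun ρ _ => map_zsmul _ _ _

/-- The unit group of an algebraically closed field of characteristic zero is divisible. -/
@[reducible]
def divisibleUnits [IsAlgClosed k] [CharZero k] : DivisibleBy (Additive kˣ) ℤ :=
  divisibleByOfSMulRightSurj _ _ fun {N} hN a => by
    obtain ⟨z, hz⟩ := IsAlgClosed.exists_pow_nat_eq (a.toMul : k)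
      (Int.natAbs_pos.mpr hN)
    have hz0 : z ≠ 0 := fun h => by
      rw [h, zero_pow (Int.natAbs_pos.mpr hN).ne'] at hz
      exact a.toMul.ne_zero hz.symm
    have hu : (Units.mk0 z hz0) ^ N.natAbs = a.toMul := Units.ext (by simpa using hz)
    rcases Int.natAbs_eq N with h | h
    · refine ⟨Additive.ofMul (Units.mk0 z hz0), ?_⟩
      dsimp only
      rw [h, natCast_zsmul, ← ofMul_pow, hu]; rfl
    · refine ⟨Additive.ofMul (Units.mk0 z hz0)⁻¹, ?_⟩
      dsimp only
      rw [h, neg_zsmul, natCast_zsmul, ofMul_inv, neg_nsmul, neg_neg, ← ofMul_pow, hu]; rfl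

/-- Every point is the image of a point of the Cox space with as few nonzero coordinates as
possible. -/
lemma Fan.IsComplete.exists_liesOver [IsAlgClosed k] [CharZero k] (hF : F.IsComplete)
    (x : Point F k) : ∃ z : R → k, LiesOver z x ∧ ∀ ρ, z ρ = 0 ↔ ρ ∈ x.cone := by
  classical
  let M : AddSubgroup (Fin n → ℤ) :=
    { carrier := F.perp x.cone
      zero_mem' := F.zero_mem_perp _
      add_mem' := F.add_mem_perp
      neg_mem' := F.neg_mem_perp }
  let f : M →+ Additive kˣ :=
    { toFun := fun m => Additive.ofMul (Units.mk0 (x.val m) (x.val_ne_zero m.2))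
      map_zero' := by
        rw [ofMul_eq_zero]; exact Units.ext (by simp [x.val_zero])
      map_add' := fun m m' => by
        rw [← ofMul_mul]
        congr 1
        exact Units.ext (by simp [x.val_add m m.2 m' m'.2]) }
  let _ := divisibleUnits (k := k)
  -- The values of `x` on `σ^⊥` extend to a homomorphism `ℤ^{Σ(1)} → kˣ`, which supplies the nonzero
  -- coordinates; those at the rays of the cone are set to zero.
  obtain ⟨l, hl⟩ := exists_extension ((divHom F).comp M.subtype)
    (hF.divHom_injective.comp Subtype.val_injective) f
  have hv : ∀ m (hm : m ∈ F.perp x.cone),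
      x.val m = ∏ ρ, ((l ρ).toMul : k) ^ (m ⬝ᵥ F.gen ρ) := by
    intro m hm
    have h := congrArg (fun a : Additive kˣ => ((a.toMul : kˣ) : k)) (hl ⟨m, hm⟩)
    simpa [f, divHom, toMul_sum, toMul_zsmul] using h
  have hz0 : ∀ ρ, (if ρ ∈ x.cone then (0 : k) else (l ρ).toMul) = 0 ↔ ρ ∈ x.cone := by
    intro ρ; split_ifs with h <;> simp [h]
  refine ⟨fun ρ => if ρ ∈ x.cone then 0 else (l ρ).toMul, ⟨x.cone, x.cone_mem,
    fun ρ => (hz0 ρ).mp, Finset.Subset.refl _, fun m hm => ?_⟩, hz0⟩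
  by_cases h : m ∈ F.perp x.cone
  · rw [hv m h]
    refine Finset.prod_congr rfl fun ρ _ => ?_
    dsimp only
    split_ifs with hρ
    · rw [h ρ hρ]; simp
    · rfl
  · rw [x.val_eq_zero _ h]
    by_contra h1
    exact h fun ρ hρ => (laurent_ne_zero_iff _ m).mp (Ne.symm h1) ρ ((hz0 ρ).mpr hρ)

end Complete

/-! ### The coordinate rings of the charts inside the group algebra of the character lattice -/

/-- The group algebra `k[M]`, the coordinate ring of the torus. -/
abbrev CharAlg (n : ℕ) (k : Type*) [Field k] : Type _ := AddMonoidAlgebra k (Fin n → ℤ)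

section Reg

variable {F : Fan n R}

/-- Evaluation of characters at a point, extended linearly. -/
def pev (x : Point F k) : CharAlg n k →ₗ[k] k :=
  Finsupp.linearCombination k x.val ∘ₗ (AddMonoidAlgebra.coeffLinearEquiv k).toLinearMap

lemma pev_apply (x : Point F k) (p : CharAlg n k) :
    pev x p = p.coeff.sum fun m c => c * x.val m := rfl

@[simp]
lemma pev_single (x : Point F k) (m : Fin n → ℤ) (c : k) :
    pev x (AddMonoidAlgebra.single m c) = c * x.val m := by
  rw [pev_apply, AddMonoidAlgebra.coeff_single, Finsupp.sum_single_index (zero_mul _)]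

@[simp]
lemma pev_one (x : Point F k) : pev x 1 = 1 := by
  rw [AddMonoidAlgebra.one_def, pev_single, x.val_zero, mul_one]

/-- The coordinate ring `k[σ^∨ ∩ M]` of the chart `U_σ`. -/
def Reg (F : Fan n R) (k : Type*) [Field k] (σ : Finset R) : Subalgebra k (CharAlg n k) where
  carrier := {p | ∀ m, p.coeff m ≠ 0 → m ∈ F.dual σ}
  mul_mem' := by
    intro p q hp hq m hm
    have h := AddMonoidAlgebra.support_coeff_mul_subset p q (Finsupp.mem_support_iff.mpr hm)
    obtain ⟨a, ha, b, hb, rfl⟩ := Finset.mem_add.mp h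
    exact F.add_mem_dual (hp a (Finsupp.mem_support_iff.mp ha))
      (hq b (Finsupp.mem_support_iff.mp hb))
  add_mem' := by
    intro p q hp hq m hm
    by_cases h : p.coeff m = 0
    · refine hq m fun h' => hm ?_
      rw [AddMonoidAlgebra.coeff_add, Finsupp.add_apply, h, h', add_zero]
    · exact hp m h
  algebraMap_mem' := by
    intro c m hm
    by_cases h : m = 0
    · rw [h]; exact F.zero_mem_dual σ
    · exfalso
      apply hm
      rw [AddMonoidAlgebra.coe_algebraMap]
      simp [Ne.symm h]

lemma Reg_anti {σ τ : Finset R} (h : τ ⊆ σ) : Reg F k σ ≤ Reg F k τ :=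
  fun _ hp m hm => F.dual_anti h (hp m hm)

lemma single_mem_Reg {σ : Finset R} {m : Fin n → ℤ} (hm : m ∈ F.dual σ) (c : k) :
    AddMonoidAlgebra.single m c ∈ Reg F k σ := by
  intro m' hm'
  rw [AddMonoidAlgebra.coeff_single, Finsupp.single_apply] at hm'
  split_ifs at hm' with h
  · exact h ▸ hm
  · exact absurd rfl hm'

lemma mem_Reg_empty (p : CharAlg n k) : p ∈ Reg F k ∅ :=
  fun _ _ ρ hρ => absurd hρ (Finset.notMem_empty ρ)

lemma pev_mul {σ : Finset R} {p q : CharAlg n k} (hp : p ∈ Reg F k σ) (hq : q ∈ Reg F k σ)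
    {x : Point F k} (hx : x ∈ chart F k σ) : pev x (p * q) = pev x p * pev x q := by
  rw [AddMonoidAlgebra.mul_def, pev_apply x p, pev_apply x q]
  simp only [Finsupp.sum, map_sum, pev_single, Finset.sum_mul_sum]
  refine Finset.sum_congr rfl fun m hm => Finset.sum_congr rfl fun m' hm' => ?_
  rw [x.val_add_dual (F.dual_anti hx (hp m (Finsupp.mem_support_iff.mp hm)))
    (F.dual_anti hx (hq m' (Finsupp.mem_support_iff.mp hm')))]
  ring

lemma pev_mul_torus (p q : CharAlg n k) {x : Point F k} (hx : x ∈ torus F k) :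
    pev x (p * q) = pev x p * pev x q :=
  pev_mul (mem_Reg_empty p) (mem_Reg_empty q) (mem_chart.mpr (mem_torus.mp hx).subset)

/-- An element of the coordinate ring in the sense of `evalAt`. -/
lemma exists_Reg_of_finsupp {σ : Finset R} (P : F.dual σ →₀ k) :
    ∃ p ∈ Reg F k σ, ∀ x : Point F k, pev x p = evalAt P x := by
  refine ⟨AddMonoidAlgebra.ofCoeff (P.mapDomain Subtype.val), fun m hm => ?_, fun x => ?_⟩
  · by_contra h
    apply hm
    rw [AddMonoidAlgebra.coeff_ofCoeff, Finsupp.mapDomain_of_notMem_range]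
    rintro ⟨m', rfl⟩
    exact h m'.2
  · rw [pev_apply, AddMonoidAlgebra.coeff_ofCoeff, Finsupp.sum_mapDomain_index
      (fun _ => zero_mul _) (fun _ _ _ => add_mul _ _ _)]
    rfl

lemma exists_finsupp_of_Reg {σ : Finset R} {p : CharAlg n k} (hp : p ∈ Reg F k σ) :
    ∃ P : F.dual σ →₀ k, ∀ x : Point F k, evalAt P x = pev x p := by
  refine ⟨p.coeff.subtypeDomain (· ∈ F.dual σ), fun x => ?_⟩
  rw [pev_apply]
  exact Finsupp.sum_subtypeDomain_index (h := fun m c => c * x.val m)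
    fun m hm => hp m (Finsupp.mem_support_iff.mp hm)

lemma isOpen_basic {σ : Finset R} (hσ : σ ∈ F.cones) {p : CharAlg n k} (hp : p ∈ Reg F k σ) :
    IsOpen {x : Point F k | x ∈ chart F k σ ∧ pev x p ≠ 0} := by
  obtain ⟨P, hP⟩ := exists_finsupp_of_Reg hp
  refine TopologicalSpace.isOpen_generateFrom_of_mem ⟨σ, hσ, P, ?_⟩
  ext x
  simp only [Set.mem_ofPred_eq, hP]

lemma isOpen_chart {σ : Finset R} (hσ : σ ∈ F.cones) : IsOpen (chart F k σ) := by
  have := isOpen_basic hσ (one_mem (Reg F k σ))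
  simpa using this

lemma isOpen_torus : IsOpen (torus F k) := by
  rw [torus_eq_chart]; exact isOpen_chart F.empty_mem

/-- The principal open subsets of `U_σ`, with `σ` the cone of `x`, are a base at `x`. -/
lemma exists_basic_nhd {V : Set (Point F k)} (hV : IsOpen V) {x : Point F k} (hx : x ∈ V) :
    ∃ b ∈ Reg F k x.cone, pev x b ≠ 0 ∧ ∀ y ∈ chart F k x.cone, pev y b ≠ 0 → y ∈ V := by
  induction hV with
  | basic D hD =>
    obtain ⟨σ, hσ, Q, rfl⟩ := hD
    obtain ⟨q, hq, hqQ⟩ := exists_Reg_of_finsupp Q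
    refine ⟨q, Reg_anti hx.1 hq, by rw [hqQ]; exact hx.2, fun y hy h => ⟨?_, ?_⟩⟩
    · exact (mem_chart.mp hy).trans (mem_chart.mp hx.1)
    · rwa [← hqQ]
  | univ => exact ⟨1, one_mem _, by simp, fun y _ _ => trivial⟩
  | inter s t _ _ hs ht =>
    obtain ⟨b, hb, hbx, hbV⟩ := hs hx.1
    obtain ⟨c, hc, hcx, hcV⟩ := ht hx.2
    refine ⟨b * c, mul_mem hb hc, ?_, fun y hy h => ?_⟩
    · rw [pev_mul hb hc (Finset.Subset.refl _)]; exact mul_ne_zero hbx hcx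
    · rw [pev_mul hb hc hy] at h
      exact ⟨hbV y hy (left_ne_zero_of_mul h), hcV y hy (right_ne_zero_of_mul h)⟩
  | sUnion S _ hS =>
    obtain ⟨s, hs, hxs⟩ := hx
    obtain ⟨b, hb, hbx, hbV⟩ := hS s hs hxs
    exact ⟨b, hb, hbx, fun y hy h => ⟨s, hs, hbV y hy h⟩⟩

/-! ### Regularity at a point -/

/-- `φ` is regular at `x`. -/
def RegularAt (φ : Point F k → k) (x : Point F k) : Prop :=
  ∃ p ∈ Reg F k x.cone, ∃ q ∈ Reg F k x.cone, pev x q ≠ 0 ∧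
    ∀ y ∈ chart F k x.cone, pev y q ≠ 0 → φ y * pev y q = pev y p

lemma regularOn_iff {V : Set (Point F k)} (hV : IsOpen V) (φ : Point F k → k) :
    RegularOn φ V ↔ ∀ x ∈ V, RegularAt φ x := by
  constructor
  · intro h x hx
    obtain ⟨σ, hσ, hxσ, P, Q, hQ, hPQ⟩ := h x hx
    obtain ⟨b, hb, hbx, hbV⟩ := exists_basic_nhd hV hx
    obtain ⟨p, hp, hpP⟩ := exists_Reg_of_finsupp P
    obtain ⟨q, hq, hqQ⟩ := exists_Reg_of_finsupp Q
    have hp := Reg_anti hxσ hp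
    have hq := Reg_anti hxσ hq
    refine ⟨p * b, mul_mem hp hb, q * b, mul_mem hq hb, ?_, fun y hy h => ?_⟩
    · rw [pev_mul hq hb (Finset.Subset.refl _), hqQ]; exact mul_ne_zero hQ hbx
    · rw [pev_mul hq hb hy] at h ⊢
      rw [pev_mul hp hb hy, ← mul_assoc]
      congr 1
      rw [hqQ, hpP]
      exact hPQ y (hbV y hy (right_ne_zero_of_mul h)) ((mem_chart.mp hy).trans hxσ)
        (by rw [← hqQ]; exact left_ne_zero_of_mul h)
  · intro h x hx
    obtain ⟨p, hp, q, hq, hqx, hpq⟩ := h x hx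
    obtain ⟨P, hP⟩ := exists_finsupp_of_Reg hp
    obtain ⟨Q, hQ⟩ := exists_finsupp_of_Reg hq
    refine ⟨x.cone, x.cone_mem, Finset.Subset.refl _, P, Q, by rwa [hQ], fun y _ hy h => ?_⟩
    rw [hQ] at h ⊢
    rw [hP]
    exact hpq y hy h

lemma RegularAt.mem_nhd {V : Set (Point F k)} (hV : IsOpen V) {φ : Point F k → k} {x : Point F k}
    (hx : x ∈ V) (h : RegularAt φ x) : ∃ p ∈ Reg F k x.cone, ∃ q ∈ Reg F k x.cone, pev x q ≠ 0 ∧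
    ∀ y ∈ chart F k x.cone, pev y q ≠ 0 → y ∈ V ∧ φ y * pev y q = pev y p := by
  obtain ⟨p, hp, q, hq, hqx, hpq⟩ := h
  obtain ⟨b, hb, hbx, hbV⟩ := exists_basic_nhd hV hx
  refine ⟨p * b, mul_mem hp hb, q * b, mul_mem hq hb, ?_, fun y hy h => ?_⟩
  · rw [pev_mul hq hb (Finset.Subset.refl _)]; exact mul_ne_zero hqx hbx
  · rw [pev_mul hq hb hy] at h ⊢
    rw [pev_mul hp hb hy, ← mul_assoc, hpq y hy (left_ne_zero_of_mul h)]
    exact ⟨hbV y hy (right_ne_zero_of_mul h), rfl⟩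

lemma regularAt_pev {σ : Finset R} {p : CharAlg n k} (hp : p ∈ Reg F k σ) {x : Point F k}
    (hx : x ∈ chart F k σ) : RegularAt (fun y => pev y p) x :=
  ⟨p, Reg_anti hx hp, 1, one_mem _, by simp, fun _ _ _ => by simp⟩

lemma regularAt_div {σ : Finset R} {p q : CharAlg n k} (hp : p ∈ Reg F k σ) (hq : q ∈ Reg F k σ)
    {x : Point F k} (hx : x ∈ chart F k σ) (hqx : pev x q ≠ 0) :
    RegularAt (fun y => pev y p / pev y q) x :=
  ⟨p, Reg_anti hx hp, q, Reg_anti hx hq, hqx, fun _ _ h => div_mul_cancel₀ _ h⟩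

lemma RegularAt.mul {φ ψ : Point F k → k} {x : Point F k} (hφ : RegularAt φ x)
    (hψ : RegularAt ψ x) : RegularAt (fun y => φ y * ψ y) x := by
  obtain ⟨p, hp, q, hq, hqx, hpq⟩ := hφ
  obtain ⟨p', hp', q', hq', hqx', hpq'⟩ := hψ
  refine ⟨p * p', mul_mem hp hp', q * q', mul_mem hq hq', ?_, fun y hy h => ?_⟩
  · rw [pev_mul hq hq' (Finset.Subset.refl _)]; exact mul_ne_zero hqx hqx'
  · rw [pev_mul hq hq' hy] at h ⊢
    rw [pev_mul hp hp' hy, ← hpq y hy (left_ne_zero_of_mul h),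
      ← hpq' y hy (right_ne_zero_of_mul h)]
    ring

lemma RegularAt.sub {φ ψ : Point F k → k} {x : Point F k} (hφ : RegularAt φ x)
    (hψ : RegularAt ψ x) : RegularAt (fun y => φ y - ψ y) x := by
  obtain ⟨p, hp, q, hq, hqx, hpq⟩ := hφ
  obtain ⟨p', hp', q', hq', hqx', hpq'⟩ := hψ
  refine ⟨p * q' - q * p', sub_mem (mul_mem hp hq') (mul_mem hq hp'), q * q', mul_mem hq hq', ?_,
    fun y hy h => ?_⟩
  · rw [pev_mul hq hq' (Finset.Subset.refl _)]; exact mul_ne_zero hqx hqx'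
  · rw [pev_mul hq hq' hy] at h ⊢
    rw [map_sub, pev_mul hp hq' hy, pev_mul hq hp' hy, ← hpq y hy (left_ne_zero_of_mul h),
      ← hpq' y hy (right_ne_zero_of_mul h)]
    ring

lemma RegularAt.const_mul {φ : Point F k → k} {x : Point F k} (hφ : RegularAt φ x) (c : k) :
    RegularAt (fun y => c * φ y) x := by
  obtain ⟨p, hp, q, hq, hqx, hpq⟩ := hφ
  refine ⟨c • p, Subalgebra.smul_mem _ hp c, q, hq, hqx, fun y hy h => ?_⟩
  rw [map_smul, smul_eq_mul, ← hpq y hy h, mul_assoc]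

/-- Morphisms are tested on open sets, so regularity at `g x` is first spread over the principal
open set where the denominator is nonzero. -/
lemma RegularAt.comp {g : Point F k → Point F k} (hg : IsMorphism g) {φ : Point F k → k}
    {x : Point F k} (hφ : RegularAt φ (g x)) : RegularAt (fun y => φ (g y)) x := by
  obtain ⟨p, hp, q, hq, hqx, hpq⟩ := hφ
  have hV := isOpen_basic (k := k) (g x).cone_mem hq
  have hreg : RegularOn φ {y | y ∈ chart F k (g x).cone ∧ pev y q ≠ 0} := by
    rw [regularOn_iff hV]
    intro y hy
    exact ⟨p, Reg_anti hy.1 hp, q, Reg_anti hy.1 hq, hy.2,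
      fun z hz h => hpq z ((mem_chart.mp hz).trans hy.1) h⟩
  exact (regularOn_iff (hV.preimage hg.1) _).mp (hg.2 _ _ hV hreg) x ⟨Finset.Subset.refl _, hqx⟩

end Reg

/-! ### Characters and functions on `X` in Cox coordinates -/

section Cox

variable {F : Fan n R}

lemma weight_varDeg (e : R →₀ ℕ) :
    Finsupp.weight (varDeg F) e = (QuotientAddGroup.mk (fun ρ => (e ρ : ℤ)) : Cl F) := by
  rw [Finsupp.weight_apply, Finsupp.sum_fintype _ _ (fun ρ => zero_smul ℕ (varDeg F ρ))]
  have : (fun ρ => (e ρ : ℤ)) = ∑ ρ, e ρ • (Pi.single ρ 1 : R → ℤ) := by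
    ext ρ'; simp [Finset.sum_apply, Pi.single_apply]
  rw [this]
  change _ = QuotientAddGroup.mk' _ _
  rw [map_sum]
  refine Finset.sum_congr rfl fun ρ _ => ?_
  rw [map_nsmul]; rfl

/-- The exponent of the character `m` times the `N`-th power of the product of the variables
outside `σ`. -/
def expo (F : Fan n R) (σ : Finset R) (N : ℕ) (m : Fin n → ℤ) : R →₀ ℕ :=
  Finsupp.equivFunOnFinite.symm fun ρ => (m ⬝ᵥ F.gen ρ + if ρ ∈ σ then 0 else (N : ℤ)).toNat

lemma expo_apply (σ : Finset R) (N : ℕ) (m : Fin n → ℤ) (ρ : R) :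
    expo F σ N m ρ = (m ⬝ᵥ F.gen ρ + if ρ ∈ σ then 0 else (N : ℤ)).toNat := rfl

/-- The polynomial on the Cox space that represents an element of the coordinate ring of `U_σ`
times the `N`-th power of the product of the variables outside `σ`. -/
def coxPoly (F : Fan n R) (σ : Finset R) (N : ℕ) (p : CharAlg n k) : MvPolynomial R k :=
  p.coeff.sum fun m c => monomial (expo F σ N m) c

/-- `N` is large enough to clear the denominators of `p`. -/
def Clears (F : Fan n R) (N : ℕ) (p : CharAlg n k) : Prop :=
  ∀ m, p.coeff m ≠ 0 → ∀ ρ, -(N : ℤ) ≤ m ⬝ᵥ F.gen ρ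

lemma exists_clears (F : Fan n R) (p : CharAlg n k) : ∃ N₀, ∀ N ≥ N₀, Clears F N p := by
  refine ⟨∑ m ∈ p.coeff.support, ∑ ρ, (m ⬝ᵥ F.gen ρ).natAbs, fun N hN m hm ρ => ?_⟩
  have h1 : (m ⬝ᵥ F.gen ρ).natAbs ≤ ∑ ρ, (m ⬝ᵥ F.gen ρ).natAbs :=
    Finset.single_le_sum (f := fun ρ => (m ⬝ᵥ F.gen ρ).natAbs) (fun _ _ => Nat.zero_le _)
      (Finset.mem_univ ρ)
  have h2 : ∑ ρ, (m ⬝ᵥ F.gen ρ).natAbs ≤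
      ∑ m ∈ p.coeff.support, ∑ ρ, (m ⬝ᵥ F.gen ρ).natAbs :=
    Finset.single_le_sum (f := fun m => ∑ ρ, (m ⬝ᵥ F.gen ρ).natAbs) (fun _ _ => Nat.zero_le _)
      (Finsupp.mem_support_iff.mpr hm)
  omega

lemma exists_clears₂ (F : Fan n R) (p q : CharAlg n k) : ∃ N, Clears F N p ∧ Clears F N q := by
  obtain ⟨N, hN⟩ := exists_clears F p
  obtain ⟨N', hN'⟩ := exists_clears F q
  exact ⟨max N N', hN _ (le_max_left _ _), hN' _ (le_max_right _ _)⟩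

/-- Under these bounds the truncation `toNat` in `expo` has no effect: exponents inside `σ` are
non-negative by duality, those outside by the choice of `N`. -/
lemma expo_cast {σ : Finset R} {N : ℕ} {m : Fin n → ℤ} (hm : m ∈ F.dual σ)
    (hN : ∀ ρ, -(N : ℤ) ≤ m ⬝ᵥ F.gen ρ) (ρ : R) :
    (expo F σ N m ρ : ℤ) = m ⬝ᵥ F.gen ρ + if ρ ∈ σ then 0 else (N : ℤ) := by
  rw [expo_apply, Int.toNat_of_nonneg]
  have := hN ρ
  split_ifs with h
  · have := hm ρ h; omega
  · omega

/-- The degree of the product of the variables outside `σ`. -/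
def complDeg (F : Fan n R) (σ : Finset R) : Cl F := ∑ ρ ∈ σᶜ, varDeg F ρ

/-- Divisors of characters are trivial in the class group, so only `N` and `σ` matter; this is what
makes `coxPoly` homogeneous. -/
lemma weight_expo {σ : Finset R} {N : ℕ} {m : Fin n → ℤ} (hm : m ∈ F.dual σ)
    (hN : ∀ ρ, -(N : ℤ) ≤ m ⬝ᵥ F.gen ρ) :
    Finsupp.weight (varDeg F) (expo F σ N m) = N • complDeg F σ := by
  have h1 : N • complDeg F σ =
      (QuotientAddGroup.mk (fun ρ => if ρ ∈ σ then 0 else (N : ℤ)) : Cl F) := by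
    have : (fun ρ => if ρ ∈ σ then 0 else (N : ℤ)) =
        N • ∑ ρ ∈ σᶜ, (Pi.single ρ 1 : R → ℤ) := by
      ext ρ'
      simp [Finset.sum_apply, Pi.single_apply]
    rw [this]
    change _ = QuotientAddGroup.mk' _ _
    rw [map_nsmul, map_sum]; rfl
  rw [weight_varDeg, h1, QuotientAddGroup.eq]
  refine ⟨-m, funext fun ρ => ?_⟩
  change -m ⬝ᵥ F.gen ρ = -(expo F σ N m ρ : ℤ) + _
  rw [expo_cast hm hN, neg_dotProduct]
  ring

lemma isWeightedHomogeneous_coxPoly {σ : Finset R} {N : ℕ} {p : CharAlg n k}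
    (hp : p ∈ Reg F k σ) (hN : Clears F N p) :
    IsWeightedHomogeneous (varDeg F) (coxPoly F σ N p) (N • complDeg F σ) := by
  refine IsWeightedHomogeneous.sum _ _ _ fun m hm => ?_
  have hm := Finsupp.mem_support_iff.mp hm
  exact isWeightedHomogeneous_monomial _ _ _ (weight_expo (hp m hm) (hN m hm))

lemma prod_pow_expo {σ : Finset R} {N : ℕ} {m : Fin n → ℤ} (hm : m ∈ F.dual σ)
    (hN : ∀ ρ, -(N : ℤ) ≤ m ⬝ᵥ F.gen ρ) {z : R → k} (hz : ∀ ρ, z ρ = 0 → ρ ∈ σ) :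
    ∏ ρ, z ρ ^ expo F σ N m ρ = laurent F z m * (∏ ρ ∈ σᶜ, z ρ) ^ N := by
  have : (∏ ρ ∈ σᶜ, z ρ) ^ N = ∏ ρ, z ρ ^ (if ρ ∈ σ then 0 else (N : ℤ)) := by
    rw [← Finset.prod_pow, ← Finset.prod_subset (Finset.subset_univ σᶜ)]
    · exact Finset.prod_congr rfl fun ρ hρ => by
        rw [if_neg (Finset.mem_compl.mp hρ), zpow_natCast]
    · intro ρ _ hρ
      rw [if_pos (by simpa using hρ), zpow_zero]
  rw [this, laurent, ← Finset.prod_mul_distrib]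
  refine Finset.prod_congr rfl fun ρ _ => ?_
  rw [← zpow_natCast, expo_cast hm hN]
  split_ifs with h
  · simp
  · exact zpow_add₀ (fun h0 => h (hz ρ h0)) _ _

lemma eval_coxPoly {σ : Finset R} {N : ℕ} {p : CharAlg n k} (hp : p ∈ Reg F k σ)
    (hN : Clears F N p) {z : R → k} {x : Point F k} (hzx : LiesOver z x) (hx : x ∈ chart F k σ) :
    eval z (coxPoly F σ N p) = pev x p * (∏ ρ ∈ σᶜ, z ρ) ^ N := by
  rw [coxPoly, pev_apply, Finsupp.sum, map_sum, Finsupp.sum, Finset.sum_mul]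
  refine Finset.sum_congr rfl fun m hm => ?_
  have hm := Finsupp.mem_support_iff.mp hm
  rw [eval_monomial, Finsupp.prod_fintype _ _ (fun _ => pow_zero _),
    prod_pow_expo (hp m hm) (hN m hm) (fun ρ h => mem_chart.mp hx (hzx.zeros_subset ρ h)),
    hzx.val_eq' hx (hp m hm), mul_assoc]

/-- The product of the variables outside `σ`. -/
def complProd (k : Type*) [Field k] (σ : Finset R) : MvPolynomial R k := ∏ ρ ∈ σᶜ, X ρ

lemma eval_complProd (σ : Finset R) (z : R → k) :
    eval z (complProd k σ) = ∏ ρ ∈ σᶜ, z ρ := by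
  simp [complProd, map_prod]

lemma eval_complProd_ne_zero {σ : Finset R} {z : R → k} :
    eval z (complProd k σ) ≠ 0 ↔ ∀ ρ, z ρ = 0 → ρ ∈ σ := by
  rw [eval_complProd, Finset.prod_ne_zero_iff]
  constructor
  · intro h ρ h0
    by_contra h1
    exact h ρ (Finset.mem_compl.mpr h1) h0
  · intro h ρ hρ h0
    exact Finset.mem_compl.mp hρ (h ρ h0)

lemma isWeightedHomogeneous_complProd (σ : Finset R) :
    IsWeightedHomogeneous (varDeg F) (complProd k σ) (complDeg F σ) :=
  IsWeightedHomogeneous.prod _ _ _ fun _ρ _ => isWeightedHomogeneous_X _ _ _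

lemma complProd_ne_zero (σ : Finset R) : complProd k σ ≠ 0 :=
  Finset.prod_ne_zero_iff.mpr fun _ _ => X_ne_zero _

/-- A polynomial that vanishes at the generic point of the torus vanishes. -/
lemma poly_eq_zero_of_generic [Infinite k] {P B : MvPolynomial R k} (hB : B ≠ 0)
    (h : ∀ z : R → k, (∀ ρ, z ρ ≠ 0) → eval z B ≠ 0 → eval z P = 0) : P = 0 := by
  -- Multiplying by `B` and by all the variables turns generic vanishing into vanishing everywhere.
  have h1 : P * (B * complProd k ∅) = 0 := by
    refine MvPolynomial.funext fun z => ?_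
    rw [map_zero, map_mul, map_mul]
    by_cases h2 : eval z (complProd k (∅ : Finset R)) = 0
    · rw [h2, mul_zero, mul_zero]
    by_cases h3 : eval z B = 0
    · rw [h3, zero_mul, mul_zero]
    rw [h z (fun ρ h0 => absurd (eval_complProd_ne_zero.mp h2 ρ h0) (Finset.notMem_empty _)) h3,
      zero_mul]
  rcases mul_eq_zero.mp h1 with h | h
  · exact h
  · exact absurd h (mul_ne_zero hB (complProd_ne_zero _))

lemma exists_torus_eval_ne_zero [Infinite k] {B : MvPolynomial R k} (hB : B ≠ 0) :
    ∃ z : R → k, (∀ ρ, z ρ ≠ 0) ∧ eval z B ≠ 0 := by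
  by_contra! h
  exact hB (poly_eq_zero_of_generic (B := 1) one_ne_zero fun z hz _ => h z hz)

/-- On a complete fan a character is determined by its divisor, so distinct characters give distinct
exponents and nothing cancels. -/
lemma coxPoly_ne_zero (hF : F.IsComplete) {σ : Finset R} {N : ℕ} {p : CharAlg n k}
    (hp : p ∈ Reg F k σ) (hN : Clears F N p) (h0 : p ≠ 0) : coxPoly F σ N p ≠ 0 := by
  have : ∃ m, p.coeff m ≠ 0 := by
    by_contra! h
    exact h0 (AddMonoidAlgebra.coeff_eq_zero.mp (Finsupp.ext h))
  obtain ⟨m₀, hm₀⟩ := this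
  intro h
  apply hm₀
  have h1 := congrArg (coeff (expo F σ N m₀)) h
  rw [coxPoly, Finsupp.sum, coeff_sum, coeff_zero,
    Finset.sum_eq_single_of_mem m₀ (Finsupp.mem_support_iff.mpr hm₀), coeff_monomial,
    if_pos rfl] at h1
  · exact h1
  · intro m hm hne
    have hm := Finsupp.mem_support_iff.mp hm
    rw [coeff_monomial, if_neg]
    intro heq
    apply hne
    apply hF.divHom_injective
    funext ρ
    have h2 : (expo F σ N m ρ : ℤ) = expo F σ N m₀ ρ := by rw [heq]
    rw [expo_cast (hp m hm) (hN m hm), expo_cast (hp m₀ hm₀) (hN m₀ hm₀)] at h2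
    exact add_right_cancel h2

/-- A nonzero Laurent polynomial does not vanish on the whole torus. -/
lemma exists_torus_pev_ne_zero [Infinite k] (hF : F.IsComplete) {p : CharAlg n k} (h0 : p ≠ 0) :
    ∃ x ∈ torus F k, pev x p ≠ 0 := by
  obtain ⟨N, hN⟩ := exists_clears F p
  have hN := hN N le_rfl
  obtain ⟨z, hz, hz'⟩ := exists_torus_eval_ne_zero
    (coxPoly_ne_zero hF (mem_Reg_empty p) hN h0)
  obtain ⟨x, hx, hzx⟩ := exists_liesOver_torus_point (F := F) hz
  rw [eval_coxPoly (mem_Reg_empty p) hN hzx (torus_subset_chart _ hx)] at hz'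
  exact ⟨x, hx, left_ne_zero_of_mul hz'⟩

lemma pev_eq_zero_of_generic [Infinite k] (hF : F.IsComplete) {p b : CharAlg n k} (hb : b ≠ 0)
    (h : ∀ x ∈ torus F k, pev x b ≠ 0 → pev x p = 0) : p = 0 := by
  by_contra h0
  obtain ⟨x, hx, hx'⟩ := exists_torus_pev_ne_zero hF (mul_ne_zero h0 hb)
  rw [pev_mul_torus _ _ hx] at hx'
  exact left_ne_zero_of_mul hx' (h x hx (right_ne_zero_of_mul hx'))

lemma ne_zero_of_pev {p : CharAlg n k} {x : Point F k} (h : pev x p ≠ 0) : p ≠ 0 := by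
  rintro rfl; simp at h

/-- `X` is irreducible: nonempty open sets contain a principal open subset of the torus. -/
lemma exists_torus_subset {V : Set (Point F k)} (hV : IsOpen V) (hne : V.Nonempty) :
    ∃ b : CharAlg n k, b ≠ 0 ∧ ∀ y ∈ torus F k, pev y b ≠ 0 → y ∈ V := by
  obtain ⟨x, hx⟩ := hne
  obtain ⟨b, -, hbx, hbV⟩ := exists_basic_nhd hV hx
  exact ⟨b, ne_zero_of_pev hbx, fun y hy => hbV y (torus_subset_chart _ hy)⟩

lemma inter_open_nonempty [Infinite k] (hF : F.IsComplete) {V W : Set (Point F k)}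
    (hV : IsOpen V) (hne : V.Nonempty) (hW : IsOpen W) (hne' : W.Nonempty) :
    (V ∩ W).Nonempty := by
  obtain ⟨b, hb, hbV⟩ := exists_torus_subset hV hne
  obtain ⟨c, hc, hcW⟩ := exists_torus_subset hW hne'
  obtain ⟨x, hx, hx'⟩ := exists_torus_pev_ne_zero hF (mul_ne_zero hb hc)
  rw [pev_mul_torus _ _ hx] at hx'
  exact ⟨x, hbV x hx (left_ne_zero_of_mul hx'), hcW x hx (right_ne_zero_of_mul hx')⟩

/-- A regular function in Cox coordinates is a quotient of polynomials of the same degree. -/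
lemma RegularAt.exists_cox {V : Set (Point F k)} (hV : IsOpen V) {φ : Point F k → k}
    {x : Point F k} (hx : x ∈ V) (h : RegularAt φ x) :
    ∃ (β : Cl F) (A B : MvPolynomial R k), IsWeightedHomogeneous (varDeg F) A β ∧
      IsWeightedHomogeneous (varDeg F) B β ∧ (∀ z, LiesOver z x → eval z B ≠ 0) ∧
      ∀ z y, LiesOver z y → eval z B ≠ 0 → y ∈ V ∧ φ y * eval z B = eval z A := by
  obtain ⟨p, hp, q, hq, hqx, hpq⟩ := h.mem_nhd hV hx
  obtain ⟨N, hNp, hNq⟩ := exists_clears₂ F p q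
  -- The extra factor `complProd` ensures that a nonvanishing denominator puts the point below into
  -- the chart on which `p / q` represents the function.
  refine ⟨_, coxPoly F x.cone N p * complProd k x.cone, coxPoly F x.cone N q * complProd k x.cone,
    (isWeightedHomogeneous_coxPoly hp hNp).mul (isWeightedHomogeneous_complProd _),
    (isWeightedHomogeneous_coxPoly hq hNq).mul (isWeightedHomogeneous_complProd _), ?_, ?_⟩
  · intro z hz
    have h1 := eval_complProd_ne_zero.mpr hz.zeros_subset
    rw [map_mul, eval_coxPoly hq hNq hz (Finset.Subset.refl _), ← eval_complProd]
    exact mul_ne_zero (mul_ne_zero hqx (pow_ne_zero _ h1)) h1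
  · intro z y hz hB
    rw [map_mul] at hB
    have hy : y ∈ chart F k x.cone :=
      hz.cone_subset x.cone_mem (eval_complProd_ne_zero.mp (right_ne_zero_of_mul hB))
    rw [eval_coxPoly hq hNq hz hy] at hB
    obtain ⟨h1, h2⟩ := hpq y hy (left_ne_zero_of_mul (left_ne_zero_of_mul hB))
    refine ⟨h1, ?_⟩
    rw [map_mul, map_mul, eval_coxPoly hq hNq hz hy, eval_coxPoly hp hNp hz hy, ← h2]
    ring

/-- The identity theorem. -/
lemma eq_zero_of_generic [IsAlgClosed k] [CharZero k] (hF : F.IsComplete)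
    {V : Set (Point F k)} (hV : IsOpen V) {φ : Point F k → k} (hφ : ∀ x ∈ V, RegularAt φ x)
    {B : MvPolynomial R k} (hB : B ≠ 0)
    (h : ∀ z, ∀ y ∈ V, y ∈ torus F k → LiesOver z y → eval z B ≠ 0 → φ y = 0) :
    ∀ x ∈ V, φ x = 0 := by
  intro x hx
  obtain ⟨β, A, D, -, -, hD, hAD⟩ := (hφ x hx).exists_cox hV hx
  obtain ⟨z, hz, -⟩ := hF.exists_liesOver x
  have hD0 : D ≠ 0 := by
    rintro rfl; exact hD z hz (map_zero _)
  have hA : A = 0 := by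
    refine poly_eq_zero_of_generic (mul_ne_zero hB hD0) fun w hw hw' => ?_
    rw [map_mul] at hw'
    obtain ⟨y, hy, hwy⟩ := exists_liesOver_torus_point (F := F) hw
    obtain ⟨hyV, h1⟩ := hAD w y hwy (right_ne_zero_of_mul hw')
    rw [← h1, h w y hyV hy hwy (left_ne_zero_of_mul hw'), zero_mul]
  have h1 := (hAD z x hz (hD z hz)).2
  rw [hA, map_zero] at h1
  exact (mul_eq_zero.mp h1).resolve_right (hD z hz)

end Cox

/-! ### Dehomogenization -/

/-- The invariant derivation of `k[M]` with `χ^m ↦ l m · χ^m`. -/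
def logDer (l : (Fin n → ℤ) →+ k) : Derivation k (CharAlg n k) (CharAlg n k) :=
  Derivation.mk' (Finsupp.linearCombination k (fun m => AddMonoidAlgebra.single m (l m)) ∘ₗ
    (AddMonoidAlgebra.coeffLinearEquiv k).toLinearMap) <| by
    intro p q
    induction p using AddMonoidAlgebra.induction_linear with
    | zero => simp
    | add p p' hp hp' => rw [add_mul, map_add, hp, hp', map_add, smul_add, add_smul]; abel
    | single m c =>
      induction q using AddMonoidAlgebra.induction_linear with
      | zero => simp
      | add q q' hq hq' => rw [mul_add, map_add, hq, hq', map_add, smul_add, add_smul]; abel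
      | single m' c' =>
        simp only [AddMonoidAlgebra.single_mul_single, LinearMap.comp_apply,
          LinearEquiv.coe_coe, AddMonoidAlgebra.coeffLinearEquiv_apply,
          AddMonoidAlgebra.coeff_single, Finsupp.linearCombination_single,
          AddMonoidAlgebra.smul_single, smul_eq_mul, map_add]
        rw [add_comm m' m, ← AddMonoidAlgebra.single_add]
        congr 1
        ring

@[simp]
lemma logDer_single (l : (Fin n → ℤ) →+ k) (m : Fin n → ℤ) (c : k) :
    logDer l (AddMonoidAlgebra.single m c) = AddMonoidAlgebra.single m (c * l m) := by
  change Finsupp.linearCombination k _ (Finsupp.single m c) = _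
  rw [Finsupp.linearCombination_single, AddMonoidAlgebra.smul_single, smul_eq_mul]

/-- The pairing of characters with the ray generator `u_ρ`, with values in `k`. -/
def pairing (F : Fan n R) (k : Type*) [Field k] (ρ : R) : (Fin n → ℤ) →+ k where
  toFun m := ((m ⬝ᵥ F.gen ρ : ℤ) : k)
  map_zero' := by simp
  map_add' m m' := by rw [add_dotProduct]; push_cast; rfl

section Dehom

variable {F : Fan n R}

lemma laurent_mul_prod_zpow {σ : Finset R} {b : R → ℤ} (hbσ : ∀ ρ ∈ σ, b ρ = 0)
    {m : Fin n → ℤ} {e : R →₀ ℕ} (hm : ∀ ρ, m ⬝ᵥ F.gen ρ = e ρ - b ρ) {w : R → k}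
    (hw : ∀ ρ, w ρ = 0 → ρ ∈ σ) :
    laurent F w m * ∏ ρ, w ρ ^ b ρ = ∏ ρ, w ρ ^ e ρ := by
  rw [laurent, ← Finset.prod_mul_distrib]
  refine Finset.prod_congr rfl fun ρ _ => ?_
  rw [hm]
  by_cases h : w ρ = 0
  · rw [hbσ ρ (hw ρ h)]; simp
  · rw [← zpow_add₀ h, sub_add_cancel, zpow_natCast]

lemma eval_monomial' (w : R → k) (e : R →₀ ℕ) (c : k) :
    eval w (monomial e c) = c * ∏ ρ, w ρ ^ e ρ := by
  rw [eval_monomial, Finsupp.prod_fintype _ _ (fun _ => pow_zero _)]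

lemma eval_X_mul_pderiv_monomial (w : R → k) (e : R →₀ ℕ) (c : k) (ρ : R) :
    w ρ * eval w (pderiv ρ (monomial e c)) = e ρ * eval w (monomial e c) := by
  have h := congrArg (eval w) (X_mul_pderiv_monomial (i := ρ) (m := e) (r := c))
  rw [map_mul, eval_X, map_nsmul, nsmul_eq_mul] at h
  exact h

/-- The function `P / x^b` on `U_σ`, for `P` of the same degree as the Laurent monomial `x^b` that
only involves variables outside `σ`. -/
lemma exists_dehom {σ : Finset R} {β : Cl F} {b : R → ℤ} (hb : (QuotientAddGroup.mk b : Cl F) = β)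
    (hbσ : ∀ ρ ∈ σ, b ρ = 0) {P : MvPolynomial R k}
    (hP : IsWeightedHomogeneous (varDeg F) P β) :
    ∃ φ ∈ Reg F k σ,
      (∀ x ∈ chart F k σ, ∀ w, LiesOver w x → pev x φ * ∏ ρ, w ρ ^ b ρ = eval w P) ∧
      ∀ ρ, ∀ x ∈ torus F k, ∀ w, LiesOver w x → pev x (logDer (pairing F k ρ) φ) * ∏ ρ, w ρ ^ b ρ =
        w ρ * eval w (pderiv ρ P) - (b ρ : k) * eval w P := by
  -- Monomials of `P` have the class of `b`, so `x^(e - b)` is the pull-back of a character. The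
  -- character `0` for exponents outside `P` is a dummy.
  have h : ∀ e : R →₀ ℕ, ∃ m : Fin n → ℤ, coeff e P ≠ 0 → ∀ ρ, m ⬝ᵥ F.gen ρ = e ρ - b ρ := by
    intro e
    by_cases he : coeff e P = 0
    · exact ⟨0, fun h => absurd he h⟩
    · have h1 := hP he
      rw [weight_varDeg, ← hb] at h1
      obtain ⟨m, hm⟩ := QuotientAddGroup.eq.mp h1.symm
      exact ⟨m, fun _ ρ => (congrFun hm ρ).trans (by simp; ring)⟩
  choose m hm using h
  have hdual : ∀ e, coeff e P ≠ 0 → m e ∈ F.dual σ := fun e he ρ hρ => by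
    rw [hm e he, hbσ ρ hρ]; omega
  have hmon : ∀ x ∈ chart F k σ, ∀ w, LiesOver w x → ∀ e, coeff e P ≠ 0 →
      coeff e P * x.val (m e) * ∏ ρ, w ρ ^ b ρ = eval w (monomial e (coeff e P)) := by
    intro x hx w hw e he
    rw [hw.val_eq' hx (hdual e he), eval_monomial', mul_assoc,
      laurent_mul_prod_zpow hbσ (hm e he) fun ρ h => mem_chart.mp hx (hw.zeros_subset ρ h)]
  refine ⟨∑ e ∈ P.support, AddMonoidAlgebra.single (m e) (coeff e P), sum_mem fun e he =>
    single_mem_Reg (hdual e (mem_support_iff.mp he)) _, ?_, ?_⟩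
  · intro x hx w hw
    conv_rhs => rw [P.as_sum, map_sum]
    rw [map_sum, Finset.sum_mul]
    refine Finset.sum_congr rfl fun e he => ?_
    rw [pev_single, hmon x hx w hw e (mem_support_iff.mp he)]
  · intro ρ x hx w hw
    conv_rhs => rw [P.as_sum]
    simp only [map_sum, Finset.mul_sum]
    rw [Finset.sum_mul, ← Finset.sum_sub_distrib]
    refine Finset.sum_congr rfl fun e he => ?_
    have he := mem_support_iff.mp he
    rw [logDer_single, pev_single, eval_X_mul_pderiv_monomial, ← sub_mul,
      ← hmon x (torus_subset_chart σ hx) w hw e he]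
    have : pairing F k ρ (m e) = e ρ - b ρ := by
      change ((m e ⬝ᵥ F.gen ρ : ℤ) : k) = _
      rw [hm e he]; push_cast; rfl
    rw [this]
    ring

lemma prod_zpow_ne_zero {σ : Finset R} {b : R → ℤ} (hbσ : ∀ ρ ∈ σ, b ρ = 0) {w : R → k}
    (hw : ∀ ρ, w ρ = 0 → ρ ∈ σ) : ∏ ρ, w ρ ^ b ρ ≠ 0 := by
  refine Finset.prod_ne_zero_iff.mpr fun ρ _ => ?_
  by_cases h : w ρ = 0
  · rw [hbσ ρ (hw ρ h), zpow_zero]; exact one_ne_zero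
  · exact zpow_ne_zero _ h

/-- Every class is represented by a divisor that does not contain the ray divisor `D_ρ`. -/
lemma Fan.exists_pairing_eq_one (F : Fan n R) (ρ : R) : ∃ m : Fin n → ℤ, m ⬝ᵥ F.gen ρ = 1 := by
  -- A generator `d` of the ideal of the coordinates divides all of them, so primitivity makes it a
  -- unit and the ideal contains `1`.
  obtain ⟨d, hd⟩ := (IsPrincipalIdealRing.principal
    (Ideal.span (Set.range (F.gen ρ)))).principal
  have hd' : ∀ i, d ∣ F.gen ρ i := fun i => by
    have : F.gen ρ i ∈ Ideal.span (Set.range (F.gen ρ)) :=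
      Ideal.subset_span (Set.mem_range_self i)
    rw [hd] at this
    exact Ideal.mem_span_singleton.mp this
  choose v hv using hd'
  have hu := F.primitive ρ d v (funext fun i => hv i)
  have h1 : (1 : ℤ) ∈ Ideal.span (Set.range (F.gen ρ)) := by
    rw [hd]
    exact Ideal.mem_span_singleton.mpr hu.dvd
  obtain ⟨m, hm⟩ := (Submodule.mem_span_range_iff_exists_fun ℤ).mp h1
  exact ⟨m, hm⟩

/-- Subtract a multiple of the divisor of a character pairing to `1` with `u_{ρ₀}`. The resulting
monomial is invertible along `D_{ρ₀}`, so dividing a form by it gives a local equation on the chart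
of that ray. -/
lemma exists_rep (β : Cl F) (ρ₀ : R) :
    ∃ b : R → ℤ, (QuotientAddGroup.mk b : Cl F) = β ∧ b ρ₀ = 0 := by
  obtain ⟨a, rfl⟩ := QuotientAddGroup.mk_surjective β
  obtain ⟨m, hm⟩ := F.exists_pairing_eq_one ρ₀
  refine ⟨a - a ρ₀ • divHom F m, ?_, ?_⟩
  · rw [QuotientAddGroup.eq]
    refine ⟨a ρ₀ • m, ?_⟩
    rw [map_zsmul]; abel
  · simp only [Pi.sub_apply, Pi.smul_apply, smul_eq_mul]
    change a ρ₀ - a ρ₀ * (m ⬝ᵥ F.gen ρ₀) = 0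
    rw [hm, mul_one, sub_self]

/-- A local equation on `U_σ` of the divisor of a form. -/
lemma mem_divisor_of_dehom {σ : Finset R} (hσ : σ ∈ F.cones) {b : R → ℤ}
    (hbσ : ∀ ρ ∈ σ, b ρ = 0) {P : MvPolynomial R k} {φ : CharAlg n k} (hφ : φ ∈ Reg F k σ)
    (h : ∀ x ∈ chart F k σ, ∀ w, LiesOver w x → pev x φ * ∏ ρ, w ρ ^ b ρ = eval w P) :
    (chart F k σ, fun x => pev x φ) ∈ divisor (F := F) P := by
  refine ⟨isOpen_chart hσ, (regularOn_iff (isOpen_chart hσ) _).mpr fun x hx =>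
    regularAt_pev hφ hx, fun z x hx hzx => ?_⟩
  have hne : ∀ (c : R → ℕ), (∀ ρ ∈ σ, c ρ = 0) → ∀ w : R → k, (∀ ρ, w ρ = 0 → ρ ∈ σ) →
      eval w (∏ ρ, X ρ ^ c ρ : MvPolynomial R k) ≠ 0 := by
    intro c hc w hw
    simp only [map_prod, map_pow, eval_X]
    refine Finset.prod_ne_zero_iff.mpr fun ρ _ => ?_
    by_cases h : w ρ = 0
    · rw [hc ρ (hw ρ h), pow_zero]; exact one_ne_zero
    · exact pow_ne_zero _ h
  have hz : ∀ w : R → k, ∀ y ∈ chart F k σ, LiesOver w y → ∀ ρ, w ρ = 0 → ρ ∈ σ :=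
    fun w y hy hw ρ h => mem_chart.mp hy (hw.zeros_subset ρ h)
  -- The unit relating the function to the form is `x^(-b)`, split into numerator and denominator.
  refine ⟨∏ ρ, X ρ ^ (-b ρ).toNat, ∏ ρ, X ρ ^ (b ρ).toNat,
    hne _ (fun ρ hρ => by simp [hbσ ρ hρ]) z (hz z x hx hzx),
    hne _ (fun ρ hρ => by simp [hbσ ρ hρ]) z (hz z x hx hzx), fun w y hy hw _ _ => ?_⟩
  dsimp only at hy ⊢
  rw [← h y hy w hw, mul_assoc]
  congr 1
  simp only [map_prod, map_pow, eval_X, ← Finset.prod_mul_distrib]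
  refine Finset.prod_congr rfl fun ρ _ => ?_
  by_cases h : w ρ = 0
  · rw [hbσ ρ (hz w y hy hw ρ h)]; simp
  · rw [← zpow_natCast, ← zpow_natCast, ← zpow_add₀ h]
    congr 1
    omega

/-- A quotient of forms of the same degree is a regular function where the denominator does not
vanish. -/
lemma exists_regular_quotient {β : Cl F} {P Q : MvPolynomial R k}
    (hP : IsWeightedHomogeneous (varDeg F) P β) (hQ : IsWeightedHomogeneous (varDeg F) Q β)
    {x₀ : Point F k} {w₀ : R → k} (hw₀ : LiesOver w₀ x₀) (hz : ∀ ρ, w₀ ρ = 0 ↔ ρ ∈ x₀.cone)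
    (hQ₀ : eval w₀ Q ≠ 0) :
    ∃ (V : Set (Point F k)) (u : Point F k → k), IsOpen V ∧ x₀ ∈ V ∧ (∀ x ∈ V, RegularAt u x) ∧
      ∀ x ∈ V, ∀ w, LiesOver w x → eval w Q ≠ 0 ∧ u x * eval w Q = eval w P := by
  -- A monomial of `Q` that does not vanish at `w₀` involves no variable of the cone of `x₀`;
  -- dividing `P` and `Q` by it gives elements of the coordinate ring of the chart.
  have h1 : ∃ e ∈ Q.support, eval w₀ (monomial e (coeff e Q)) ≠ 0 := by
    by_contra! h
    apply hQ₀
    rw [Q.as_sum, map_sum]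
    exact Finset.sum_eq_zero h
  obtain ⟨e, he, hew⟩ := h1
  rw [eval_monomial'] at hew
  have he0 : ∀ ρ ∈ x₀.cone, (e ρ : ℤ) = 0 := by
    intro ρ hρ
    by_contra h
    have := Finset.prod_ne_zero_iff.mp (right_ne_zero_of_mul hew) ρ (Finset.mem_univ _)
    rw [(hz ρ).mpr hρ] at this
    exact this (zero_pow (by exact_mod_cast h))
  have heβ : (QuotientAddGroup.mk (fun ρ => (e ρ : ℤ)) : Cl F) = β := by
    rw [← weight_varDeg]; exact hQ (mem_support_iff.mp he)
  obtain ⟨p, hp, hpP, -⟩ := exists_dehom heβ he0 hP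
  obtain ⟨q, hq, hqQ, -⟩ := exists_dehom heβ he0 hQ
  refine ⟨{x | x ∈ chart F k x₀.cone ∧ pev x q ≠ 0}, fun x => pev x p / pev x q,
    isOpen_basic x₀.cone_mem hq, ⟨Finset.Subset.refl _, fun h => ?_⟩,
    fun x hx => regularAt_div hp hq hx.1 hx.2, fun x hx w hw => ⟨?_, ?_⟩⟩
  · rw [← hqQ x₀ (Finset.Subset.refl _) w₀ hw₀, h, zero_mul] at hQ₀
    exact hQ₀ rfl
  · rw [← hqQ x hx.1 w hw]
    exact mul_ne_zero hx.2 (prod_zpow_ne_zero he0 fun ρ h => hx.1 (hw.zeros_subset ρ h))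
  · rw [← hqQ x hx.1 w hw, ← hpP x hx.1 w hw, ← mul_assoc, div_mul_cancel₀ _ hx.2]

lemma weightedHomogeneousComponent_mul {γ β : Cl F} {G P : MvPolynomial R k}
    (hG : IsWeightedHomogeneous (varDeg F) G γ) :
    weightedHomogeneousComponent (varDeg F) (γ + β) (G * P) =
      G * weightedHomogeneousComponent (varDeg F) β P := by
  induction P using MvPolynomial.induction_on' with
  | monomial e c =>
    have h1 : IsWeightedHomogeneous (varDeg F) (monomial e c)
        (Finsupp.weight (varDeg F) e) := isWeightedHomogeneous_monomial _ _ _ rfl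
    by_cases h : Finsupp.weight (varDeg F) e = β
    · rw [← h, h1.weightedHomogeneousComponent_same,
        (hG.mul h1).weightedHomogeneousComponent_same]
    · rw [h1.weightedHomogeneousComponent_ne _ (Ne.symm h), mul_zero,
        (hG.mul h1).weightedHomogeneousComponent_ne _ (fun h' => h (add_left_cancel h'.symm))]
  | add p q hp hq => rw [mul_add, map_add, hp, hq, map_add, mul_add]

lemma exists_component_eval_ne_zero {P : MvPolynomial R k} {w : R → k} (h : eval w P ≠ 0) :
    ∃ β : Cl F, eval w (weightedHomogeneousComponent (varDeg F) β P) ≠ 0 := by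
  by_contra! h'
  apply h
  have h1 := sum_weightedHomogeneousComponent (varDeg F) P
  rw [← h1, finsum_eq_sum _ (weightedHomogeneousComponent_finsupp _), map_sum]
  exact Finset.sum_eq_zero fun β _ => h' β

/-- If a quotient of arbitrary polynomials that do not vanish at `w` equals a quotient of forms of
the same degree, it equals a quotient of forms that do not vanish at `w`. -/
lemma exists_homogeneous_quotient {γ : Cl F} {G H P Q : MvPolynomial R k}
    (hG : IsWeightedHomogeneous (varDeg F) G γ) (hH : IsWeightedHomogeneous (varDeg F) H γ)
    (hG0 : G ≠ 0) (hH0 : H ≠ 0) (h : G * Q = H * P) {w : R → k} (hP : eval w P ≠ 0)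
    (hQ : eval w Q ≠ 0) :
    ∃ (β : Cl F) (P' Q' : MvPolynomial R k), IsWeightedHomogeneous (varDeg F) P' β ∧
      IsWeightedHomogeneous (varDeg F) Q' β ∧ G * Q' = H * P' ∧ eval w P' ≠ 0 ∧
      eval w Q' ≠ 0 := by
  obtain ⟨β, hβ⟩ := exists_component_eval_ne_zero (F := F) hP
  obtain ⟨δ, hδ⟩ := exists_component_eval_ne_zero (F := F) hQ
  have hc : ∀ ε : Cl F, G * weightedHomogeneousComponent (varDeg F) ε Q =
      H * weightedHomogeneousComponent (varDeg F) ε P := fun ε => by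
    rw [← weightedHomogeneousComponent_mul hG, ← weightedHomogeneousComponent_mul hH, h]
  refine ⟨β, _, _, weightedHomogeneousComponent_isWeightedHomogeneous _ _,
    weightedHomogeneousComponent_isWeightedHomogeneous _ _, hc β, hβ, ?_⟩
  -- The nonvanishing components found for `P` and `Q` may have different degrees. All pairs of
  -- components have the same ratio, so cross-multiplying shows that the component of `Q` in degree
  -- `β` is nonzero at `w` too.
  have h1 : weightedHomogeneousComponent (varDeg F) β Q *
      weightedHomogeneousComponent (varDeg F) δ P =
      weightedHomogeneousComponent (varDeg F) δ Q *
      weightedHomogeneousComponent (varDeg F) β P := by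
    refine mul_left_cancel₀ (mul_ne_zero hG0 hH0) ?_
    linear_combination (H * weightedHomogeneousComponent (varDeg F) δ P) * hc β -
      (H * weightedHomogeneousComponent (varDeg F) β P) * hc δ
  have h2 := congrArg (eval w) h1
  rw [map_mul, map_mul] at h2
  intro h0
  rw [h0, zero_mul] at h2
  exact mul_ne_zero hδ hβ h2.symm

end Dehom

/-! ### Automorphisms and divisors of forms -/

/-- In a factorial domain, two nonzero elements are associated if they are so locally at all
primes. -/
lemma associated_of_forall_prime {A : Type*} [CommRing A] [IsDomain A]
    [UniqueFactorizationMonoid A] {N D : A} (hN : N ≠ 0) (hD : D ≠ 0)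
    (h : ∀ π : A, Prime π → ∃ a b, ¬ π ∣ a ∧ ¬ π ∣ b ∧ N * b = D * a) : Associated N D := by
  obtain ⟨N', D', c, hrel, rfl, rfl⟩ :=
    UniqueFactorizationMonoid.exists_reduced_factors N hN D
  have hc : c ≠ 0 := left_ne_zero_of_mul hN
  -- With the common factor removed, a prime dividing one element would divide the other times a
  -- factor it does not divide, contradicting coprimality; so both are units.
  have hu : ∀ {x y : A}, IsRelPrime x y → x ≠ 0 →
      (∀ π : A, Prime π → ∃ a b, ¬ π ∣ a ∧ ¬ π ∣ b ∧ x * b = y * a) → IsUnit x := by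
    intro x y hxy hx hloc
    by_contra hnu
    obtain ⟨π, hπ, hπx⟩ := WfDvdMonoid.exists_irreducible_factor hnu hx
    obtain ⟨a, b, ha, -, hab⟩ := hloc π hπ.prime
    have h1 : π ∣ y * a := hab ▸ hπx.mul_right b
    rcases hπ.prime.dvd_or_dvd h1 with h2 | h2
    · exact hπ.not_isUnit (hxy hπx h2)
    · exact ha h2
  have hloc : ∀ π : A, Prime π → ∃ a b, ¬ π ∣ a ∧ ¬ π ∣ b ∧ N' * b = D' * a := by
    intro π hπ
    obtain ⟨a, b, ha, hb, hab⟩ := h π hπ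
    exact ⟨a, b, ha, hb, mul_left_cancel₀ hc (by rw [← mul_assoc, hab, mul_assoc])⟩
  have h1 := hu hrel (right_ne_zero_of_mul hN) hloc
  have h2 := hu hrel.symm (right_ne_zero_of_mul hD) fun π hπ => by
    obtain ⟨a, b, ha, hb, hab⟩ := hloc π hπ
    exact ⟨b, a, hb, ha, hab.symm⟩
  exact Associated.mul_left c ((associated_one_iff_isUnit.mpr h1).trans
    (associated_one_iff_isUnit.mpr h2).symm)

/-- A hypersurface in the Cox space has a point that lies over the union of the torus and one of
the ray divisors. -/
lemma exists_zero_of_prime [IsAlgClosed k] {π : MvPolynomial R k} (hπ : Prime π) :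
    ∃ (ρ₀ : R) (z : R → k), eval z π = 0 ∧ ∀ ρ, z ρ = 0 → ρ = ρ₀ := by
  by_cases h : ∃ ρ₀, π ∣ X ρ₀
  · obtain ⟨ρ₀, u, hu⟩ := h
    have hunit : IsUnit u := by
      refine ((X_prime (R := k) (i := ρ₀)).irreducible.isUnit_or_isUnit hu).resolve_left ?_
      exact hπ.not_isUnit
    refine ⟨ρ₀, fun ρ => if ρ = ρ₀ then 0 else 1, ?_, fun ρ hρ => ?_⟩
    · have h1 := congrArg (eval fun ρ => if ρ = ρ₀ then (0 : k) else 1) hu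
      rw [eval_X, if_pos rfl, map_mul] at h1
      exact (mul_eq_zero.mp h1.symm).resolve_right (hunit.map _).ne_zero
    · by_contra h1
      simp [h1] at hρ
  · have h1 : ¬ π ∣ complProd k (∅ : Finset R) := by
      rw [complProd, hπ.dvd_finsetProd_iff]
      rintro ⟨ρ, -, hρ⟩
      exact h ⟨ρ, hρ⟩
    -- If `π` divides no variable, the Nullstellensatz gives a zero of `π` with all coordinates
    -- nonzero, and any ray will do. There is a ray, as a nonzero constant has no zeros.
    have h2 : complProd k (∅ : Finset R) ∉ (Ideal.span {π}).radical := by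
      rw [((Ideal.span_singleton_prime hπ.ne_zero).mpr hπ).radical]
      exact fun h => h1 (Ideal.mem_span_singleton.mp h)
    rw [← vanishingIdeal_zeroLocus_eq_radical (K := k), mem_vanishingIdeal_iff] at h2
    push Not at h2
    obtain ⟨z, hz, hz'⟩ := h2
    have hz0 : eval z π = 0 := by
      have := hz π (Ideal.mem_span_singleton_self π)
      rwa [← MvPolynomial.coe_aeval_eq_eval]
    replace hz' : eval z (complProd k (∅ : Finset R)) ≠ 0 := by
      rwa [← MvPolynomial.coe_aeval_eq_eval]
    have hne : Nonempty R := by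
      by_contra hemp
      rw [not_nonempty_iff] at hemp
      rw [π.eq_C_of_isEmpty, eval_C] at hz0
      apply hπ.ne_zero
      rw [π.eq_C_of_isEmpty, hz0, C_0]
    exact ⟨hne.some, z, hz0, fun ρ hρ =>
      absurd (eval_complProd_ne_zero.mp hz' ρ hρ) (Finset.notMem_empty _)⟩

section Ratio

variable {F : Fan n R}

/-- If `g_* div f = div f'`, local equations of `f'` pull back to local equations of `f`. -/
lemma exists_local_of_push {g : Equiv.Perm (Point F k)} {f f' : MvPolynomial R k}
    (h : pushDivisor g (divisor (F := F) f) = divisor f') {V : Set (Point F k)}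
    {h' : Point F k → k} (hmem : (V, h') ∈ divisor (F := F) f') {x₀ : Point F k}
    (hx₀ : g x₀ ∈ V) {w₀ : R → k} (hw₀ : LiesOver w₀ x₀) :
    ∃ P Q : MvPolynomial R k, eval w₀ P ≠ 0 ∧ eval w₀ Q ≠ 0 ∧ ∀ w x, g x ∈ V → LiesOver w x →
      eval w P ≠ 0 → eval w Q ≠ 0 → h' (g x) * eval w Q = eval w f * eval w P := by
  rw [← h] at hmem
  obtain ⟨p, hp, hpV⟩ := hmem
  have h1 : g '' p.1 = V := congrArg Prod.fst hpV
  have h2 : p.2 ∘ g.symm = h' := congrArg Prod.snd hpV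
  have hin : ∀ x, g x ∈ V → x ∈ p.1 := fun x hx => by
    rw [← h1] at hx
    obtain ⟨y, hy, hyx⟩ := hx
    rwa [← g.injective hyx]
  obtain ⟨P, Q, hP, hQ, hPQ⟩ := hp.2.2 w₀ x₀ (hin x₀ hx₀) hw₀
  refine ⟨P, Q, hP, hQ, fun w x hx hw hwP hwQ => ?_⟩
  rw [← hPQ w x (hin x hx) hw hwP hwQ, ← h2, Function.comp_apply, g.symm_apply_apply]

lemma apply_mem_symm_preimage {g : Equiv.Perm (Point F k)} {V : Set (Point F k)}
    {x : Point F k} : g x ∈ g.symm ⁻¹' V ↔ x ∈ V := by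
  rw [Set.mem_preimage, g.symm_apply_apply]

variable [IsAlgClosed k]

lemma exists_pev_ne_zero_of_dehom {a : R → ℤ} {f : MvPolynomial R k}
    (hf0 : f ≠ 0) {φ : CharAlg n k}
    (hφ : ∀ x ∈ chart F k ∅, ∀ w, LiesOver w x → pev x φ * ∏ ρ, w ρ ^ a ρ = eval w f) :
    ∃ x ∈ torus F k, pev x φ ≠ 0 := by
  obtain ⟨z, hz, hz'⟩ := exists_torus_eval_ne_zero hf0
  obtain ⟨x, hx, hzx⟩ := exists_liesOver_torus_point (F := F) hz
  rw [← hφ x (torus_subset_chart _ hx) z hzx] at hz'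
  exact ⟨x, hx, left_ne_zero_of_mul hz'⟩

variable [CharZero k]

/-- Choose a zero of `π` over the chart of one ray, where forms of degree `α` have local equations.
Those of `f₁'` and `f₂'` pull back under `g` to local equations of `f₁` and `f₂`, so `(f₁'/f₂') ∘ g`
is `f₁/f₂` times a function `u` that is regular and nonzero there. The fractions `Aᵢ / Bᵢ` express
`φᵢ ∘ g⁻¹` in Cox coordinates. -/
lemma exists_local_ratio (hF : F.IsComplete) {g : Equiv.Perm (Point F k)} (hg : g ∈ autX F k)
    {α : Cl F} {f₁ f₂ f₁' f₂' : MvPolynomial R k}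
    (hf₁ : IsWeightedHomogeneous (varDeg F) f₁ α) (hf₂ : IsWeightedHomogeneous (varDeg F) f₂ α)
    (hf₁' : IsWeightedHomogeneous (varDeg F) f₁' α)
    (hf₂' : IsWeightedHomogeneous (varDeg F) f₂' α) (h₁0 : f₁ ≠ 0) (h₂0 : f₂ ≠ 0)
    (h₁ : pushDivisor g (divisor (F := F) f₁) = divisor f₁')
    (h₂ : pushDivisor g (divisor (F := F) f₂) = divisor f₂')
    {a : R → ℤ} {φ₁ φ₂ : CharAlg n k}
    (hφ₁ : ∀ x ∈ chart F k ∅, ∀ w, LiesOver w x → pev x φ₁ * ∏ ρ, w ρ ^ a ρ = eval w f₁)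
    (hφ₂ : ∀ x ∈ chart F k ∅, ∀ w, LiesOver w x → pev x φ₂ * ∏ ρ, w ρ ^ a ρ = eval w f₂)
    {A₁ B₁ A₂ B₂ : MvPolynomial R k}
    (hA₁ : ∀ z y, LiesOver z y → eval z B₁ ≠ 0 →
      g.symm y ∈ torus F k ∧ pev (g.symm y) φ₁ * eval z B₁ = eval z A₁)
    (hA₂ : ∀ z y, LiesOver z y → eval z B₂ ≠ 0 →
      g.symm y ∈ torus F k ∧ pev (g.symm y) φ₂ * eval z B₂ = eval z A₂)
    (hB₁ : B₁ ≠ 0) (hB₂ : B₂ ≠ 0)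
    {π : MvPolynomial R k} (hπ : Prime π) :
    ∃ a b, ¬ π ∣ a ∧ ¬ π ∣ b ∧ (f₁' * A₂ * B₁) * b = (f₂' * A₁ * B₂) * a := by
  obtain ⟨ρ₀, z₀, hz₀, hzρ⟩ := exists_zero_of_prime hπ
  have hzσ : ∀ ρ, z₀ ρ = 0 → ρ ∈ ({ρ₀} : Finset R) := fun ρ h =>
    Finset.mem_singleton.mpr (hzρ ρ h)
  obtain ⟨y₀, hy₀⟩ := exists_liesOver_point (F := F) (F.ray_mem ρ₀) hzσ
  have hy₀σ : y₀ ∈ chart F k {ρ₀} := hy₀.cone_subset (F.ray_mem ρ₀) hzσ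
  obtain ⟨b, hb, hbρ⟩ := exists_rep α ρ₀
  have hbσ : ∀ ρ ∈ ({ρ₀} : Finset R), b ρ = 0 := fun ρ hρ => by
    rw [Finset.mem_singleton.mp hρ, hbρ]
  obtain ⟨h₁', hR₁, hh₁, -⟩ := exists_dehom hb hbσ hf₁'
  obtain ⟨h₂', hR₂, hh₂, -⟩ := exists_dehom hb hbσ hf₂'
  obtain ⟨x₀, rfl⟩ := g.surjective y₀
  obtain ⟨w₀, hw₀, hw₀z⟩ := hF.exists_liesOver x₀
  have hVo : IsOpen (g ⁻¹' chart F k {ρ₀}) := (isOpen_chart (F.ray_mem ρ₀)).preimage hg.1.1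
  obtain ⟨P₁, Q₁, hP₁, hQ₁, hPQ₁⟩ := exists_local_of_push h₁
    (mem_divisor_of_dehom (F.ray_mem ρ₀) hbσ hR₁ hh₁) hy₀σ hw₀
  obtain ⟨P₂, Q₂, hP₂, hQ₂, hPQ₂⟩ := exists_local_of_push h₂
    (mem_divisor_of_dehom (F.ray_mem ρ₀) hbσ hR₂ hh₂) hy₀σ hw₀
  obtain ⟨β₁, C₁, D₁, hC₁, hD₁, hD₁0, hCD₁⟩ :=
    ((regularAt_pev hR₁ hy₀σ).comp hg.1).exists_cox hVo hy₀σ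
  obtain ⟨β₂, C₂, D₂, hC₂, hD₂, hD₂0, hCD₂⟩ :=
    ((regularAt_pev hR₂ hy₀σ).comp hg.1).exists_cox hVo hy₀σ
  have hne : ∀ {w : R → k} {p : MvPolynomial R k}, eval w p ≠ 0 → p ≠ 0 := by
    rintro w p h rfl; exact h (map_zero _)
  have key : ∀ {C D f P Q : MvPolynomial R k} {h' : CharAlg n k},
      (∀ w x, LiesOver w x → eval w D ≠ 0 →
        x ∈ g ⁻¹' chart F k {ρ₀} ∧ pev (g x) h' * eval w D = eval w C) →
      (∀ w x, g x ∈ chart F k {ρ₀} → LiesOver w x → eval w P ≠ 0 → eval w Q ≠ 0 →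
        pev (g x) h' * eval w Q = eval w f * eval w P) → D ≠ 0 → P ≠ 0 → Q ≠ 0 →
      C * Q = f * P * D := by
    intro C D f P Q h' h1 h2 hD hP hQ
    rw [← sub_eq_zero]
    refine poly_eq_zero_of_generic (mul_ne_zero (mul_ne_zero hD hP) hQ) fun w hw hw' => ?_
    rw [map_mul, map_mul] at hw'
    obtain ⟨x, hx, hwx⟩ := exists_liesOver_torus_point (F := F) hw
    obtain ⟨hxV, h3⟩ := h1 w x hwx (left_ne_zero_of_mul (left_ne_zero_of_mul hw'))
    have h4 := h2 w x hxV hwx (right_ne_zero_of_mul (left_ne_zero_of_mul hw'))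
      (right_ne_zero_of_mul hw')
    simp only [map_sub, map_mul]
    linear_combination (-eval w Q) * h3 + eval w D * h4
  have hk₁ := key hCD₁ hPQ₁ (hne (hD₁0 w₀ hw₀)) (hne hP₁) (hne hQ₁)
  have hk₂ := key hCD₂ hPQ₂ (hne (hD₂0 w₀ hw₀)) (hne hP₂) (hne hQ₂)
  have hC₁0 : C₁ ≠ 0 := by
    rintro rfl
    rw [zero_mul] at hk₁
    exact mul_ne_zero (mul_ne_zero h₁0 (hne hP₁)) (hne (hD₁0 w₀ hw₀)) hk₁.symm
  have hC₂0 : C₂ ≠ 0 := by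
    rintro rfl
    rw [zero_mul] at hk₂
    exact mul_ne_zero (mul_ne_zero h₂0 (hne hP₂)) (hne (hD₂0 w₀ hw₀)) hk₂.symm
  -- The units in the local equations are quotients of arbitrary polynomials; only a quotient of
  -- forms of equal degree descends to a function on `X`.
  obtain ⟨γ, p, q, hp, hq, hpq, hp0, hq0⟩ := exists_homogeneous_quotient
    (γ := α + β₁ + β₂) (G := f₂ * C₁ * D₂) (H := f₁ * D₁ * C₂) (P := P₁ * Q₂) (Q := Q₁ * P₂)
    ((hf₂.mul hC₁).mul hD₂) ((hf₁.mul hD₁).mul hC₂)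
    (mul_ne_zero (mul_ne_zero h₂0 hC₁0) (hne (hD₂0 w₀ hw₀)))
    (mul_ne_zero (mul_ne_zero h₁0 (hne (hD₁0 w₀ hw₀))) hC₂0)
    (by linear_combination (f₂ * D₂ * P₂) * hk₁ - (f₁ * P₁ * D₁) * hk₂)
    (w := w₀) (by rw [map_mul]; exact mul_ne_zero hP₁ hQ₂)
    (by rw [map_mul]; exact mul_ne_zero hQ₁ hP₂)
  obtain ⟨V₀, u, hV₀, hxV₀, hu, huq⟩ := exists_regular_quotient hp hq hw₀ hw₀z hq0
  have hux₀ : u x₀ ≠ 0 := fun h => hp0 (by rw [← (huq x₀ hxV₀ w₀ hw₀).2, h, zero_mul])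
  -- the ratio of the local equations is the ratio of `f₁` and `f₂` times the unit `u`
  have hI : ∀ x ∈ V₀ ∩ torus F k ∩ g ⁻¹' chart F k {ρ₀},
      pev (g x) h₁' * pev x φ₂ - u x * (pev x φ₁ * pev (g x) h₂') = 0 := by
    refine eq_zero_of_generic hF ((hV₀.inter isOpen_torus).inter hVo) (fun x hx => ?_)
      (mul_ne_zero (hne (hD₁0 w₀ hw₀)) (hne (hD₂0 w₀ hw₀))) fun w x hx hxT hwx hw => ?_
    · have hxT : x ∈ chart F k ∅ := torus_subset_chart _ hx.1.2
      exact (((regularAt_pev hR₁ hx.2).comp hg.1).mul (regularAt_pev (mem_Reg_empty φ₂) hxT)).sub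
        ((hu x hx.1.1).mul ((regularAt_pev (mem_Reg_empty φ₁) hxT).mul
          ((regularAt_pev hR₂ hx.2).comp hg.1)))
    · rw [map_mul] at hw
      have e₁ := (hCD₁ w x hwx (left_ne_zero_of_mul hw)).2
      have e₂ := (hCD₂ w x hwx (right_ne_zero_of_mul hw)).2
      obtain ⟨hqw, e₃⟩ := huq x hx.1.1 w hwx
      have e₄ := hφ₁ x (torus_subset_chart _ hxT) w hwx
      have e₅ := hφ₂ x (torus_subset_chart _ hxT) w hwx
      have e₆ := congrArg (eval w) hpq
      simp only [map_mul] at e₆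
      have hw0 : ∏ ρ, w ρ ^ a ρ ≠ 0 := prod_zpow_ne_zero (σ := ∅) (by simp)
        fun ρ h => absurd h (hwx.mem_torus_iff.mp hxT ρ)
      rw [← e₁, ← e₂, ← e₃, ← e₄, ← e₅] at e₆
      refine mul_right_cancel₀ (mul_ne_zero (mul_ne_zero hw hw0) hqw) ?_
      linear_combination e₆
  have hgV : IsOpen (g.symm ⁻¹' V₀) := hV₀.preimage hg.2.1
  have hux : RegularAt (fun y => u (g.symm y)) (g x₀) :=
    RegularAt.comp hg.2 (by rw [g.symm_apply_apply]; exact hu x₀ hxV₀)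
  have hxm : g x₀ ∈ g.symm ⁻¹' V₀ := apply_mem_symm_preimage.mpr hxV₀
  obtain ⟨β, A, B, -, -, hB, hAB⟩ := hux.exists_cox hgV hxm
  have hBz := hB z₀ hy₀
  have hAz : eval z₀ A ≠ 0 := by
    rw [← (hAB z₀ _ hy₀ hBz).2, g.symm_apply_apply]
    exact mul_ne_zero hux₀ hBz
  -- Since `u ∘ g⁻¹ = A / B` is a unit at the zero `z₀` of `π`, neither `A` nor `B` is divisible by
  -- `π`.
  have hndvd : ∀ p, eval z₀ p ≠ 0 → ¬ π ∣ p := by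
    rintro p hp ⟨p', rfl⟩
    rw [map_mul, hz₀, zero_mul] at hp
    exact hp rfl
  refine ⟨A, B, hndvd A hAz, hndvd B hBz, ?_⟩
  rw [← sub_eq_zero]
  refine poly_eq_zero_of_generic (mul_ne_zero (mul_ne_zero hB₁ hB₂) (hne hBz)) fun z hz hz' => ?_
  simp only [map_mul] at hz'
  obtain ⟨y, hy, hzy⟩ := exists_liesOver_torus_point (F := F) hz
  obtain ⟨hxT, e₁⟩ := hA₁ z y hzy (left_ne_zero_of_mul (left_ne_zero_of_mul hz'))
  obtain ⟨-, e₂⟩ := hA₂ z y hzy (right_ne_zero_of_mul (left_ne_zero_of_mul hz'))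
  obtain ⟨hxV, e₃⟩ := hAB z y hzy (right_ne_zero_of_mul hz')
  have e₄ := hh₁ y (torus_subset_chart _ hy) z hzy
  have e₅ := hh₂ y (torus_subset_chart _ hy) z hzy
  have e₆ := hI (g.symm y) ⟨⟨hxV, hxT⟩, by
    rw [Set.mem_preimage, g.apply_symm_apply]; exact torus_subset_chart _ hy⟩
  rw [g.apply_symm_apply] at e₆
  simp only [map_sub, map_mul]
  rw [← e₁, ← e₂, ← e₃, ← e₄, ← e₅]
  linear_combination ((∏ ρ, z ρ ^ b ρ) * eval z B₁ * eval z B₂ * eval z B) * e₆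

/-- If `g_* div fᵢ = div fᵢ'` then `(f₁' / f₂') ∘ g = c · f₁ / f₂` for a constant `c`. -/
lemma exists_ratio (hF : F.IsComplete) {g : Equiv.Perm (Point F k)} (hg : g ∈ autX F k)
    {α : Cl F} {f₁ f₂ f₁' f₂' : MvPolynomial R k}
    (hf₁ : IsWeightedHomogeneous (varDeg F) f₁ α) (hf₂ : IsWeightedHomogeneous (varDeg F) f₂ α)
    (hf₁' : IsWeightedHomogeneous (varDeg F) f₁' α)
    (hf₂' : IsWeightedHomogeneous (varDeg F) f₂' α) (h₁0 : f₁ ≠ 0) (h₂0 : f₂ ≠ 0)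
    (h₁0' : f₁' ≠ 0) (h₂0' : f₂' ≠ 0)
    (h₁ : pushDivisor g (divisor (F := F) f₁) = divisor f₁')
    (h₂ : pushDivisor g (divisor (F := F) f₂) = divisor f₂') :
    ∃ c : k, c ≠ 0 ∧ ∀ x ∈ torus F k, g x ∈ torus F k → ∀ w z, LiesOver w x →
      LiesOver z (g x) → eval z f₁' * eval w f₂ = c * (eval w f₁ * eval z f₂') := by
  obtain ⟨a, ha⟩ := QuotientAddGroup.mk_surjective α
  have ha0 : ∀ ρ ∈ (∅ : Finset R), a ρ = 0 := fun ρ h => absurd h (Finset.notMem_empty ρ)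
  obtain ⟨φ₁, -, hφ₁, -⟩ := exists_dehom ha ha0 hf₁
  obtain ⟨φ₂, -, hφ₂, -⟩ := exists_dehom ha ha0 hf₂
  obtain ⟨φ₁', -, hφ₁', -⟩ := exists_dehom ha ha0 hf₁'
  obtain ⟨φ₂', -, hφ₂', -⟩ := exists_dehom ha ha0 hf₂'
  have hV : IsOpen (g.symm ⁻¹' torus F k) := isOpen_torus.preimage hg.2.1
  have hreg : ∀ φ : CharAlg n k, ∀ y ∈ g.symm ⁻¹' torus F k,
      RegularAt (fun y => pev (g.symm y) φ) y := fun φ y hy =>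
    RegularAt.comp (φ := fun x => pev x φ) hg.2
      (regularAt_pev (mem_Reg_empty φ) (torus_subset_chart _ hy))
  have hT : ∃ y, y ∈ g.symm ⁻¹' torus F k := by
    obtain ⟨x, hx, -⟩ := exists_torus_pev_ne_zero hF (one_ne_zero (α := CharAlg n k))
    exact ⟨g x, apply_mem_symm_preimage.mpr hx⟩
  obtain ⟨y₁, hy₁⟩ := hT
  obtain ⟨z₁, hz₁, -⟩ := hF.exists_liesOver y₁
  obtain ⟨-, A₁, B₁, -, -, hB₁, hAB₁⟩ := (hreg φ₁ y₁ hy₁).exists_cox hV hy₁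
  obtain ⟨-, A₂, B₂, -, -, hB₂, hAB₂⟩ := (hreg φ₂ y₁ hy₁).exists_cox hV hy₁
  have hne : ∀ {w : R → k} {p : MvPolynomial R k}, eval w p ≠ 0 → p ≠ 0 := by
    rintro w p h rfl; exact h (map_zero _)
  have hB₁0 := hne (hB₁ z₁ hz₁)
  have hB₂0 := hne (hB₂ z₁ hz₁)
  have hA0 : ∀ {f A B : MvPolynomial R k} {φ : CharAlg n k}, f ≠ 0 →
      (∀ x ∈ chart F k ∅, ∀ w, LiesOver w x → pev x φ * ∏ ρ, w ρ ^ a ρ = eval w f) → B ≠ 0 →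
      (∀ z y, LiesOver z y → eval z B ≠ 0 →
        y ∈ g.symm ⁻¹' torus F k ∧ pev (g.symm y) φ * eval z B = eval z A) → A ≠ 0 := by
    rintro f A B φ hf hφ hB hAB rfl
    have h0 := eq_zero_of_generic hF hV (hreg φ) hB fun z y _ _ hzy hz => by
      have := (hAB z y hzy hz).2
      rw [map_zero] at this
      exact (mul_eq_zero.mp this).resolve_right hz
    obtain ⟨x, hx, hx'⟩ := exists_pev_ne_zero_of_dehom hf hφ
    have := h0 (g x) (apply_mem_symm_preimage.mpr hx)
    rw [g.symm_apply_apply] at this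
    exact hx' this
  have hA₁0 := hA0 h₁0 hφ₁ hB₁0 hAB₁
  have hA₂0 := hA0 h₂0 hφ₂ hB₂0 hAB₂
  -- Being a unit at every prime of a factorial ring, the ratio is a global unit, and units of the
  -- polynomial ring are constants.
  obtain ⟨v, hv⟩ := (associated_of_forall_prime
    (mul_ne_zero (mul_ne_zero h₁0' hA₂0) hB₁0) (mul_ne_zero (mul_ne_zero h₂0' hA₁0) hB₂0)
    fun π hπ => exists_local_ratio hF hg hf₁ hf₂ hf₁' hf₂' h₁0 h₂0 h₁ h₂ hφ₁ hφ₂ hAB₁ hAB₂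
      hB₁0 hB₂0 hπ).symm
  obtain ⟨c, hc, hcv⟩ := MvPolynomial.isUnit_iff_eq_C_of_isReduced.mp v.isUnit
  have hIo : IsOpen (torus F k ∩ g.symm ⁻¹' torus F k) := isOpen_torus.inter hV
  have hI : ∀ y ∈ torus F k ∩ g.symm ⁻¹' torus F k,
      pev y φ₁' * pev (g.symm y) φ₂ - c * (pev y φ₂' * pev (g.symm y) φ₁) = 0 := by
    refine eq_zero_of_generic hF hIo (fun y hy => ?_) (mul_ne_zero hB₁0 hB₂0)
      fun z y hy hyT hzy hz => ?_
    · have hyT : y ∈ chart F k ∅ := torus_subset_chart _ hy.1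
      exact ((regularAt_pev (mem_Reg_empty φ₁') hyT).mul (hreg φ₂ y hy.2)).sub
        (((regularAt_pev (mem_Reg_empty φ₂') hyT).mul (hreg φ₁ y hy.2)).const_mul c)
    · rw [map_mul] at hz
      have e₁ := (hAB₁ z y hzy (left_ne_zero_of_mul hz)).2
      have e₂ := (hAB₂ z y hzy (right_ne_zero_of_mul hz)).2
      have e₃ := hφ₁' y (torus_subset_chart _ hyT) z hzy
      have e₄ := hφ₂' y (torus_subset_chart _ hyT) z hzy
      have e₅ := congrArg (eval z) hv
      simp only [map_mul, hcv, eval_C] at e₅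
      rw [← e₁, ← e₂, ← e₃, ← e₄] at e₅
      have hz0 : ∏ ρ, z ρ ^ a ρ ≠ 0 := prod_zpow_ne_zero (σ := ∅) (by simp)
        fun ρ h => absurd h (hzy.mem_torus_iff.mp hyT ρ)
      refine mul_right_cancel₀ (mul_ne_zero hz hz0) ?_
      linear_combination -e₅
  refine ⟨c, hc.ne_zero, fun x hx hgx w z hw hz => ?_⟩
  have h := hI (g x) ⟨hgx, apply_mem_symm_preimage.mpr hx⟩
  rw [g.symm_apply_apply] at h
  rw [← hφ₁' _ (torus_subset_chart _ hgx) z hz, ← hφ₂' _ (torus_subset_chart _ hgx) z hz,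
    ← hφ₁ _ (torus_subset_chart _ hx) w hw, ← hφ₂ _ (torus_subset_chart _ hx) w hw]
  linear_combination ((∏ ρ, z ρ ^ a ρ) * ∏ ρ, w ρ ^ a ρ) * h

end Ratio

/-! ### The linear action on the linear system -/

section Lift

variable {F : Fan n R} {α : Cl F}

lemma CoxPiece.coe_ne_zero {f : CoxPiece F k α} (hf : f ≠ 0) : (f : MvPolynomial R k) ≠ 0 :=
  fun h => hf (Subtype.ext h)

lemma divisor_smul_subset (f : MvPolynomial R k) {c : k} (hc : c ≠ 0) :
    divisor (F := F) f ⊆ divisor (c • f) := by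
  rintro p ⟨hp, hreg, h⟩
  refine ⟨hp, hreg, fun z x hx hzx => ?_⟩
  obtain ⟨P, Q, hP, hQ, hPQ⟩ := h z x hx hzx
  have hP' : ∀ w, eval w (c⁻¹ • P) = c⁻¹ * eval w P := fun w => smul_eval _ _ _
  refine ⟨c⁻¹ • P, Q, ?_, hQ, fun w y hy hwy hwP hwQ => ?_⟩
  · rw [hP']; exact mul_ne_zero (inv_ne_zero hc) hP
  · rw [hP'] at hwP ⊢
    rw [hPQ w y hy hwy (right_ne_zero_of_mul hwP) hwQ, smul_eval]
    field_simp

lemma divisor_smul (f : MvPolynomial R k) {c : k} (hc : c ≠ 0) :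
    divisor (F := F) (c • f) = divisor f := by
  refine (divisor_smul_subset f hc).antisymm' ?_
  have := divisor_smul_subset (F := F) (c • f) (inv_ne_zero hc)
  rwa [smul_smul, inv_mul_cancel₀ hc, one_smul] at this

variable [IsAlgClosed k] [CharZero k]

/-- Forms of the same degree with the same divisor are proportional. -/
lemma exists_smul_of_divisor_eq (hF : F.IsComplete) {f f' : CoxPiece F k α} (hf : f ≠ 0)
    (hf' : f' ≠ 0) (h : divisor (F := F) (f : MvPolynomial R k) = divisor (f' : MvPolynomial R k)) :
    ∃ c : k, c ≠ 0 ∧ f' = c • f := by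
  obtain ⟨c, hc, hcf⟩ := exists_ratio hF (one_mem (autX F k)) f.2 f.2 f'.2 f.2
    (CoxPiece.coe_ne_zero hf) (CoxPiece.coe_ne_zero hf) (CoxPiece.coe_ne_zero hf')
    (CoxPiece.coe_ne_zero hf) (by rw [pushDivisor_one, h]) (pushDivisor_one _)
  refine ⟨c, hc, Subtype.ext ?_⟩
  rw [Submodule.coe_smul, ← sub_eq_zero]
  refine poly_eq_zero_of_generic (CoxPiece.coe_ne_zero hf) fun z hz hz' => ?_
  obtain ⟨x, hx, hzx⟩ := exists_liesOver_torus_point (F := F) hz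
  have h1 := hcf x hx hx z z hzx hzx
  rw [map_sub, smul_eval]
  refine mul_right_cancel₀ hz' ?_
  linear_combination h1

/-- There are points in general position with respect to an automorphism and two forms. -/
lemma exists_common_point (hF : F.IsComplete) {g : Equiv.Perm (Point F k)} (hg : g ∈ autX F k)
    {β γ : Cl F} {p q : MvPolynomial R k} (hp : IsWeightedHomogeneous (varDeg F) p β)
    (hq : IsWeightedHomogeneous (varDeg F) q γ) (hp0 : p ≠ 0) (hq0 : q ≠ 0) :
    ∃ x ∈ torus F k, g x ∈ torus F k ∧ ∃ w z, LiesOver w x ∧ LiesOver z (g x) ∧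
      eval w p ≠ 0 ∧ eval z q ≠ 0 := by
  have key : ∀ {β : Cl F} {p : MvPolynomial R k}, IsWeightedHomogeneous (varDeg F) p β → p ≠ 0 →
      ∃ V : Set (Point F k), IsOpen V ∧ V.Nonempty ∧ V ⊆ torus F k ∧
        ∀ x ∈ V, ∀ w, LiesOver w x → eval w p ≠ 0 := by
    intro β p hp hp0
    obtain ⟨a, ha⟩ := QuotientAddGroup.mk_surjective β
    have ha0 : ∀ ρ ∈ (∅ : Finset R), a ρ = 0 := fun ρ h => absurd h (Finset.notMem_empty ρ)
    obtain ⟨φ, hφR, hφ, -⟩ := exists_dehom ha ha0 hp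
    refine ⟨_, isOpen_basic F.empty_mem hφR, ?_, fun x hx => ?_, fun x hx w hw => ?_⟩
    · obtain ⟨x, hx, hx'⟩ := exists_pev_ne_zero_of_dehom hp0 hφ
      exact ⟨x, torus_subset_chart _ hx, hx'⟩
    · rw [torus_eq_chart]; exact hx.1
    · rw [← hφ x hx.1 w hw]
      exact mul_ne_zero hx.2 (prod_zpow_ne_zero ha0 fun ρ h => hx.1 (hw.zeros_subset ρ h))
  obtain ⟨V, hV, hVn, hVT, hVp⟩ := key hp hp0
  obtain ⟨W, hW, hWn, hWT, hWq⟩ := key hq hq0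
  obtain ⟨x, hxV, hxW⟩ := inter_open_nonempty hF hV hVn (hW.preimage hg.1.1)
    (hWn.preimage g.surjective)
  obtain ⟨w, hw, -⟩ := hF.exists_liesOver x
  obtain ⟨z, hz, -⟩ := hF.exists_liesOver (g x)
  exact ⟨x, hVT hxV, hWT hxW, w, z, hw, hz, hVp x hxV w hw, hWq _ hxW z hz⟩

/-- Push-forward gives a form only up to a scalar. Rescaling it so that `(L f / f₀') ∘ g = f / f₀`
makes the right side linear in `f`, and values at general points determine `L f`, so `L` is linear.
It is onto because `g_*` maps `|α|` onto itself. -/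
lemma exists_lift_aux (hF : F.IsComplete) {g : Equiv.Perm (Point F k)}
    (hg : g ∈ autClass F k α) {f₀ : CoxPiece F k α} (hf₀ : f₀ ≠ 0) :
    ∃ L, (g, L) ∈ linearGroup F k α ∧ ∃ f₀' : CoxPiece F k α, f₀' ≠ 0 ∧
      ∀ (f : CoxPiece F k α), ∀ x ∈ torus F k, g x ∈ torus F k → ∀ w z, LiesOver w x →
      LiesOver z (g x) → eval z (L f : MvPolynomial R k) * eval w (f₀ : MvPolynomial R k) =
        eval w (f : MvPolynomial R k) * eval z (f₀' : MvPolynomial R k) := by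
  have hpush : ∀ f : CoxPiece F k α, f ≠ 0 → ∃ f' : CoxPiece F k α, f' ≠ 0 ∧
      pushDivisor g (divisor (F := F) (f : MvPolynomial R k)) =
        divisor (f' : MvPolynomial R k) := by
    intro f hf
    have h1 : pushDivisor g (divisor (F := F) (f : MvPolynomial R k)) ∈ linearSystem F k α := by
      rw [← hg.2]
      exact ⟨_, ⟨f, f.2, CoxPiece.coe_ne_zero hf, rfl⟩, rfl⟩
    obtain ⟨f', hf', hf'0, h⟩ := h1
    exact ⟨⟨f', hf'⟩, fun h => hf'0 (congrArg Subtype.val h), h⟩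
  obtain ⟨f₀', hf₀', hdiv₀⟩ := hpush f₀ hf₀
  have hex : ∀ f : CoxPiece F k α, ∃ f'' : CoxPiece F k α, (f ≠ 0 → f'' ≠ 0 ∧
      pushDivisor g (divisor (F := F) (f : MvPolynomial R k)) =
        divisor (f'' : MvPolynomial R k)) ∧ ∀ x ∈ torus F k, g x ∈ torus F k → ∀ w z,
      LiesOver w x → LiesOver z (g x) →
        eval z (f'' : MvPolynomial R k) * eval w (f₀ : MvPolynomial R k) =
        eval w (f : MvPolynomial R k) * eval z (f₀' : MvPolynomial R k) := by
    intro f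
    by_cases hf : f = 0
    · exact ⟨0, fun h => absurd hf h, fun x _ _ w z _ _ => by rw [hf]; simp⟩
    · obtain ⟨f', hf', hdiv⟩ := hpush f hf
      obtain ⟨c, hc, hcf⟩ := exists_ratio hF hg.1 f.2 f₀.2 f'.2 f₀'.2
        (CoxPiece.coe_ne_zero hf) (CoxPiece.coe_ne_zero hf₀) (CoxPiece.coe_ne_zero hf')
        (CoxPiece.coe_ne_zero hf₀') hdiv hdiv₀
      refine ⟨c⁻¹ • f', fun _ => ⟨smul_ne_zero (inv_ne_zero hc) hf', ?_⟩, ?_⟩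
      · rw [hdiv, Submodule.coe_smul, divisor_smul _ (inv_ne_zero hc)]
      · intro x hx hgx w z hw hz
        rw [Submodule.coe_smul, smul_eval, mul_assoc, hcf x hx hgx w z hw hz,
          inv_mul_cancel_left₀ hc]
  choose Lf hLdiv hLrel using hex
  have huniq : ∀ d : CoxPiece F k α, (∀ x ∈ torus F k, g x ∈ torus F k → ∀ w z, LiesOver w x →
      LiesOver z (g x) →
      eval z (d : MvPolynomial R k) * eval w (f₀ : MvPolynomial R k) = 0) → d = 0 := by
    intro d hd
    by_contra hd0
    obtain ⟨x, hx, hgx, w, z, hw, hz, h1, h2⟩ := exists_common_point hF hg.1 f₀.2 d.2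
      (CoxPiece.coe_ne_zero hf₀) (CoxPiece.coe_ne_zero hd0)
    exact mul_ne_zero h2 h1 (hd x hx hgx w z hw hz)
  let L₀ : CoxPiece F k α →ₗ[k] CoxPiece F k α :=
    { toFun := Lf
      map_add' := fun f h => by
        rw [← sub_eq_zero]
        refine huniq _ fun x hx hgx w z hw hz => ?_
        have h1 := hLrel (f + h) x hx hgx w z hw hz
        have h2 := hLrel f x hx hgx w z hw hz
        have h3 := hLrel h x hx hgx w z hw hz
        simp only [Submodule.coe_add, Submodule.coe_sub, map_add, map_sub] at h1 ⊢
        linear_combination h1 - h2 - h3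
      map_smul' := fun c f => by
        rw [← sub_eq_zero]
        refine huniq _ fun x hx hgx w z hw hz => ?_
        have h1 := hLrel (c • f) x hx hgx w z hw hz
        have h2 := hLrel f x hx hgx w z hw hz
        simp only [RingHom.id_apply, Submodule.coe_smul, Submodule.coe_sub, smul_eval,
          map_sub] at h1 ⊢
        linear_combination h1 - c * h2 }
  have hinj : Function.Injective L₀ := by
    rw [← LinearMap.ker_eq_bot, LinearMap.ker_eq_bot']
    intro f hf
    by_contra h
    exact (hLdiv f h).1 hf
  have hsurj : Function.Surjective L₀ := by
    intro f'
    by_cases hf' : f' = 0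
    · exact ⟨0, by rw [hf', map_zero]⟩
    · have h1 : divisor (F := F) (f' : MvPolynomial R k) ∈ linearSystem F k α :=
        ⟨f', f'.2, CoxPiece.coe_ne_zero hf', rfl⟩
      rw [← hg.2] at h1
      obtain ⟨-, ⟨f, hfα, hf, rfl⟩, hdiv⟩ := h1
      have hf : (⟨f, hfα⟩ : CoxPiece F k α) ≠ 0 := fun h => hf (congrArg Subtype.val h)
      obtain ⟨h2, h3⟩ := hLdiv ⟨f, hfα⟩ hf
      obtain ⟨c, -, hc⟩ := exists_smul_of_divisor_eq hF h2 hf' (h3.symm.trans hdiv)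
      exact ⟨c • ⟨f, hfα⟩, by rw [map_smul]; exact hc.symm⟩
  exact ⟨LinearEquiv.ofBijective L₀ ⟨hinj, hsurj⟩, ⟨hg, fun f hf => (hLdiv f hf).2⟩, f₀', hf₀',
    hLrel⟩

lemma exists_lift (hF : F.IsComplete) (hα : ∃ f ∈ CoxPiece F k α, f ≠ 0)
    {g : Equiv.Perm (Point F k)} (hg : g ∈ autClass F k α) :
    ∃ L, (g, L) ∈ linearGroup F k α := by
  obtain ⟨f, hf, hf0⟩ := hα
  obtain ⟨L, hL, -⟩ := exists_lift_aux hF hg (f₀ := ⟨f, hf⟩)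
    (fun h => hf0 (congrArg Subtype.val h))
  exact ⟨L, hL⟩

/-- A lift of `g` to `S_α` is unique up to a scalar. -/
lemma lift_unique (hF : F.IsComplete) (hα : ∃ f ∈ CoxPiece F k α, f ≠ 0)
    {g : Equiv.Perm (Point F k)} {L L' : CoxPiece F k α ≃ₗ[k] CoxPiece F k α}
    (hL : (g, L) ∈ linearGroup F k α) (hL' : (g, L') ∈ linearGroup F k α) :
    ∃ c : k, c ≠ 0 ∧ ∀ f, L' f = c • L f := by
  -- Equal divisors mean proportional forms, so every nonzero vector is an eigenvector of `L⁻¹ L'`,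
  -- which is therefore a homothety.
  have h1 : ∀ f, ¬ LinearIndependent k ![f, (L.symm.toLinearMap ∘ₗ L'.toLinearMap) f] := by
    intro f hli
    have hf : f ≠ 0 := by simpa using hli.ne_zero 0
    obtain ⟨c, -, hc⟩ := exists_smul_of_divisor_eq hF (f := L f) (f' := L' f) (by simpa using hf)
      (by simpa using hf) ((hL.2 f hf).symm.trans (hL'.2 f hf))
    have h2 : (L.symm.toLinearMap ∘ₗ L'.toLinearMap) f = c • f := by
      simp [hc]
    rw [LinearIndependent.pair_iff] at hli
    have := hli c (-1) (by rw [h2]; simp)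
    simpa using this.2
  obtain ⟨c, hc⟩ := LinearMap.exists_eq_smul_id_of_forall_notLinearIndependent h1
  have h2 : ∀ f, L' f = c • L f := fun f => by
    have := congrArg L (LinearMap.congr_fun hc f)
    simpa using this
  obtain ⟨f, hf, hf0⟩ := hα
  refine ⟨c, ?_, h2⟩
  rintro rfl
  have h3 := h2 ⟨f, hf⟩
  rw [zero_smul, LinearEquiv.map_eq_zero_iff] at h3
  exact hf0 (congrArg Subtype.val h3)

/-- The functions `f₁ / f₂` are transported by a lift of `g`. -/
lemma lift_rel (hF : F.IsComplete) {g : Equiv.Perm (Point F k)}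
    {L : CoxPiece F k α ≃ₗ[k] CoxPiece F k α} (hL : (g, L) ∈ linearGroup F k α)
    (f h : CoxPiece F k α) {x : Point F k} (hx : x ∈ torus F k) (hgx : g x ∈ torus F k)
    {w z : R → k} (hw : LiesOver w x) (hz : LiesOver z (g x)) :
    eval z (L f : MvPolynomial R k) * eval w (h : MvPolynomial R k) =
      eval w (f : MvPolynomial R k) * eval z (L h : MvPolynomial R k) := by
  by_cases hf0 : f = 0
  · rw [hf0]; simp
  by_cases hh0 : h = 0
  · rw [hh0]; simp
  have hα : ∃ f ∈ CoxPiece F k α, f ≠ 0 := ⟨f, f.2, CoxPiece.coe_ne_zero hf0⟩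
  obtain ⟨L₀, hL₀, f', hf', hrel⟩ := exists_lift_aux hF hL.1 hf0
  obtain ⟨a, ha, hLa⟩ := lift_unique hF hα hL₀ hL
  have hLne : ∀ {f : CoxPiece F k α}, f ≠ 0 → L f ≠ 0 := fun {f} hf => by simpa using hf
  obtain ⟨c, hc, hcf⟩ := exists_ratio hF hL.1.1 f.2 h.2 (L f).2 (L h).2
    (CoxPiece.coe_ne_zero hf0) (CoxPiece.coe_ne_zero hh0) (CoxPiece.coe_ne_zero (hLne hf0))
    (CoxPiece.coe_ne_zero (hLne hh0)) (hL.2 f hf0) (hL.2 h hh0)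
  -- For a single pair of forms the constant is undetermined; comparison with the normalised lift
  -- `L₀`, of which `L` is a multiple, shows that it is `1`.
  have hc1 : c = 1 := by
    obtain ⟨x, hx, hgx, w, z, hw, hz, h1, h2⟩ := exists_common_point hF hL.1.1
      (IsWeightedHomogeneous.mul f.2 h.2) f'.2
      (mul_ne_zero (CoxPiece.coe_ne_zero hf0) (CoxPiece.coe_ne_zero hh0))
      (CoxPiece.coe_ne_zero hf')
    have e₁ := hcf x hx hgx w z hw hz
    have e₂ := hrel f x hx hgx w z hw hz
    have e₃ := hrel h x hx hgx w z hw hz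
    rw [hLa, hLa, Submodule.coe_smul, Submodule.coe_smul, smul_eval, smul_eval] at e₁
    rw [map_mul] at h1
    refine mul_right_cancel₀ (mul_ne_zero ha (mul_ne_zero h1 h2)) ?_
    linear_combination -eval w (f : MvPolynomial R k) * e₁ +
      a * eval w (h : MvPolynomial R k) * e₂ - c * a * eval w (f : MvPolynomial R k) * e₃
  rw [hcf x hx hgx w z hw hz, hc1, one_mul]

end Lift

/-! ### Rational functions and their values -/

/-- The field of rational functions on `X`. -/
abbrev RatFun (n : ℕ) (k : Type*) [Field k] : Type _ := FractionRing (CharAlg n k)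

/-- The invariant derivation of the field of rational functions that extends `logDer l`. -/
lemma exists_derivation_ratFun (l : (Fin n → ℤ) →+ k) :
    ∃ D : RatFun n k →ₗ[k] RatFun n k, (∀ r s, D (r * s) = r * D s + s * D r) ∧
      ∀ p : CharAlg n k, D (algebraMap _ _ p) = algebraMap _ _ (logDer l p) := by
  -- Encode the derivation as the algebra map `p ↦ p + ε · logDer l p`. It extends to fractions
  -- because a dual number with invertible first component is invertible.
  let E₀ : CharAlg n k →ₐ[k] DualNumber (RatFun n k) :=
    { toFun := fun p => (algebraMap _ _ p, algebraMap _ _ (logDer l p))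
      map_one' := TrivSqZeroExt.ext (map_one _) (by
        change algebraMap _ _ (logDer l 1) = (0 : RatFun n k)
        rw [Derivation.map_one_eq_zero, map_zero])
      map_mul' := fun p q => TrivSqZeroExt.ext (map_mul _ p q) (by
        change algebraMap _ _ (logDer l (p * q)) = algebraMap _ _ p * algebraMap _ _ (logDer l q) +
          algebraMap _ (RatFun n k) (logDer l p) * algebraMap _ _ q
        rw [Derivation.leibniz, map_add, smul_eq_mul, smul_eq_mul, map_mul, map_mul,
          mul_comm (algebraMap _ _ q)])
      map_zero' := TrivSqZeroExt.ext (map_zero _) (by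
        change algebraMap _ _ (logDer l 0) = (0 : RatFun n k)
        rw [map_zero, map_zero])
      map_add' := fun p q => TrivSqZeroExt.ext (map_add _ p q) (by
        change algebraMap _ _ (logDer l (p + q)) = algebraMap _ _ (logDer l p) +
          algebraMap _ (RatFun n k) (logDer l q)
        rw [map_add, map_add])
      commutes' := fun c => TrivSqZeroExt.ext
        (IsScalarTower.algebraMap_apply k (CharAlg n k) (RatFun n k) c).symm (by
        change algebraMap _ _ (logDer l (algebraMap k _ c)) = (0 : RatFun n k)
        rw [Derivation.map_algebraMap, map_zero]) }
  have hunit : ∀ y : nonZeroDivisors (CharAlg n k), IsUnit (E₀ y) := fun y => by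
    rw [TrivSqZeroExt.isUnit_iff_isUnit_fst]
    change IsUnit (algebraMap _ (RatFun n k) (y : CharAlg n k))
    rw [isUnit_iff_ne_zero]
    exact IsFractionRing.to_map_ne_zero_of_mem_nonZeroDivisors y.2
  let E : RatFun n k →ₐ[k] DualNumber (RatFun n k) :=
    IsLocalization.liftAlgHom (M := nonZeroDivisors (CharAlg n k)) (f := E₀) hunit
  have hE : ∀ p : CharAlg n k, E (algebraMap _ _ p) = E₀ p := fun p => by
    simp [E]
  have hfst : ∀ r, TrivSqZeroExt.fst (E r) = r := by
    have : (TrivSqZeroExt.fstHom k (RatFun n k) (RatFun n k)).comp E = AlgHom.id k _ := by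
      refine IsLocalization.algHom_ext (nonZeroDivisors (CharAlg n k)) ?_
      refine AlgHom.ext fun p => ?_
      change TrivSqZeroExt.fst (E (algebraMap _ _ p)) = algebraMap _ _ p
      rw [hE]; rfl
    exact fun r => AlgHom.congr_fun this r
  refine ⟨⟨⟨fun r => TrivSqZeroExt.snd (E r), fun r s => by simp⟩, fun c r => by simp⟩,
    fun r s => ?_, fun p => ?_⟩
  · change TrivSqZeroExt.snd (E (r * s)) = r * TrivSqZeroExt.snd (E s) + s * TrivSqZeroExt.snd (E r)
    rw [map_mul, TrivSqZeroExt.snd_mul, hfst, hfst, op_smul_eq_mul, smul_eq_mul,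
      mul_comm s]
  · change TrivSqZeroExt.snd (E (algebraMap _ _ p)) = _
    rw [hE]
    rfl

section Rat

variable {F : Fan n R}

/-- The rational function `r` represents the function `φ` at the general point of `X`. -/
def Represents (φ : Point F k → k) (r : RatFun n k) : Prop :=
  ∃ p q : CharAlg n k, q ≠ 0 ∧ r * algebraMap _ _ q = algebraMap _ _ p ∧
    ∀ y ∈ torus F k, pev y q ≠ 0 → φ y * pev y q = pev y p

/-- The rational function `r` is regular at `x` with value `v`. -/
def HasVal (x : Point F k) (r : RatFun n k) (v : k) : Prop :=
  ∃ p ∈ Reg F k x.cone, ∃ q ∈ Reg F k x.cone, pev x q ≠ 0 ∧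
    r * algebraMap _ _ q = algebraMap _ _ p ∧ v * pev x q = pev x p

lemma map_ne_zero' {q : CharAlg n k} (hq : q ≠ 0) : algebraMap _ (RatFun n k) q ≠ 0 :=
  fun h => hq ((IsFractionRing.to_map_eq_zero_iff).mp h)

lemma map_inj {p q : CharAlg n k} (h : algebraMap _ (RatFun n k) p = algebraMap _ _ q) : p = q :=
  IsFractionRing.injective _ _ h

lemma HasVal.unique {x : Point F k} {r : RatFun n k} {v v' : k} (h : HasVal x r v)
    (h' : HasVal x r v') : v = v' := by
  obtain ⟨p, hp, q, hq, hqx, hr, hv⟩ := h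
  obtain ⟨p', hp', q', hq', hqx', hr', hv'⟩ := h'
  have h1 : p * q' = p' * q := by
    apply map_inj
    rw [map_mul, map_mul, ← hr, ← hr']
    ring
  have h2 := congrArg (pev x) h1
  rw [pev_mul hp hq' (Finset.Subset.refl _), pev_mul hp' hq (Finset.Subset.refl _), ← hv,
    ← hv'] at h2
  exact mul_right_cancel₀ (mul_ne_zero hqx hqx') (by linear_combination h2)

lemma hasVal_map {x : Point F k} {p : CharAlg n k} (hp : p ∈ Reg F k x.cone) :
    HasVal x (algebraMap _ _ p) (pev x p) :=
  ⟨p, hp, 1, one_mem _, by simp, by simp, by simp⟩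

lemma HasVal.add {x : Point F k} {r s : RatFun n k} {v u : k} (h : HasVal x r v)
    (h' : HasVal x s u) : HasVal x (r + s) (v + u) := by
  obtain ⟨p, hp, q, hq, hqx, hr, hv⟩ := h
  obtain ⟨p', hp', q', hq', hqx', hr', hv'⟩ := h'
  have hc : x ∈ chart F k x.cone := Finset.Subset.refl _
  refine ⟨p * q' + p' * q, add_mem (mul_mem hp hq') (mul_mem hp' hq), q * q', mul_mem hq hq',
    ?_, ?_, ?_⟩
  · rw [pev_mul hq hq' hc]; exact mul_ne_zero hqx hqx'
  · rw [map_add, map_mul, map_mul, map_mul, ← hr, ← hr']; ring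
  · rw [map_add, pev_mul hq hq' hc, pev_mul hp hq' hc, pev_mul hp' hq hc, ← hv, ← hv']; ring

lemma HasVal.mul {x : Point F k} {r s : RatFun n k} {v u : k} (h : HasVal x r v)
    (h' : HasVal x s u) : HasVal x (r * s) (v * u) := by
  obtain ⟨p, hp, q, hq, hqx, hr, hv⟩ := h
  obtain ⟨p', hp', q', hq', hqx', hr', hv'⟩ := h'
  have hc : x ∈ chart F k x.cone := Finset.Subset.refl _
  refine ⟨p * p', mul_mem hp hp', q * q', mul_mem hq hq', ?_, ?_, ?_⟩
  · rw [pev_mul hq hq' hc]; exact mul_ne_zero hqx hqx'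
  · rw [map_mul, map_mul, ← hr, ← hr']; ring
  · rw [pev_mul hq hq' hc, pev_mul hp hp' hc, ← hv, ← hv']; ring

lemma HasVal.smul {x : Point F k} {r : RatFun n k} {v : k} (h : HasVal x r v) (c : k) :
    HasVal x (c • r) (c * v) := by
  obtain ⟨p, hp, q, hq, hqx, hr, hv⟩ := h
  refine ⟨c • p, Subalgebra.smul_mem _ hp c, q, hq, hqx, ?_, ?_⟩
  · rw [smul_mul_assoc, hr]; exact (map_smul (Algebra.algHom k (CharAlg n k) (RatFun n k)) c p).symm
  · rw [map_smul, smul_eq_mul, ← hv, mul_assoc]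

lemma hasVal_sum {ι : Type*} (s : Finset ι) {x : Point F k} {r : ι → RatFun n k} {v : ι → k}
    (h : ∀ i ∈ s, HasVal x (r i) (v i)) : HasVal x (∑ i ∈ s, r i) (∑ i ∈ s, v i) := by
  classical
  induction s using Finset.induction_on with
  | empty =>
    have := hasVal_map (x := x) (zero_mem (Reg F k x.cone))
    simpa using this
  | insert i s hi ih =>
    rw [Finset.sum_insert hi, Finset.sum_insert hi]
    exact (h i (Finset.mem_insert_self _ _)).add
      (ih fun j hj => h j (Finset.mem_insert_of_mem hj))

/-- A derivation of `k[M]` preserves regularity at the points of the torus. -/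
lemma HasVal.derivation {l : (Fin n → ℤ) →+ k} {D : RatFun n k →ₗ[k] RatFun n k}
    (hD : ∀ r s, D (r * s) = r * D s + s * D r)
    (hDp : ∀ p : CharAlg n k, D (algebraMap _ _ p) = algebraMap _ _ (logDer l p))
    {t : Point F k} (ht : t ∈ torus F k) {r : RatFun n k} {v : k} (h : HasVal t r v) :
    ∃ v', HasVal t (D r) v' := by
  obtain ⟨p, -, q, -, hqx, hr, hv⟩ := h
  have hmem : ∀ p : CharAlg n k, p ∈ Reg F k t.cone := fun p => by
    rw [mem_torus.mp ht]; exact mem_Reg_empty p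
  have h1 := congrArg D hr
  rw [hD, hDp, hDp] at h1
  have hq2 : pev t (q * q) ≠ 0 := by
    rw [pev_mul_torus _ _ ht]; exact mul_ne_zero hqx hqx
  refine ⟨pev t (logDer l p * q - p * logDer l q) / pev t (q * q), _,
    hmem (logDer l p * q - p * logDer l q), q * q, hmem _, hq2, ?_, div_mul_cancel₀ _ hq2⟩
  rw [map_sub, map_mul, map_mul, map_mul, ← h1, ← hr]
  ring

variable [IsAlgClosed k] [CharZero k]

lemma Represents.unique (hF : F.IsComplete) {φ : Point F k → k} {r r' : RatFun n k}
    (h : Represents φ r) (h' : Represents φ r') : r = r' := by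
  obtain ⟨p, q, hq, hr, hφ⟩ := h
  obtain ⟨p', q', hq', hr', hφ'⟩ := h'
  have h1 : p * q' = p' * q := by
    rw [← sub_eq_zero]
    refine pev_eq_zero_of_generic hF (mul_ne_zero hq hq') fun y hy hy' => ?_
    rw [pev_mul_torus _ _ hy] at hy'
    rw [map_sub, pev_mul_torus _ _ hy, pev_mul_torus _ _ hy,
      ← hφ y hy (left_ne_zero_of_mul hy'), ← hφ' y hy (right_ne_zero_of_mul hy')]
    ring
  have h2 := congrArg (algebraMap _ (RatFun n k)) h1
  rw [map_mul, map_mul, ← hr, ← hr'] at h2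
  exact mul_right_cancel₀ (mul_ne_zero (map_ne_zero' hq) (map_ne_zero' hq'))
    (by linear_combination h2)

lemma Represents.congr {φ ψ : Point F k → k} {r : RatFun n k}
    (h : Represents φ r) {V : Set (Point F k)} (hV : IsOpen V) (hne : V.Nonempty)
    (heq : ∀ y ∈ V, y ∈ torus F k → φ y = ψ y) : Represents ψ r := by
  obtain ⟨p, q, hq, hr, hφ⟩ := h
  obtain ⟨b, hb, hbV⟩ := exists_torus_subset hV hne
  refine ⟨p * b, q * b, mul_ne_zero hq hb, ?_, fun y hy hy' => ?_⟩
  · rw [map_mul, map_mul, ← hr]; ring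
  · rw [pev_mul_torus _ _ hy] at hy' ⊢
    rw [pev_mul_torus _ _ hy, ← hφ y hy (left_ne_zero_of_mul hy'),
      heq y (hbV y hy (right_ne_zero_of_mul hy')) hy, mul_assoc]

lemma Represents.add {φ ψ : Point F k → k} {r s : RatFun n k} (h : Represents φ r)
    (h' : Represents ψ s) : Represents (fun y => φ y + ψ y) (r + s) := by
  obtain ⟨p, q, hq, hr, hφ⟩ := h
  obtain ⟨p', q', hq', hr', hφ'⟩ := h'
  refine ⟨p * q' + p' * q, q * q', mul_ne_zero hq hq', ?_, fun y hy hy' => ?_⟩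
  · rw [map_add, map_mul, map_mul, map_mul, ← hr, ← hr']; ring
  · rw [pev_mul_torus _ _ hy] at hy'
    rw [map_add, pev_mul_torus _ _ hy, pev_mul_torus _ _ hy, pev_mul_torus _ _ hy,
      ← hφ y hy (left_ne_zero_of_mul hy'), ← hφ' y hy (right_ne_zero_of_mul hy')]
    ring

lemma Represents.mul {φ ψ : Point F k → k} {r s : RatFun n k} (h : Represents φ r)
    (h' : Represents ψ s) : Represents (fun y => φ y * ψ y) (r * s) := by
  obtain ⟨p, q, hq, hr, hφ⟩ := h
  obtain ⟨p', q', hq', hr', hφ'⟩ := h'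
  refine ⟨p * p', q * q', mul_ne_zero hq hq', ?_, fun y hy hy' => ?_⟩
  · rw [map_mul, map_mul, ← hr, ← hr']; ring
  · rw [pev_mul_torus _ _ hy] at hy'
    rw [pev_mul_torus _ _ hy, pev_mul_torus _ _ hy,
      ← hφ y hy (left_ne_zero_of_mul hy'), ← hφ' y hy (right_ne_zero_of_mul hy')]
    ring

lemma represents_map (p : CharAlg n k) :
    Represents (F := F) (fun y => pev y p) (algebraMap _ _ p) :=
  ⟨p, 1, one_ne_zero, by simp, fun _ _ _ => by simp⟩

lemma represents_const (c : k) :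
    Represents (F := F) (fun _ => c) (algebraMap k (RatFun n k) c) := by
  refine ⟨algebraMap k _ c, 1, one_ne_zero, ?_, fun y _ _ => ?_⟩
  · rw [map_one, mul_one, ← IsScalarTower.algebraMap_apply]
  · rw [pev_one, mul_one, Algebra.algebraMap_eq_smul_one, map_smul, pev_one, smul_eq_mul, mul_one]

/-- A function that is regular at `x` is represented by a rational function with the same
value at `x`. -/
lemma RegularAt.exists_represents {φ : Point F k → k} {x : Point F k} (h : RegularAt φ x) :
    ∃ r, Represents φ r ∧ HasVal x r (φ x) := by
  obtain ⟨p, hp, q, hq, hqx, hpq⟩ := h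
  have hq0 := map_ne_zero' (ne_zero_of_pev hqx)
  have h1 : algebraMap _ (RatFun n k) p / algebraMap _ _ q * algebraMap _ _ q =
    algebraMap _ _ p := div_mul_cancel₀ _ hq0
  exact ⟨_, ⟨p, q, ne_zero_of_pev hqx, h1, fun y hy => hpq y (torus_subset_chart _ hy)⟩,
    p, hp, q, hq, hqx, h1, hpq x (Finset.Subset.refl _) hqx⟩

lemma HasVal.exists_regularAt {x : Point F k} {r : RatFun n k} {v : k} (h : HasVal x r v) :
    ∃ φ : Point F k → k, RegularAt φ x ∧ Represents φ r ∧ φ x = v := by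
  obtain ⟨p, hp, q, hq, hqx, hr, hv⟩ := h
  refine ⟨fun y => pev y p / pev y q, regularAt_div hp hq (Finset.Subset.refl _) hqx,
    ⟨p, q, ne_zero_of_pev hqx, hr, fun _ _ h => div_mul_cancel₀ _ h⟩, ?_⟩
  change pev x p / pev x q = v
  rw [← hv, mul_div_cancel_right₀ _ hqx]

/-- The action of an automorphism on rational functions. -/
lemma exists_pullback (hF : F.IsComplete) {g : Equiv.Perm (Point F k)} (hg : g ∈ autX F k) :
    ∃ γ : RatFun n k →ₐ[k] RatFun n k, ∀ (φ : Point F k → k) (r : RatFun n k),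
      Represents φ r → Represents (fun y => φ (g y)) (γ r) := by
  have hV : IsOpen (g ⁻¹' torus F k) := isOpen_torus.preimage hg.1.1
  obtain ⟨x₁, hx₁, -⟩ := exists_torus_pev_ne_zero hF (one_ne_zero (α := CharAlg n k))
  have hne : (g ⁻¹' torus F k).Nonempty :=
    ⟨g.symm x₁, by rw [Set.mem_preimage, g.apply_symm_apply]; exact hx₁⟩
  have hex : ∀ p : CharAlg n k, ∃ r, Represents (F := F) (fun y => pev (g y) p) r := by
    intro p
    obtain ⟨y, hy⟩ := hne
    obtain ⟨r, hr, -⟩ := (RegularAt.comp (φ := fun y => pev y p) hg.1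
      (regularAt_pev (mem_Reg_empty p) (torus_subset_chart _ hy))).exists_represents
    exact ⟨r, hr⟩
  choose γ₀ hγ₀ using hex
  have hmul : ∀ p q, γ₀ (p * q) = γ₀ p * γ₀ q := fun p q =>
    (hγ₀ (p * q)).unique hF (((hγ₀ p).mul (hγ₀ q)).congr hV hne fun y hy _ =>
      (pev_mul_torus p q hy).symm)
  have hadd : ∀ p q, γ₀ (p + q) = γ₀ p + γ₀ q := fun p q =>
    (hγ₀ (p + q)).unique hF (((hγ₀ p).add (hγ₀ q)).congr hV hne fun y _ _ =>
      (map_add _ p q).symm)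
  have halg : ∀ c : k, γ₀ (algebraMap k _ c) = algebraMap k _ c := fun c =>
    (hγ₀ _).unique hF ((represents_const c).congr hV hne fun y _ _ => by
      rw [Algebra.algebraMap_eq_smul_one, map_smul, pev_one, smul_eq_mul, mul_one])
  let γ₁ : CharAlg n k →ₐ[k] RatFun n k :=
    { toFun := γ₀
      map_one' := by have := halg 1; rwa [map_one, map_one] at this
      map_mul' := hmul
      map_zero' := by have := halg 0; rwa [map_zero, map_zero] at this
      map_add' := hadd
      commutes' := halg }
  -- If `p ∘ g` were represented by zero it would vanish on a nonempty open set, which by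
  -- irreducibility meets the preimage of the set where `p ≠ 0`.
  have hinj : ∀ p : CharAlg n k, γ₀ p = 0 → p = 0 := by
    intro p hp
    by_contra hp0
    have hr := hγ₀ p
    rw [hp] at hr
    obtain ⟨a, b, hb, hab, h⟩ := hr
    rw [zero_mul] at hab
    have ha : a = 0 := IsFractionRing.to_map_eq_zero_iff.mp hab.symm
    obtain ⟨x₂, hx₂, hx₂'⟩ := exists_torus_pev_ne_zero hF hp0
    have h1 := isOpen_basic F.empty_mem (mem_Reg_empty (F := F) p)
    obtain ⟨y, hyV, hyT⟩ := inter_open_nonempty hF (h1.preimage hg.1.1)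
      ⟨g.symm x₂, by
        rw [Set.mem_preimage, g.apply_symm_apply]; exact ⟨torus_subset_chart _ hx₂, hx₂'⟩⟩
      (isOpen_basic F.empty_mem (mem_Reg_empty (F := F) b))
      (by
        obtain ⟨x, hx, hx'⟩ := exists_torus_pev_ne_zero hF hb
        exact ⟨x, torus_subset_chart _ hx, hx'⟩)
    have h2 := h y (by rw [torus_eq_chart]; exact hyT.1) hyT.2
    rw [ha, map_zero] at h2
    exact mul_ne_zero hyV.2 hyT.2 h2
  let γ : RatFun n k →ₐ[k] RatFun n k :=
    IsLocalization.liftAlgHom (M := nonZeroDivisors (CharAlg n k)) (f := γ₁) fun y =>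
      isUnit_iff_ne_zero.mpr fun h => nonZeroDivisors.coe_ne_zero y (hinj _ h)
  have hγ : ∀ p : CharAlg n k, γ (algebraMap _ _ p) = γ₀ p := fun p => by
    simp [γ, γ₁]
  refine ⟨γ, fun φ r hr => ?_⟩
  obtain ⟨p, q, hq, hpq, hφ⟩ := hr
  obtain ⟨a, b, hb, hab, hγp⟩ := hγ₀ p
  obtain ⟨c, d, hd, hcd, hγq⟩ := hγ₀ q
  have hc : c ≠ 0 := by
    rintro rfl
    rw [map_zero] at hcd
    exact hq (hinj q ((mul_eq_zero.mp hcd).resolve_right (map_ne_zero' hd)))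
  obtain ⟨e, he, heV⟩ := exists_torus_subset hV hne
  refine ⟨a * d * e * d, b * c * e * d, mul_ne_zero (mul_ne_zero (mul_ne_zero hb hc) he) hd, ?_,
    fun y hy hy' => ?_⟩
  · have h1 := congrArg γ hpq
    rw [map_mul, hγ, hγ] at h1
    simp only [map_mul]
    rw [← hab, ← hcd, ← h1]
    ring
  · simp only [pev_mul_torus _ _ hy] at hy' ⊢
    have hd0 := right_ne_zero_of_mul hy'
    have he0 := right_ne_zero_of_mul (left_ne_zero_of_mul hy')
    have hc0 := right_ne_zero_of_mul (left_ne_zero_of_mul (left_ne_zero_of_mul hy'))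
    have hb0 := left_ne_zero_of_mul (left_ne_zero_of_mul (left_ne_zero_of_mul hy'))
    have h1 : pev (g y) p * pev y b = pev y a := hγp y hy hb0
    have h2 : pev (g y) q * pev y d = pev y c := hγq y hy hd0
    have h3 := hφ (g y) (heV y hy he0) (fun h => hc0 (by rw [← h2, h, zero_mul]))
    rw [← h1, ← h2, ← h3]
    ring

end Rat

/-! ### Tangent vectors that lift to the Cox space -/

section Tangent

variable {F : Fan n R}

/-- The partial derivative of a Laurent monomial on the Cox space. -/
def laurentDer (F : Fan n R) (z : R → k) (ρ : R) (m : Fin n → ℤ) : k :=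
  ((m ⬝ᵥ F.gen ρ : ℤ) : k) * (z ρ ^ (m ⬝ᵥ F.gen ρ - 1) *
    ∏ ρ' ∈ Finset.univ.erase ρ, z ρ' ^ (m ⬝ᵥ F.gen ρ'))

lemma laurent_eq_mul_erase (z : R → k) (ρ : R) (m : Fin n → ℤ) :
    laurent F z m = z ρ ^ (m ⬝ᵥ F.gen ρ) *
      ∏ ρ' ∈ Finset.univ.erase ρ, z ρ' ^ (m ⬝ᵥ F.gen ρ') :=
  (Finset.mul_prod_erase _ _ (Finset.mem_univ ρ)).symm

lemma mul_laurentDer (z : R → k) (ρ : R) (m : Fin n → ℤ) :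
    z ρ * laurentDer F z ρ m = ((m ⬝ᵥ F.gen ρ : ℤ) : k) * laurent F z m := by
  rw [laurent_eq_mul_erase z ρ, laurentDer]
  by_cases h0 : m ⬝ᵥ F.gen ρ = 0
  · rw [h0]; simp
  have h1 : z ρ * z ρ ^ (m ⬝ᵥ F.gen ρ - 1) = z ρ ^ (m ⬝ᵥ F.gen ρ) := by
    by_cases hz : z ρ = 0
    · rw [hz, zero_mul, zero_zpow _ h0]
    · rw [← zpow_one_add₀ hz, add_sub_cancel]
  rw [← h1]
  ring

/-- A regular factor that does not vanish at a point cannot cancel poles at that point. -/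
lemma mem_Reg_of_mul_mem {x : Point F k} {q r : CharAlg n k} (hq : q ∈ Reg F k x.cone)
    (hqx : pev x q ≠ 0) (hp : q * r ∈ Reg F k x.cone) : r ∈ Reg F k x.cone := by
  classical
  by_contra hr
  have hr : ∃ μ, r.coeff μ ≠ 0 ∧ ∃ ρ ∈ x.cone, μ ⬝ᵥ F.gen ρ < 0 := by
    by_contra hcon
    push Not at hcon
    exact hr fun m hm ρ hρ => hcon m hm ρ hρ
  obtain ⟨μ₁, hμ₁, ρ, hρ, hneg⟩ := hr
  -- Compare lowest terms along `D_ρ`. Characters positive on `ρ` vanish at `x`, so `q x ≠ 0` gives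
  -- `q` a nonzero part of order `0`; its product with the part of `r` of lowest order `a < 0`
  -- survives because `k[M]` is a domain.
  obtain ⟨μ, hμ, hmin⟩ := Finset.exists_min_image r.coeff.support (fun m => m ⬝ᵥ F.gen ρ)
    ⟨μ₁, Finsupp.mem_support_iff.mpr hμ₁⟩
  have hneg' : μ ⬝ᵥ F.gen ρ < 0 :=
    (hmin μ₁ (Finsupp.mem_support_iff.mpr hμ₁)).trans_lt hneg
  set a := μ ⬝ᵥ F.gen ρ with ha
  let q₀ : CharAlg n k := .ofCoeff (q.coeff.filter fun m => m ⬝ᵥ F.gen ρ = 0)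
  let q' : CharAlg n k := .ofCoeff (q.coeff.filter fun m => ¬ m ⬝ᵥ F.gen ρ = 0)
  let r₀ : CharAlg n k := .ofCoeff (r.coeff.filter fun m => m ⬝ᵥ F.gen ρ = a)
  let r' : CharAlg n k := .ofCoeff (r.coeff.filter fun m => ¬ m ⬝ᵥ F.gen ρ = a)
  have hqs : q = q₀ + q' := by
    apply AddMonoidAlgebra.coeff_injective
    exact (Finsupp.filter_add_filter_not _ _).symm
  have hrs : r = r₀ + r' := by
    apply AddMonoidAlgebra.coeff_injective
    exact (Finsupp.filter_add_filter_not _ _).symm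
  have hq₀ : ∀ m, q₀.coeff m ≠ 0 → m ⬝ᵥ F.gen ρ = 0 := fun m hm => by
    by_contra h
    exact hm (Finsupp.filter_apply_neg _ _ h)
  have hr₀ : ∀ m, r₀.coeff m ≠ 0 → m ⬝ᵥ F.gen ρ = a := fun m hm => by
    by_contra h
    exact hm (Finsupp.filter_apply_neg _ _ h)
  have hq' : ∀ m, q'.coeff m ≠ 0 → 0 < m ⬝ᵥ F.gen ρ := fun m hm => by
    have h1 : ¬ m ⬝ᵥ F.gen ρ = 0 := fun h =>
      hm (Finsupp.filter_apply_neg _ _ (not_not_intro h))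
    have h2 : q.coeff m ≠ 0 := fun h => hm (by
      change (q.coeff.filter fun m => ¬ m ⬝ᵥ F.gen ρ = 0) m = 0
      rw [Finsupp.filter_apply, h, ite_self])
    exact lt_of_le_of_ne (hq m h2 ρ hρ) (Ne.symm h1)
  have hr' : ∀ m, r'.coeff m ≠ 0 → a < m ⬝ᵥ F.gen ρ := fun m hm => by
    have h1 : ¬ m ⬝ᵥ F.gen ρ = a := fun h =>
      hm (Finsupp.filter_apply_neg _ _ (not_not_intro h))
    have h2 : r.coeff m ≠ 0 := fun h => hm (by
      change (r.coeff.filter fun m => ¬ m ⬝ᵥ F.gen ρ = a) m = 0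
      rw [Finsupp.filter_apply, h, ite_self])
    exact lt_of_le_of_ne (hmin m (Finsupp.mem_support_iff.mpr h2)) (Ne.symm h1)
  have hq₀0 : q₀ ≠ 0 := by
    intro h
    apply hqx
    rw [hqs, h, zero_add, pev_apply]
    refine Finset.sum_eq_zero fun m hm => ?_
    change q'.coeff m * x.val m = 0
    rw [(x.val_eq_zero_iff m).mpr, mul_zero]
    intro hm'
    exact (hq' m (Finsupp.mem_support_iff.mp hm)).ne' (hm' ρ hρ)
  have hr₀0 : r₀ ≠ 0 := by
    intro h
    apply Finsupp.mem_support_iff.mp hμ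
    have h1 : r₀.coeff μ = r.coeff μ := Finsupp.filter_apply_pos _ _ rfl
    rw [← h1, h]; rfl
  have hdeg : ∀ (p s : CharAlg n k) (m : Fin n → ℤ), (p * s).coeff m ≠ 0 →
      ∃ m₁ m₂, p.coeff m₁ ≠ 0 ∧ s.coeff m₂ ≠ 0 ∧ m = m₁ + m₂ := by
    intro p s m hm
    obtain ⟨m₁, h₁, m₂, h₂, rfl⟩ := Finset.mem_add.mp
      (AddMonoidAlgebra.support_coeff_mul_subset p s (Finsupp.mem_support_iff.mpr hm))
    exact ⟨m₁, m₂, Finsupp.mem_support_iff.mp h₁, Finsupp.mem_support_iff.mp h₂, rfl⟩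
  obtain ⟨m, hm⟩ : ∃ m, (q₀ * r₀).coeff m ≠ 0 := by
    by_contra hcon
    push Not at hcon
    exact mul_ne_zero hq₀0 hr₀0 (AddMonoidAlgebra.coeff_injective (Finsupp.ext hcon))
  have hma : m ⬝ᵥ F.gen ρ = a := by
    obtain ⟨m₁, m₂, h₁, h₂, rfl⟩ := hdeg _ _ _ hm
    rw [add_dotProduct, hq₀ _ h₁, hr₀ _ h₂, zero_add]
  have h1 : (q₀ * r').coeff m = 0 := by
    by_contra h
    obtain ⟨m₁, m₂, h₁, h₂, rfl⟩ := hdeg _ _ _ h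
    rw [add_dotProduct, hq₀ _ h₁, zero_add] at hma
    exact (hr' _ h₂).ne' hma
  have h2 : (q' * r).coeff m = 0 := by
    by_contra h
    obtain ⟨m₁, m₂, h₁, h₂, rfl⟩ := hdeg _ _ _ h
    rw [add_dotProduct] at hma
    have := hq' _ h₁
    have := hmin m₂ (Finsupp.mem_support_iff.mpr h₂)
    omega
  have h3 : q * r = q₀ * r₀ + (q₀ * r' + q' * r) := by
    conv_lhs => rw [hqs, add_mul]
    rw [← add_assoc, ← mul_add, ← hrs]
  have h4 : (q * r).coeff m ≠ 0 := by
    rw [h3, AddMonoidAlgebra.coeff_add, AddMonoidAlgebra.coeff_add, Finsupp.add_apply,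
      Finsupp.add_apply, h1, h2, add_zero, add_zero]
    exact hm
  have h5 := hp m h4 ρ hρ
  rw [hma] at h5
  omega

/-- A property of characters that is closed under subtraction holds on `τ^⊥` if it holds on
`τ^⊥ ∩ σ^∨`. -/
lemma Fan.mem_of_dual_inter_perp {σ τ : Finset R} (hσ : σ ∈ F.cones) (hτ : τ ∈ F.cones)
    (hle : τ ⊆ σ) (S : AddSubgroup (Fin n → ℤ)) (hS : ∀ m ∈ F.dual σ, m ∈ F.perp τ → m ∈ S)
    {m : Fin n → ℤ} (hm : m ∈ F.perp τ) : m ∈ S := by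
  obtain ⟨m₀, hm₀, hm₀', -, hN⟩ := F.exists_add_nsmul_mem_dual hσ hτ hle
  obtain ⟨N, hN⟩ := hN m (F.perp_subset_dual _ hm)
  have hp : N • m₀ ∈ F.perp τ := fun ρ hρ => by
    rw [smul_dotProduct, hm₀' ρ hρ, smul_zero]
  have h1 := hS _ hN (F.add_mem_perp hm hp)
  have h2 := hS _ (F.nsmul_mem_dual hm₀ N) hp
  simpa using S.sub_mem h1 h2

variable [CharZero k]

/-- A homogeneous vector field on the torus that is regular at `q z` has a value at `q z` that
lifts to a tangent vector at `z`. -/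
lemma exists_tangent_of_weight (hF : F.IsComplete) {z : R → k} {x : Point F k}
    (hzx : LiesOver z x) (lam : (Fin n → ℤ) →+ k) (μ : Fin n → ℤ)
    (hlam : ∀ m ∈ F.dual x.cone, lam m ≠ 0 → μ + m ∈ F.dual x.cone) :
    ∃ v : R → k, ∀ m ∈ F.dual x.cone,
      lam m * x.val (μ + m) = ∑ ρ, v ρ * laurentDer F z ρ m := by
  have hz := hzx.zeros_subset
  by_cases h0 : lam = 0
  · exact ⟨0, fun m _ => by simp [h0]⟩
  by_cases hμ : μ ∈ F.dual x.cone
  -- For a regular weight, extend `lam` to `ℤ^{Σ(1)} → k`; the field lifts to `χ^μ · ∑ l_ρ x_ρ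
  -- ∂/∂x_ρ`.
  · let _ : DivisibleBy k ℤ :=
      { div := fun a m => a / m
        div_zero := fun a => by simp
        div_cancel := fun {m} a hm => by
          rw [zsmul_eq_mul, mul_div_cancel₀ _ (Int.cast_ne_zero.mpr hm)] }
    obtain ⟨l, hl⟩ := exists_extension (divHom F) hF.divHom_injective lam
    refine ⟨fun ρ => l ρ * laurent F z μ * z ρ, fun m hm => ?_⟩
    rw [hzx.val_eq (F.add_mem_dual hμ hm), laurent_add z hz hμ hm, hl, Finset.sum_mul]
    refine Finset.sum_congr rfl fun ρ _ => ?_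
    rw [mul_assoc, mul_laurentDer z ρ m, zsmul_eq_mul]
    change ((m ⬝ᵥ F.gen ρ : ℤ) : k) * _ * _ = _
    ring
  -- the remaining weights are the roots
  have hzero : ∀ ρ ∈ x.cone, μ ⬝ᵥ F.gen ρ < 0 → ∀ m ∈ F.perp {ρ}, lam m = 0 := by
    intro ρ hρ hneg m hm
    refine F.mem_of_dual_inter_perp x.cone_mem (F.ray_mem ρ) (Finset.singleton_subset_iff.mpr hρ)
      lam.ker (fun m hm hm' => ?_) hm
    by_contra h
    have h1 := hlam m hm h ρ hρ
    rw [add_dotProduct, hm' ρ (Finset.mem_singleton_self ρ)] at h1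
    omega
  obtain ⟨ρ, hρ, hneg⟩ : ∃ ρ ∈ x.cone, μ ⬝ᵥ F.gen ρ < 0 := by
    by_contra hcon
    push Not at hcon
    exact hμ hcon
  obtain ⟨m₁, hm₁⟩ := F.exists_pairing_eq_one ρ
  have hlin : ∀ m, lam m = ((m ⬝ᵥ F.gen ρ : ℤ) : k) * lam m₁ := by
    intro m
    have h1 : m - (m ⬝ᵥ F.gen ρ) • m₁ ∈ F.perp {ρ} := fun ρ' hρ' => by
      rw [Finset.mem_singleton.mp hρ', sub_dotProduct, smul_dotProduct, hm₁]
      simp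
    have h2 := hzero ρ hρ hneg _ h1
    rw [map_sub, map_zsmul, zsmul_eq_mul] at h2
    exact sub_eq_zero.mp h2
  have hc : lam m₁ ≠ 0 := fun h => h0 (AddMonoidHom.ext fun m => by rw [hlin, h, mul_zero]; rfl)
  obtain ⟨m₀, hm₀, hm₀', hpos, hN⟩ := F.exists_add_nsmul_mem_dual x.cone_mem (F.ray_mem ρ)
    (Finset.singleton_subset_iff.mpr hρ)
  have hm₀ρ := hm₀' ρ (Finset.mem_singleton_self ρ)
  -- Test regularity on a character of `σ^∨` of order exactly `1` along `D_ρ`: the pole can only be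
  -- simple.
  have hμρ : μ ⬝ᵥ F.gen ρ = -1 := by
    obtain ⟨N, hN⟩ := hN m₁ fun ρ' hρ' => by rw [Finset.mem_singleton.mp hρ', hm₁]; exact zero_le_one
    have h1 : (m₁ + N • m₀) ⬝ᵥ F.gen ρ = 1 := by
      rw [add_dotProduct, smul_dotProduct, hm₀ρ, hm₁]; simp
    have h2 := hlam _ hN (by rw [hlin, h1, Int.cast_one, one_mul]; exact hc) ρ hρ
    rw [add_dotProduct, h1] at h2
    omega
  -- A pole along a second ray would make `lam` a multiple of that pairing as well. The form `m₀`,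
  -- zero on `ρ` and positive on `ρ'`, then forces `lam = 0`.
  have hμρ' : ∀ ρ' ∈ x.cone, ρ' ≠ ρ → 0 ≤ μ ⬝ᵥ F.gen ρ' := by
    intro ρ' hρ' hne
    by_contra hneg'
    push Not at hneg'
    obtain ⟨m₂, hm₂⟩ := F.exists_pairing_eq_one ρ'
    have h1 := hpos ρ' hρ' (by simpa using hne)
    have h2 : m₀ - (m₀ ⬝ᵥ F.gen ρ') • m₂ ∈ F.perp {ρ'} := fun ρ'' hρ'' => by
      rw [Finset.mem_singleton.mp hρ'', sub_dotProduct, smul_dotProduct, hm₂]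
      simp
    have h3 := hzero ρ' hρ' hneg' _ h2
    rw [map_sub, hlin m₀, hm₀ρ, map_zsmul, zsmul_eq_mul, Int.cast_zero, zero_mul, zero_sub,
      neg_eq_zero, mul_eq_zero, Int.cast_eq_zero] at h3
    have h4 : lam m₂ = 0 := h3.resolve_left h1.ne'
    have h5 : m₁ - (m₁ ⬝ᵥ F.gen ρ') • m₂ ∈ F.perp {ρ'} := fun ρ'' hρ'' => by
      rw [Finset.mem_singleton.mp hρ'', sub_dotProduct, smul_dotProduct, hm₂]
      simp
    have h6 := hzero ρ' hρ' hneg' _ h5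
    rw [map_sub, map_zsmul, h4, smul_zero, sub_zero] at h6
    exact hc h6
  -- The root vector field lifts to `∂/∂x_ρ` times the monomial `x_ρ χ^μ`, which is free of `x_ρ`
  -- because `⟨μ, u_ρ⟩ = -1`.
  refine ⟨Pi.single ρ (lam m₁ * ∏ ρ' ∈ Finset.univ.erase ρ, z ρ' ^ (μ ⬝ᵥ F.gen ρ')),
    fun m hm => ?_⟩
  rw [Finset.sum_eq_single ρ (fun ρ' _ hne => by rw [Pi.single_eq_of_ne hne, zero_mul])
    (fun h => absurd (Finset.mem_univ ρ) h), Pi.single_eq_same]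
  by_cases hm0 : m ⬝ᵥ F.gen ρ = 0
  · rw [hlin, laurentDer, hm0]; simp
  have hl : lam m ≠ 0 := by
    rw [hlin]; exact mul_ne_zero (Int.cast_ne_zero.mpr hm0) hc
  rw [hzx.val_eq (hlam m hm hl), laurent_eq_mul_erase z ρ, hlin, laurentDer]
  have h1 : (μ + m) ⬝ᵥ F.gen ρ = m ⬝ᵥ F.gen ρ - 1 := by
    rw [add_dotProduct, hμρ]; ring
  have h2 : ∏ ρ' ∈ Finset.univ.erase ρ, z ρ' ^ ((μ + m) ⬝ᵥ F.gen ρ') =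
      (∏ ρ' ∈ Finset.univ.erase ρ, z ρ' ^ (μ ⬝ᵥ F.gen ρ')) *
        ∏ ρ' ∈ Finset.univ.erase ρ, z ρ' ^ (m ⬝ᵥ F.gen ρ') := by
    rw [← Finset.prod_mul_distrib]
    refine Finset.prod_congr rfl fun ρ' hρ' => ?_
    rw [add_dotProduct]
    by_cases h : z ρ' = 0
    · have h3 := hμρ' ρ' (hz ρ' h) (Finset.ne_of_mem_erase hρ')
      have h4 := hm ρ' (hz ρ' h)
      rw [← Int.toNat_of_nonneg h3, ← Int.toNat_of_nonneg h4, ← Nat.cast_add, zpow_natCast,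
        zpow_natCast, zpow_natCast, pow_add]
    · exact zpow_add₀ h _ _
  rw [h1, h2]
  ring

end Tangent

/-! ### Automorphisms and singular points on the Cox space -/

section Sing

variable {F : Fan n R}

lemma pev_single_mul (x : Point F k) (m : Fin n → ℤ) (p : CharAlg n k) :
    pev x (AddMonoidAlgebra.single m 1 * p) = p.coeff.sum fun μ c => c * x.val (μ + m) := by
  rw [AddMonoidAlgebra.mul_def, AddMonoidAlgebra.coeff_single, Finsupp.sum_single_index (by simp)]
  simp only [Finsupp.sum, map_sum, pev_single, one_mul, add_comm m]

lemma coeff_single_mul (m μ : Fin n → ℤ) (p : CharAlg n k) :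
    (AddMonoidAlgebra.single m 1 * p).coeff (μ + m) = p.coeff μ := by
  rw [add_comm]
  simp

/-- The character `m` as a rational function. -/
def charFun (k : Type*) [Field k] (m : Fin n → ℤ) : RatFun n k :=
  algebraMap (CharAlg n k) _ (AddMonoidAlgebra.single m 1)

lemma charFun_add (m m' : Fin n → ℤ) : charFun k (m + m') = charFun k m * charFun k m' := by
  rw [charFun, charFun, charFun, ← map_mul, AddMonoidAlgebra.single_mul_single, one_mul]

lemma charFun_zero : charFun k (0 : Fin n → ℤ) = 1 := by
  rw [charFun, ← AddMonoidAlgebra.one_def, map_one]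

lemma charFun_mul_neg (m : Fin n → ℤ) : charFun k m * charFun k (-m) = 1 := by
  rw [← charFun_add, add_neg_cancel, charFun_zero]

variable [IsAlgClosed k] [CharZero k]

lemma exists_represents (r : RatFun n k) : ∃ φ : Point F k → k, Represents φ r := by
  obtain ⟨p, q, hq, rfl⟩ := IsFractionRing.div_surjective (A := CharAlg n k) r
  have hq0 := nonZeroDivisors.ne_zero hq
  exact ⟨fun y => pev y p / pev y q, p, q, hq0, div_mul_cancel₀ _ (map_ne_zero' hq0),
    fun y _ h => div_mul_cancel₀ _ h⟩

lemma HasVal.pullback (hF : F.IsComplete) {g : Equiv.Perm (Point F k)} (hg : g ∈ autX F k)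
    {γ : RatFun n k →ₐ[k] RatFun n k} (hγ : ∀ (φ : Point F k → k) (r : RatFun n k),
      Represents φ r → Represents (fun y => φ (g y)) (γ r)) {t : Point F k} {r : RatFun n k} {v : k}
    (h : HasVal (g t) r v) : HasVal t (γ r) v := by
  obtain ⟨φ, hφ, hr, rfl⟩ := h.exists_regularAt
  obtain ⟨s, hs, hv⟩ := (RegularAt.comp hg.1 hφ).exists_represents
  rwa [(hγ φ r hr).unique hF hs]

/-- An invariant vector field on the torus, transported by an automorphism `g`, takes at the
points of `g T` values that lift to the Cox space. -/
lemma exists_tangent (hF : F.IsComplete) {g : Equiv.Perm (Point F k)} (hg : g ∈ autX F k)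
    {γ : RatFun n k →ₐ[k] RatFun n k} (hγ : ∀ (φ : Point F k → k) (r : RatFun n k),
      Represents φ r → Represents (fun y => φ (g y)) (γ r))
    {l : (Fin n → ℤ) →+ k} {D : RatFun n k →ₗ[k] RatFun n k}
    (hD : ∀ r s, D (r * s) = r * D s + s * D r)
    (hDp : ∀ p : CharAlg n k, D (algebraMap _ _ p) = algebraMap _ _ (logDer l p))
    {t : Point F k} (ht : t ∈ torus F k) {z : R → k} (hz : LiesOver z (g t)) :
    ∃ V : R → k, ∀ m ∈ F.dual (g t).cone,
      HasVal t (D (γ (charFun k m))) (∑ ρ, V ρ * laurentDer F z ρ m) := by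
  classical
  have hg' : g.symm ∈ autX F k := inv_mem hg
  obtain ⟨δ, hδ⟩ := exists_pullback hF hg'
  have hcomp : ∀ r, δ (γ r) = r := fun r => by
    obtain ⟨φ, hφ⟩ := exists_represents (F := F) r
    have h1 := hδ _ _ (hγ φ r hφ)
    simp only [Equiv.apply_symm_apply] at h1
    exact h1.unique hF hφ
  set x := g t with hx
  have hxc : x ∈ chart F k x.cone := Finset.Subset.refl _
  let θ : RatFun n k → RatFun n k := fun r => δ (D (γ r))
  have hθ : ∀ r s, θ (r * s) = r * θ s + s * θ r := fun r s => by
    simp only [θ, map_mul, hD, map_add, hcomp]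
  have hreg : ∀ m ∈ F.dual x.cone, ∃ v, HasVal t (D (γ (charFun k m))) v ∧
      HasVal x (θ (charFun k m)) v := fun m hm => by
    obtain ⟨v, hv⟩ := (HasVal.pullback hF hg hγ
      (hasVal_map (single_mem_Reg hm (1 : k)))).derivation hD hDp ht
    refine ⟨v, hv, HasVal.pullback hF hg' hδ ?_⟩
    rwa [hx, Equiv.symm_apply_apply]
  -- `θ` is the vector field transported by `g`. Its logarithmic form `m ↦ θ(χ^m) / χ^m` is additive
  -- by the Leibniz rule.
  let Λ : (Fin n → ℤ) →+ RatFun n k := AddMonoidHom.mk' (fun m => θ (charFun k m) * charFun k (-m))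
    fun m m' => by
      have h1 := charFun_mul_neg (k := k) m
      have h2 := charFun_mul_neg (k := k) m'
      rw [charFun_add, hθ, neg_add, charFun_add]
      linear_combination (θ (charFun k m') * charFun k (-m')) * h1 +
        (θ (charFun k m) * charFun k (-m)) * h2
  have hΛ : ∀ m, charFun k m * Λ m = θ (charFun k m) := fun m => by
    change charFun k m * (θ (charFun k m) * charFun k (-m)) = _
    linear_combination (θ (charFun k m)) * charFun_mul_neg (k := k) m
  -- a common denominator
  let S : AddSubgroup (Fin n → ℤ) :=
    { carrier := {m | ∃ Q ∈ Reg F k x.cone, pev x Q ≠ 0 ∧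
        ∃ r : CharAlg n k, Λ m * algebraMap _ _ Q = algebraMap _ _ r}
      zero_mem' := ⟨1, one_mem _, by simp, 0, by simp⟩
      add_mem' := by
        rintro m m' ⟨Q, hQ, hQx, r, hr⟩ ⟨Q', hQ', hQx', r', hr'⟩
        refine ⟨Q * Q', mul_mem hQ hQ', ?_, r * Q' + r' * Q, ?_⟩
        · rw [pev_mul hQ hQ' hxc]; exact mul_ne_zero hQx hQx'
        · simp only [map_add, map_mul, ← hr, ← hr']; ring
      neg_mem' := by
        rintro m ⟨Q, hQ, hQx, r, hr⟩
        exact ⟨Q, hQ, hQx, -r, by rw [map_neg, map_neg, ← hr, neg_mul]⟩ }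
  have hS : ∀ m, m ∈ S := fun m => by
    refine F.mem_of_dual_inter_perp x.cone_mem F.empty_mem (Finset.empty_subset _) S
      (fun m hm _ => ?_) (m := m) fun ρ hρ => absurd hρ (Finset.notMem_empty ρ)
    obtain ⟨v, -, p, hp, q, hq, hqx, hr, -⟩ := hreg m hm
    refine ⟨q, hq, hqx, p * AddMonoidAlgebra.single (-m) 1, ?_⟩
    rw [map_mul, ← hr]
    change θ (charFun k m) * charFun k (-m) * _ = _ * charFun k (-m)
    ring
  choose Q₀ hQ₀ hQ₀x r₀ hr₀ using fun i : Fin n => hS (Pi.single i 1)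
  set Q := ∏ i, Q₀ i with hQdef
  have hQ : Q ∈ Reg F k x.cone := Subalgebra.prod_mem _ fun i _ => hQ₀ i
  have hQx : pev x Q ≠ 0 := by
    have : ∀ s : Finset (Fin n), pev x (∏ i ∈ s, Q₀ i) ≠ 0 := fun s => by
      induction s using Finset.induction_on with
      | empty => simp
      | insert i s hi ih =>
        rw [Finset.prod_insert hi, pev_mul (hQ₀ i) (Subalgebra.prod_mem _ fun i _ => hQ₀ i) hxc]
        exact mul_ne_zero (hQ₀x i) ih
    exact this _
  let S' : AddSubgroup (Fin n → ℤ) :=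
    { carrier := {m | ∃ r : CharAlg n k, Λ m * algebraMap _ _ Q = algebraMap _ _ r}
      zero_mem' := ⟨0, by simp⟩
      add_mem' := by
        rintro m m' ⟨r, hr⟩ ⟨r', hr'⟩
        exact ⟨r + r', by rw [map_add, map_add, ← hr, ← hr', add_mul]⟩
      neg_mem' := by
        rintro m ⟨r, hr⟩
        exact ⟨-r, by rw [map_neg, map_neg, ← hr, neg_mul]⟩ }
  have hgen : ∀ T : AddSubgroup (Fin n → ℤ), (∀ i, Pi.single i 1 ∈ T) → ∀ m, m ∈ T := by
    intro T hT m
    rw [← Finset.univ_sum_single m]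
    refine AddSubgroup.sum_mem _ fun i _ => ?_
    have : (Pi.single i (m i) : Fin n → ℤ) = m i • Pi.single i 1 := by
      rw [← Pi.single_smul, smul_eq_mul, mul_one]
    rw [this]
    exact AddSubgroup.zsmul_mem _ (hT i) _
  have hS' : ∀ m, ∃ r : CharAlg n k, Λ m * algebraMap _ _ Q = algebraMap _ _ r :=
    hgen S' fun i => ⟨r₀ i * ∏ j ∈ Finset.univ.erase i, Q₀ j, by
      rw [hQdef, ← Finset.mul_prod_erase _ _ (Finset.mem_univ i), map_mul, map_mul, ← hr₀ i,
        mul_assoc]⟩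
  choose L₀ hL₀ using hS'
  let L : (Fin n → ℤ) →+ CharAlg n k := AddMonoidHom.mk' L₀ fun m m' => map_inj (by
    rw [map_add, ← hL₀, ← hL₀, ← hL₀, map_add, add_mul])
  have hL : ∀ m, Λ m * algebraMap _ _ Q = algebraMap _ _ (L m) := hL₀
  -- `lam μ` is the component of weight `μ` of the field `Q · θ`, which sends `χ^m` to `χ^m · L m`.
  let lam : (Fin n → ℤ) → (Fin n → ℤ) →+ k := fun μ => AddMonoidHom.mk' (fun m => (L m).coeff μ)
    fun m m' => by rw [map_add, AddMonoidAlgebra.coeff_add, Finsupp.add_apply]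
  -- For `m ∈ σ^∨` the function `Q · θ(χ^m)` is a Laurent polynomial and is regular at `x`, so it
  -- lies in the coordinate ring of the chart. This holds for each of its terms, so every weight
  -- meets the condition of `exists_tangent_of_weight`.
  have hmem : ∀ m ∈ F.dual x.cone, AddMonoidAlgebra.single m 1 * L m ∈ Reg F k x.cone ∧
      ∀ v, HasVal x (θ (charFun k m)) v →
        v * pev x Q = pev x (AddMonoidAlgebra.single m 1 * L m) := by
    intro m hm
    have key : ∀ p q : CharAlg n k, q ∈ Reg F k x.cone → p ∈ Reg F k x.cone →
        θ (charFun k m) * algebraMap _ _ q = algebraMap _ _ p →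
        q * (AddMonoidAlgebra.single m 1 * L m) = Q * p := by
      intro p q hq hp hr
      apply map_inj
      rw [map_mul, map_mul, map_mul, ← hL, ← hr, ← hΛ]
      change _ * (charFun k m * _) = _
      ring
    have h1 : AddMonoidAlgebra.single m 1 * L m ∈ Reg F k x.cone := by
      obtain ⟨v, -, p, hp, q, hq, hqx, hr, hv⟩ := hreg m hm
      refine mem_Reg_of_mul_mem hq hqx ?_
      rw [key p q hq hp hr]
      exact mul_mem hQ hp
    refine ⟨h1, ?_⟩
    rintro v ⟨p, hp, q, hq, hqx, hr, hv⟩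
    have h2 := congrArg (pev x) (key p q hq hp hr)
    rw [pev_mul hq h1 hxc, pev_mul hQ hp hxc, ← hv] at h2
    exact mul_left_cancel₀ hqx (by linear_combination -h2)
  choose v hv using fun μ => exists_tangent_of_weight hF hz (lam μ) μ fun m hm hne =>
    (hmem m hm).1 (μ + m) (by rwa [coeff_single_mul])
  -- By additivity only the weights seen on the standard basis of `M` occur, and these are finitely
  -- many.
  let W : Finset (Fin n → ℤ) := Finset.univ.biUnion fun i => (L (Pi.single i 1)).coeff.support
  have hW : ∀ m μ, μ ∉ W → lam μ m = 0 := fun m μ hμ => by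
    refine hgen (lam μ).ker (fun i => ?_) m
    by_contra h
    exact hμ (Finset.mem_biUnion.mpr ⟨i, Finset.mem_univ i, Finsupp.mem_support_iff.mpr h⟩)
  refine ⟨fun ρ => (∑ μ ∈ W, v μ ρ) / pev x Q, fun m hm => ?_⟩
  obtain ⟨c, hc, hc'⟩ := hreg m hm
  have h1 := (hmem m hm).2 c hc'
  have he : ∀ μ ∈ W, (L m).coeff μ * x.val (μ + m) = ∑ ρ, v μ ρ * laurentDer F z ρ m :=
    fun μ _ => hv μ m hm
  rw [pev_single_mul, Finsupp.sum, Finset.sum_subset (s₂ := W)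
    (fun μ hμ => by_contra fun h => Finsupp.mem_support_iff.mp hμ (hW m μ h))
    (fun μ _ h => by rw [Finsupp.notMem_support_iff.mp h, zero_mul]),
    Finset.sum_congr rfl he, Finset.sum_comm] at h1
  have h2 : c = ∑ ρ, (∑ μ ∈ W, v μ ρ) / pev x Q * laurentDer F z ρ m := by
    rw [eq_div_of_mul_eq hQx h1, Finset.sum_div]
    refine Finset.sum_congr rfl fun ρ _ => ?_
    rw [← Finset.sum_mul]
    ring
  rwa [← h2]

omit [IsAlgClosed k] [CharZero k] in
-- In the product rule the derivative of the monomial factor drops out because `p` vanishes at `x`.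
-- If `z ρ = 0`, that factor is free of `x_ρ`, and the other exponents are compared after replacing
-- `z ρ` by `1`; otherwise one multiplies by `z ρ` and uses logarithmic derivatives.
lemma eval_pderiv_coxPoly {x : Point F k} {z : R → k} (hz : LiesOver z x) {N : ℕ}
    {p : CharAlg n k} (hp : p ∈ Reg F k x.cone) (hN : Clears F N p) (hpx : pev x p = 0) (ρ : R) :
    eval z (pderiv ρ (coxPoly F x.cone N p)) =
      (p.coeff.sum fun m c => c * laurentDer F z ρ m) * (∏ ρ ∈ x.coneᶜ, z ρ) ^ N := by
  by_cases hzρ : z ρ = 0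
  · have hρ := hz.zeros_subset ρ hzρ
    rw [coxPoly, Finsupp.sum, Finsupp.sum, map_sum, map_sum, Finset.sum_mul]
    refine Finset.sum_congr rfl fun m hm => ?_
    have hm := Finsupp.mem_support_iff.mp hm
    have he := expo_cast (F := F) (hp m hm) (hN m hm) ρ
    rw [if_pos hρ, add_zero] at he
    rw [pderiv_monomial, eval_monomial', laurentDer, ← he, Int.cast_natCast]
    rcases Nat.eq_zero_or_pos (expo F x.cone N m ρ) with h0 | h0
    · rw [h0]; simp
    have hz' : ∀ ρ', Function.update z ρ 1 ρ' = 0 → ρ' ∈ x.cone := fun ρ' h => by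
      by_cases h' : ρ' = ρ
      · rw [h']; exact hρ
      · rw [Function.update_of_ne h'] at h; exact hz.zeros_subset ρ' h
    have h1 := prod_pow_expo (hp m hm) (hN m hm) hz'
    have e₁ : ∀ ρ' ∈ Finset.univ.erase ρ, Function.update z ρ 1 ρ' ^ expo F x.cone N m ρ' =
        z ρ' ^ expo F x.cone N m ρ' := fun ρ' hρ' => by
      rw [Function.update_of_ne (Finset.ne_of_mem_erase hρ')]
    have e₂ : ∀ ρ' ∈ Finset.univ.erase ρ, Function.update z ρ 1 ρ' ^ (m ⬝ᵥ F.gen ρ') =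
        z ρ' ^ (m ⬝ᵥ F.gen ρ') := fun ρ' hρ' => by
      rw [Function.update_of_ne (Finset.ne_of_mem_erase hρ')]
    have e₃ : ∀ ρ' ∈ x.coneᶜ, Function.update z ρ 1 ρ' = z ρ' := fun ρ' hρ' => by
      refine Function.update_of_ne (fun h => ?_) _ _
      rw [h] at hρ'
      exact Finset.mem_compl.mp hρ' hρ
    have e₄ : ∀ ρ' ∈ Finset.univ.erase ρ,
        z ρ' ^ (expo F x.cone N m - Finsupp.single ρ 1 : R →₀ ℕ) ρ' = z ρ' ^ expo F x.cone N m ρ' :=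
      fun ρ' hρ' => by
        rw [Finsupp.tsub_apply, Finsupp.single_eq_of_ne (Finset.ne_of_mem_erase hρ'), Nat.sub_zero]
    rw [laurent_eq_mul_erase _ ρ, ← Finset.mul_prod_erase _ _ (Finset.mem_univ ρ),
      Function.update_self, one_pow, one_zpow, one_mul, one_mul,
      Finset.prod_congr rfl e₁, Finset.prod_congr rfl e₂, Finset.prod_congr rfl e₃] at h1
    rw [← Finset.mul_prod_erase _ _ (Finset.mem_univ ρ),
      Finset.prod_congr rfl e₄, h1, Finsupp.tsub_apply, Finsupp.single_eq_same, ← zpow_natCast,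
      Nat.cast_sub h0, Nat.cast_one]
    ring
  · refine mul_left_cancel₀ hzρ ?_
    have h1 : ∀ m ∈ p.coeff.support, z ρ * eval z (pderiv ρ (monomial (expo F x.cone N m)
        (p.coeff m))) = z ρ * (p.coeff m * laurentDer F z ρ m) * (∏ ρ ∈ x.coneᶜ, z ρ) ^ N +
        (if ρ ∈ x.cone then 0 else (N : k)) * (∏ ρ ∈ x.coneᶜ, z ρ) ^ N *
          (p.coeff m * x.val m) := by
      intro m hm
      have hm := Finsupp.mem_support_iff.mp hm
      have he := congrArg (Int.cast : ℤ → k) (expo_cast (F := F) (hp m hm) (hN m hm) ρ)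
      rw [eval_X_mul_pderiv_monomial, eval_monomial', prod_pow_expo (hp m hm) (hN m hm)
        hz.zeros_subset, hz.val_eq (hp m hm)]
      have h2 := mul_laurentDer (F := F) z ρ m
      push_cast at he
      rw [he]
      split_ifs <;> linear_combination -(p.coeff m * (∏ ρ ∈ x.coneᶜ, z ρ) ^ N) * h2
    rw [coxPoly, Finsupp.sum, Finsupp.sum, map_sum, map_sum, Finset.mul_sum,
      Finset.sum_congr rfl h1, Finset.sum_add_distrib, ← Finset.mul_sum, ← Finset.sum_mul,
      ← Finset.mul_sum]
    have h3 : ∑ m ∈ p.coeff.support, p.coeff m * x.val m = 0 := hpx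
    rw [h3]
    ring

/-- If `L f` is singular at a point over `g t`, then `f` is singular at the points over `t`. -/
lemma singular_of_lift (hF : F.IsComplete) {α : Cl F} {g : Equiv.Perm (Point F k)}
    {L : CoxPiece F k α ≃ₗ[k] CoxPiece F k α} (hL : (g, L) ∈ linearGroup F k α)
    (f : CoxPiece F k α) {t : Point F k} (ht : t ∈ torus F k) {w z : R → k} (hw : LiesOver w t)
    (hz : LiesOver z (g t)) (h0 : eval z (L f : MvPolynomial R k) = 0)
    (hgrad : GradVanishes (L f : MvPolynomial R k) z) :
    eval w (f : MvPolynomial R k) = 0 ∧ GradVanishes (f : MvPolynomial R k) w := by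
  have hg : g ∈ autX F k := hL.1.1
  by_cases hf : f = 0
  · subst hf
    exact ⟨by simp, fun ρ => by simp⟩
  set x := g t with hx
  have hxc : x ∈ chart F k x.cone := Finset.Subset.refl _
  obtain ⟨b, hb⟩ := QuotientAddGroup.mk_surjective α
  have hb0 : ∀ ρ ∈ (∅ : Finset R), b ρ = 0 := fun ρ hρ => absurd hρ (Finset.notMem_empty ρ)
  obtain ⟨φ, hφ, hφ₁, hφ₂⟩ := exists_dehom hb hb0 f.2
  have ht' : t ∈ chart F k ∅ := torus_subset_chart _ ht
  have hmem : transport g (chart F k ∅, fun y => pev y φ) ∈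
      divisor (F := F) (L f : MvPolynomial R k) := by
    rw [← hL.2 f hf]
    exact ⟨_, mem_divisor_of_dehom F.empty_mem hb0 hφ hφ₁, rfl⟩
  obtain ⟨hV, -, hloc⟩ := hmem
  obtain ⟨P, Q, hP, hQ, hPQ⟩ := hloc z x ⟨t, ht', rfl⟩ hz
  have hψ : RegularAt (fun y => pev (g.symm y) φ) x :=
    RegularAt.comp (φ := fun y => pev y φ) hg.2
      (regularAt_pev hφ (by rwa [hx, Equiv.symm_apply_apply]))
  obtain ⟨p, hp, q, hq, hqx, hpq⟩ := hψ.mem_nhd hV ⟨t, ht', rfl⟩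
  obtain ⟨N, hNp, hNq⟩ := exists_clears₂ F p q
  have hne : eval z (coxPoly F x.cone N q) ≠ 0 := by
    rw [eval_coxPoly hq hNq hz hxc]
    refine mul_ne_zero hqx (pow_ne_zero _ (Finset.prod_ne_zero_iff.mpr fun ρ hρ h => ?_))
    exact Finset.mem_compl.mp hρ (hz.zeros_subset ρ h)
  -- The function `φ ∘ g⁻¹` is `p / q` near `x`, and it is also `L f` times the unit `P / Q`.
  -- Clearing denominators and differentiating at `z` passes the singularity from `L f` to `p`.
  have hpoly : coxPoly F x.cone N p * Q - (L f : MvPolynomial R k) * P * coxPoly F x.cone N q =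
      0 := by
    refine poly_eq_zero_of_generic (B := P * Q * coxPoly F x.cone N q) (fun h => ?_)
      fun w' hw' hB => ?_
    · have := congrArg (eval z) h
      rw [map_mul, map_mul, map_zero] at this
      exact mul_ne_zero (mul_ne_zero hP hQ) hne this
    · obtain ⟨y, hy, hw'y⟩ := exists_liesOver_torus_point (F := F) hw'
      have hyc := torus_subset_chart x.cone hy
      rw [map_mul, map_mul] at hB
      have hB' := right_ne_zero_of_mul hB
      rw [eval_coxPoly hq hNq hw'y hyc] at hB'
      obtain ⟨hyV, hy'⟩ := hpq y hyc (left_ne_zero_of_mul hB')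
      have h1 := hPQ w' y hyV hw'y (left_ne_zero_of_mul (left_ne_zero_of_mul hB))
        (right_ne_zero_of_mul (left_ne_zero_of_mul hB))
      change pev (g.symm y) φ * _ = _ at h1
      rw [map_sub, map_mul, map_mul, map_mul, eval_coxPoly hp hNp hw'y hyc,
        eval_coxPoly hq hNq hw'y hyc, ← h1, ← hy']
      ring
  have hpx : pev x p = 0 := by
    have h1 := congrArg (eval z) hpoly
    rw [map_sub, map_mul, map_mul, map_mul, h0, zero_mul, zero_mul, sub_zero, map_zero] at h1
    have h2 := (mul_eq_zero.mp h1).resolve_right hQ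
    rw [eval_coxPoly hp hNp hz hxc] at h2
    refine (mul_eq_zero.mp h2).resolve_right (pow_ne_zero _ ?_)
    exact Finset.prod_ne_zero_iff.mpr fun ρ hρ h =>
      Finset.mem_compl.mp hρ (hz.zeros_subset ρ h)
  have hder : ∀ ρ, (p.coeff.sum fun m c => c * laurentDer F z ρ m) = 0 := by
    intro ρ
    have hNpz : eval z (coxPoly F x.cone N p) = 0 := by
      rw [eval_coxPoly hp hNp hz hxc, hpx, zero_mul]
    have h1 := congrArg (fun P => eval z (pderiv ρ P)) hpoly
    simp only [map_sub, Derivation.leibniz, map_add, map_mul, smul_eq_mul, h0, hgrad ρ, hNpz,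
      zero_mul, mul_zero, add_zero, zero_add, sub_zero, map_zero] at h1
    have h2 := (mul_eq_zero.mp h1).resolve_left hQ
    rw [eval_pderiv_coxPoly hz hp hNp hpx] at h2
    refine (mul_eq_zero.mp h2).resolve_right (pow_ne_zero _ ?_)
    exact Finset.prod_ne_zero_iff.mpr fun ρ hρ h =>
      Finset.mem_compl.mp hρ (hz.zeros_subset ρ h)
  have hφt : pev t φ = 0 := by
    have h1 := (hpq x hxc hqx).2
    rw [hpx, hx, Equiv.symm_apply_apply] at h1
    exact (mul_eq_zero.mp h1).resolve_right hqx
  have hfw : eval w (f : MvPolynomial R k) = 0 := by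
    rw [← hφ₁ t ht' w hw, hφt, zero_mul]
  refine ⟨hfw, fun ρ => ?_⟩
  obtain ⟨γ, hγ⟩ := exists_pullback hF hg
  obtain ⟨D, hD, hDp⟩ := exists_derivation_ratFun (pairing F k ρ)
  -- `V` is a tangent vector at `z` lifting the image under `g` of the invariant field with
  -- direction `u_ρ` at `t`.
  obtain ⟨V, hV'⟩ := exists_tangent hF hg hγ hD hDp ht hz
  -- This is `φ · (q ∘ g) = p ∘ g` as rational functions; `D` will be applied to it and the result
  -- evaluated at `t`.
  have hK : algebraMap _ (RatFun n k) φ * γ (algebraMap _ _ q) = γ (algebraMap _ _ p) := by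
    have hopen := (isOpen_basic x.cone_mem hq).preimage hg.1.1
    refine (((represents_map φ).mul (hγ _ _ (represents_map q))).congr hopen
      ⟨t, hxc, hqx⟩ fun y hy _ => ?_).unique hF (hγ _ _ (represents_map p))
    have h1 := (hpq (g y) hy.1 hy.2).2
    rwa [Equiv.symm_apply_apply] at h1
  have hK' := congrArg D hK
  rw [hD, hDp] at hK'
  have htc : t.cone = ∅ := ht
  have hreg : ∀ p, p ∈ Reg F k t.cone := fun p => by rw [htc]; exact mem_Reg_empty p
  have hγq := HasVal.pullback hF hg hγ (hasVal_map hq)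
  obtain ⟨v', hv'⟩ := hγq.derivation hD hDp ht
  have hl := ((hasVal_map (hreg φ)).mul hv').add (hγq.mul (hasVal_map
    (hreg (logDer (pairing F k ρ) φ))))
  -- Chain rule: the derivative of `p ∘ g` at `t` is the derivative of `p` along `V` at `z`, and all
  -- partial derivatives vanish there.
  have hr : HasVal t (D (γ (algebraMap _ _ p))) 0 := by
    have h1 : algebraMap _ (RatFun n k) p = ∑ m ∈ p.coeff.support, p.coeff m • charFun k m := by
      have h2 : p = ∑ m ∈ p.coeff.support, p.coeff m • AddMonoidAlgebra.single m (1 : k) := by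
        conv_lhs => rw [← AddMonoidAlgebra.sum_coeff_single p]
        simp [Finsupp.sum]
      conv_lhs => rw [h2]
      rw [map_sum]
      refine Finset.sum_congr rfl fun m _ => ?_
      exact map_smul (Algebra.algHom k (CharAlg n k) (RatFun n k)) _ _
    rw [h1, map_sum, map_sum]
    have h3 := hasVal_sum p.coeff.support fun m hm =>
      ((hV' m (hp m (Finsupp.mem_support_iff.mp hm))).smul (p.coeff m))
    have h4 : ∑ m ∈ p.coeff.support, p.coeff m * ∑ ρ, V ρ * laurentDer F z ρ m = 0 := by
      simp only [Finset.mul_sum]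
      rw [Finset.sum_comm]
      refine Finset.sum_eq_zero fun ρ _ => ?_
      have := congrArg (V ρ * ·) (hder ρ)
      simp only [Finsupp.sum, Finset.mul_sum, mul_zero] at this
      rw [← this]
      exact Finset.sum_congr rfl fun m _ => by ring
    rw [h4] at h3
    simpa only [map_smul] using h3
  rw [← hK'] at hr
  have h1 := hl.unique hr
  rw [hφt, zero_mul, zero_add] at h1
  have h2 := hφ₂ ρ t ht w hw
  rw [(mul_eq_zero.mp h1).resolve_left hqx, zero_mul, hfw, mul_zero, sub_zero] at h2
  exact (mul_eq_zero.mp h2.symm).resolve_left (hw.mem_torus_iff.mp ht ρ)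

end Sing

/-! ### Coordinates on `S_α` -/

section Coords

variable {F : Fan n R} {α : Cl F}

/-- A relation between the ray generators kills the divisors of characters, so it defines a
real-valued degree on the class group. -/
lemma pairing_relation {c : R → ℝ} (hc : ∀ i, ∑ ρ, c ρ * (F.gen ρ i : ℝ) = 0)
    {e e' : R →₀ ℕ} (h : Finsupp.weight (varDeg F) e = Finsupp.weight (varDeg F) e') :
    ∑ ρ, c ρ * e ρ = ∑ ρ, c ρ * e' ρ := by
  rw [weight_varDeg, weight_varDeg, QuotientAddGroup.eq] at h
  obtain ⟨m, hm⟩ := h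
  have h1 : ∀ ρ, (e' ρ : ℝ) = e ρ + ∑ i, (m i : ℝ) * F.gen ρ i := fun ρ => by
    have h2 : m ⬝ᵥ F.gen ρ = -(e ρ : ℤ) + e' ρ := congrFun hm ρ
    have h3 : ((∑ i, m i * F.gen ρ i : ℤ) : ℝ) = ((-(e ρ : ℤ) + e' ρ : ℤ) : ℝ) := by
      rw [← h2]; rfl
    push_cast at h3
    linarith
  have h4 : ∑ ρ, c ρ * ∑ i, (m i : ℝ) * F.gen ρ i = 0 := by
    simp only [Finset.mul_sum]
    rw [Finset.sum_comm]
    refine Finset.sum_eq_zero fun i _ => ?_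
    rw [← mul_zero (m i : ℝ), ← hc i, Finset.mul_sum]
    exact Finset.sum_congr rfl fun ρ _ => by ring
  simp only [h1, mul_add, Finset.sum_add_distrib, h4, add_zero]

/-- The relation with all coefficients at least `1` bounds each exponent by the common real degree.
-/
lemma finite_exps (hF : F.IsComplete) (α : Cl F) : Finite (Exps F α) := by
  obtain ⟨c, hc1, hc⟩ := hF.exists_pos_relation
  rcases isEmpty_or_nonempty (Exps F α) with h | ⟨⟨e₀, he₀⟩⟩
  · infer_instance
  obtain ⟨N, hN⟩ := exists_nat_ge (∑ ρ, c ρ * e₀ ρ)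
  refine Set.Finite.subset (Set.finite_Iic (Finsupp.equivFunOnFinite.symm fun _ : R => N))
    fun e he => ?_
  have he : Finsupp.weight (varDeg F) e = α := he
  intro ρ
  have h1 := pairing_relation hc (he.trans he₀.symm)
  have h2 : (e ρ : ℝ) ≤ ∑ ρ, c ρ * e ρ :=
    (le_mul_of_one_le_left (Nat.cast_nonneg _) (hc1 ρ)).trans
      (Finset.single_le_sum (f := fun ρ => c ρ * (e ρ : ℝ))
        (fun ρ _ => mul_nonneg (zero_le_one.trans (hc1 ρ)) (Nat.cast_nonneg _))
        (Finset.mem_univ ρ))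
  have h3 : (e ρ : ℝ) ≤ N := by linarith
  exact_mod_cast h3

lemma coords_add (f f' : CoxPiece F k α) : coords (f + f') = coords f + coords f' := by
  funext a
  exact coeff_add _ _ _

lemma coords_smul (c : k) (f : CoxPiece F k α) : coords (c • f) = c • coords f := by
  funext a
  exact coeff_smul _ _ _

lemma coords_injective : Function.Injective (coords (F := F) (k := k) (α := α)) := by
  intro f f' h
  apply Subtype.ext
  ext e
  by_cases he : Finsupp.weight (varDeg F) e = α
  · exact congrFun h ⟨e, he⟩
  · rw [f.2.coeff_eq_zero e he, f'.2.coeff_eq_zero e he]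

lemma coords_monomialElt (a b : Exps F α) :
    coords (monomialElt (k := k) b) a = if b = a then 1 else 0 := by
  change coeff a.1 (monomial b.1 (1 : k)) = _
  rw [coeff_monomial]
  simp only [Subtype.ext_iff]

variable [Fintype (Exps F α)]

/-- The coordinates of `S_α` in the monomial basis. -/
def coordsEquiv (F : Fan n R) (k : Type*) [Field k] (α : Cl F) [Fintype (Exps F α)] :
    CoxPiece F k α ≃ₗ[k] (Exps F α → k) :=
  LinearEquiv.ofBijective ⟨⟨coords, coords_add⟩, coords_smul⟩ ⟨coords_injective, fun v =>
    ⟨∑ b, v b • monomialElt b, by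
      classical
      change coords (∑ b, v b • monomialElt (k := k) b) = v
      have h : ∀ s : Finset (Exps F α), coords (∑ b ∈ s, v b • monomialElt (k := k) b) =
          ∑ b ∈ s, v b • coords (monomialElt (k := k) b) := fun s => by
        induction s using Finset.induction_on with
        | empty => funext a; exact coeff_zero _
        | insert b s hb ih =>
          rw [Finset.sum_insert hb, Finset.sum_insert hb, coords_add, coords_smul, ih]
      rw [h]
      funext a
      rw [Finset.sum_apply]
      simp [coords_monomialElt]⟩⟩

lemma coordsEquiv_apply (f : CoxPiece F k α) : coordsEquiv F k α f = coords f := rfl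

lemma finite_coxPiece : Module.Finite k (CoxPiece F k α) :=
  Module.Finite.equiv (coordsEquiv F k α).symm

lemma eq_sum_monomialElt (f : CoxPiece F k α) : f = ∑ b, coords f b • monomialElt b := by
  classical
  apply (coordsEquiv F k α).injective
  rw [map_sum]
  funext a
  rw [Finset.sum_apply]
  simp only [map_smul, coordsEquiv_apply, Pi.smul_apply, coords_monomialElt]
  simp

lemma coords_map (A : CoxPiece F k α →ₗ[k] CoxPiece F k α) (f : CoxPiece F k α) (a : Exps F α) :
    coords (A f) a = ∑ b, coords (A (monomialElt b)) a * coords f b := by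
  conv_lhs => rw [eq_sum_monomialElt f]
  rw [← coordsEquiv_apply, map_sum, map_sum, Finset.sum_apply]
  refine Finset.sum_congr rfl fun b _ => ?_
  rw [map_smul, map_smul, coordsEquiv_apply, Pi.smul_apply, smul_eq_mul, mul_comm]

/-- Substitution of a linear map into a polynomial on `S_α`. -/
def substMap (A : CoxPiece F k α →ₗ[k] CoxPiece F k α) :
    MvPolynomial (Exps F α) k →ₐ[k] MvPolynomial (Exps F α) k :=
  aeval fun a => ∑ b, C (coords (A (monomialElt b)) a) * X b

lemma eval_substMap (A : CoxPiece F k α →ₗ[k] CoxPiece F k α) (H : MvPolynomial (Exps F α) k)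
    (f : CoxPiece F k α) : eval (coords f) (substMap A H) = eval (coords (A f)) H := by
  rw [substMap, ← coe_aeval_eq_eval, ← coe_aeval_eq_eval]
  change (aeval (coords f)) (aeval _ H) = aeval _ H
  rw [← AlgHom.comp_apply, comp_aeval]
  congr 2
  funext a
  rw [coords_map]
  simp

lemma isHomogeneous_substMap (A : CoxPiece F k α →ₗ[k] CoxPiece F k α)
    {H : MvPolynomial (Exps F α) k} {d : ℕ} (hH : H.IsHomogeneous d) :
    (substMap A H).IsHomogeneous d := by
  have := hH.aeval (fun a => ∑ b, C (coords (A (monomialElt b)) a) * X b) (n := 1) fun a =>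
    IsHomogeneous.sum _ _ _ fun b _ => (isHomogeneous_X k b).C_mul _
  rwa [one_mul] at this

end Coords

/-! ### The discriminant locus: invariance and description by the sweep -/

section Closure

variable {F : Fan n R} {α : Cl F}

lemma eval_smul_of_isHomogeneous {ι : Type*} {H : MvPolynomial ι k} {d : ℕ}
    (hH : H.IsHomogeneous d) (c : k) (v : ι → k) : eval (c • v) H = c ^ d * eval v H := by
  rw [eval_eq, eval_eq, Finset.mul_sum]
  refine Finset.sum_congr rfl fun e he => ?_
  rw [hH.degree_eq_sum_deg_support he, ← Finset.prod_pow_eq_pow_sum]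
  simp only [Pi.smul_apply, smul_eq_mul, mul_pow, Finset.prod_mul_distrib]
  ring

lemma eval_coords_smul_eq_zero_iff {H : MvPolynomial (Exps F α) k} {d : ℕ}
    (hH : H.IsHomogeneous d) {c : k} (hc : c ≠ 0) (f : CoxPiece F k α) :
    eval (coords (c • f)) H = 0 ↔ eval (coords f) H = 0 := by
  rw [coords_smul, eval_smul_of_isHomogeneous hH, mul_eq_zero]
  exact or_iff_right (pow_ne_zero _ hc)

lemma exists_rep_eq_smul (f : CoxPiece F k α) (hf : f ≠ 0) :
    ∃ c : k, c ≠ 0 ∧ (Projectivization.mk k f hf).rep = c • f := by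
  obtain ⟨c, hc⟩ := Projectivization.exists_smul_eq_mk_rep k f hf
  exact ⟨c, c.ne_zero, hc.symm⟩

/-- `f` is singular at `z`. -/
def IsSingularAt (f : MvPolynomial R k) (z : R → k) : Prop := eval z f = 0 ∧ GradVanishes f z

lemma IsSingularAt.smul {f : MvPolynomial R k} {z : R → k} (h : IsSingularAt f z) (c : k) :
    IsSingularAt (c • f) z :=
  ⟨by rw [smul_eval, h.1, mul_zero], fun ρ => by
    rw [Derivation.map_smul, smul_eval, h.2 ρ, mul_zero]⟩

/-- `H` vanishes on the forms with a singular point on the torus. -/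
def VanishesOnSingular (H : MvPolynomial (Exps F α) k) : Prop :=
  ∀ (f : CoxPiece F k α) (z : R → k), f ≠ 0 → (∀ ρ, z ρ ≠ 0) →
    IsSingularAt (f : MvPolynomial R k) z → eval (coords f) H = 0

lemma vanishesOnSingular_iff {H : MvPolynomial (Exps F α) k} {d : ℕ} (hH : H.IsHomogeneous d) :
    VanishesOnSingular H ↔ ∀ q ∈ discOpen F k α, eval (coords q.rep) H = 0 := by
  constructor
  · rintro h q ⟨z, hz, hs⟩
    exact h _ z q.rep_nonzero hz hs
  · intro h f z hf hz hs
    obtain ⟨c, hc, hrep⟩ := exists_rep_eq_smul f hf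
    have h1 := h (Projectivization.mk k f hf) ⟨z, hz, by
      rw [hrep]; exact hs.smul c⟩
    rwa [hrep, eval_coords_smul_eq_zero_iff hH hc] at h1

lemma mem_discLocus {f : CoxPiece F k α} {hf : f ≠ 0} :
    Projectivization.mk k f hf ∈ discLocus F k α ↔ ∀ (H : MvPolynomial (Exps F α) k) (d : ℕ),
      H.IsHomogeneous d → VanishesOnSingular H → eval (coords f) H = 0 := by
  obtain ⟨c, hc, hrep⟩ := exists_rep_eq_smul f hf
  refine forall_congr' fun H => forall_congr' fun d => forall_congr' fun hH => ?_
  rw [vanishesOnSingular_iff hH, hrep, eval_coords_smul_eq_zero_iff hH hc]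

lemma zariskiClosure_eq {Y Z : Set (ℙ k (CoxPiece F k α))} (h : Y ⊆ Z)
    (h' : Z ⊆ zariskiClosure Y) : zariskiClosure Y = zariskiClosure Z := by
  apply Set.Subset.antisymm
  · exact fun p hp H d hH hv => hp H d hH fun q hq => hv q (h hq)
  · exact fun p hp H d hH hv => hp H d hH fun q hq => h' hq H d hH hv

variable [IsAlgClosed k] [CharZero k]

/-- The forms with a singular point on the torus are carried by the automorphisms into every
hypersurface that contains all of them. -/
lemma eval_lift_eq_zero (hF : F.IsComplete) {g : Equiv.Perm (Point F k)}
    {L : CoxPiece F k α ≃ₗ[k] CoxPiece F k α} (hL : (g, L) ∈ linearGroup F k α)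
    {H : MvPolynomial (Exps F α) k} {d : ℕ} (hH : H.IsHomogeneous d) (hv : VanishesOnSingular H)
    {f : CoxPiece F k α} {w : R → k} (hf : f ≠ 0) (hw : ∀ ρ, w ρ ≠ 0)
    (hs : IsSingularAt (f : MvPolynomial R k) w) : eval (coords (L f)) H = 0 := by
  -- The automorphism may move the point below `w` out of `T`, so `L f` itself need not be singular
  -- on the torus. Hence the singular point is moved to a general `s` by a torus translation of `f`.
  classical
  have := finite_exps hF α
  have := Fintype.ofFinite (Exps F α)
  -- the forms `f (w x / s) s ^ E` depend polynomially on `s`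
  let E : R →₀ ℕ := ∑ e : Exps F α, e.1
  have hE : ∀ e : Exps F α, e.1 ≤ E := fun e =>
    Finset.single_le_sum (f := fun e : Exps F α => e.1) (fun _ _ => zero_le) (Finset.mem_univ e)
  let mon : (R →₀ ℕ) → (R → k) → k := fun e z => ∏ ρ, z ρ ^ e ρ
  let Fs : (R → k) → CoxPiece F k α := fun s =>
    ∑ e, (coords f e * mon e.1 w * mon (E - e.1) s) • monomialElt e
  have hcoords : ∀ s e, coords (Fs s) e = coords f e * mon e.1 w * mon (E - e.1) s := by
    intro s e
    rw [← coordsEquiv_apply, map_sum, Finset.sum_apply]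
    simp only [map_smul, Pi.smul_apply, coordsEquiv_apply, coords_monomialElt]
    simp
  have hmon : ∀ (e : Exps F α) (s : R → k), mon (E - e.1) s * mon e.1 s = mon E s := by
    intro e s
    simp only [mon, ← Finset.prod_mul_distrib, ← pow_add]
    refine Finset.prod_congr rfl fun ρ _ => ?_
    rw [Finsupp.tsub_apply, Nat.sub_add_cancel (hE e ρ)]
  have hmon0 : ∀ (e : R →₀ ℕ) (s : R → k), (∀ ρ, s ρ ≠ 0) → mon e s ≠ 0 := fun e s hs =>
    Finset.prod_ne_zero_iff.mpr fun ρ _ => pow_ne_zero _ (hs ρ)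
  have hsum : ∀ h : CoxPiece F k α, (h : MvPolynomial R k) =
      ∑ e : Exps F α, monomial e.1 (coords h e) := by
    intro h
    conv_lhs => rw [eq_sum_monomialElt h]
    rw [AddSubmonoidClass.coe_finsetSum]
    refine Finset.sum_congr rfl fun e _ => ?_
    change coords h e • monomial e.1 (1 : k) = _
    rw [smul_monomial, smul_eq_mul, mul_one]
  have heval : ∀ s (h : CoxPiece F k α), eval s (h : MvPolynomial R k) =
      ∑ e, coords h e * mon e.1 s := by
    intro s h
    conv_lhs => rw [hsum h]
    rw [map_sum]
    exact Finset.sum_congr rfl fun e _ => eval_monomial' _ _ _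
  have hpder : ∀ s (h : CoxPiece F k α) ρ, s ρ * eval s (pderiv ρ (h : MvPolynomial R k)) =
      ∑ e, (e.1 ρ : k) * (coords h e * mon e.1 s) := by
    intro s h ρ
    conv_lhs => rw [hsum h]
    rw [map_sum, map_sum, Finset.mul_sum]
    refine Finset.sum_congr rfl fun e _ => ?_
    rw [eval_X_mul_pderiv_monomial, eval_monomial']
  have hFs : ∀ s, (∀ ρ, s ρ ≠ 0) → Fs s ≠ 0 ∧ IsSingularAt (Fs s : MvPolynomial R k) s := by
    intro s hs0
    refine ⟨fun h => hf ?_, ?_, fun ρ => ?_⟩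
    · apply coords_injective
      funext e
      have h1 := hcoords s e
      rw [h] at h1
      have h2 : coords (0 : CoxPiece F k α) e = 0 := coeff_zero _
      rw [h2] at h1 ⊢
      exact (mul_eq_zero.mp ((mul_eq_zero.mp h1.symm).resolve_right (hmon0 _ _ hs0))).resolve_right
        (hmon0 _ _ hw)
    · have h1 : eval s (Fs s : MvPolynomial R k) = mon E s * eval w (f : MvPolynomial R k) := by
        rw [heval, heval, Finset.mul_sum]
        refine Finset.sum_congr rfl fun e _ => ?_
        rw [hcoords, ← hmon e s]; ring
      rw [h1, hs.1, mul_zero]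
    · refine (mul_eq_zero.mp ?_).resolve_left (hs0 ρ)
      have h1 : s ρ * eval s (pderiv ρ (Fs s : MvPolynomial R k)) =
          mon E s * (w ρ * eval w (pderiv ρ (f : MvPolynomial R k))) := by
        rw [hpder, hpder, Finset.mul_sum]
        refine Finset.sum_congr rfl fun e _ => ?_
        rw [hcoords, ← hmon e s]; ring
      rw [h1, hs.2 ρ, mul_zero, mul_zero]
  -- the generic member of the family is carried to a form with a singular point on the torus
  let P : MvPolynomial R k := aeval (fun a => ∑ e, monomial (E - e.1)
    (coords (L (monomialElt e)) a * (coords f e * mon e.1 w))) H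
  have hP : ∀ s, eval s P = eval (coords (L (Fs s))) H := by
    intro s
    simp only [P]
    rw [← coe_aeval_eq_eval, ← coe_aeval_eq_eval]
    change (aeval s) (aeval _ H) = aeval _ H
    rw [← AlgHom.comp_apply, comp_aeval]
    congr 2
    funext a
    have h1 := coords_map (L : CoxPiece F k α →ₗ[k] CoxPiece F k α) (Fs s) a
    rw [LinearEquiv.coe_coe] at h1
    rw [h1, map_sum]
    refine Finset.sum_congr rfl fun e _ => ?_
    change eval s _ = _
    rw [eval_monomial', hcoords]
    change _ * mon (E - e.1) s = _
    ring
  have hne : (g ⁻¹' torus F k).Nonempty := by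
    obtain ⟨x, hx, -⟩ := exists_torus_pev_ne_zero hF (one_ne_zero (α := CharAlg n k))
    exact ⟨g.symm x, by rw [Set.mem_preimage, g.apply_symm_apply]; exact hx⟩
  obtain ⟨b, hb, hbV⟩ := exists_torus_subset (isOpen_torus.preimage hL.1.1.1.1) hne
  obtain ⟨N, hN⟩ := exists_clears F b
  have hP0 : P = 0 := by
    refine poly_eq_zero_of_generic (coxPoly_ne_zero hF (mem_Reg_empty b) (hN N le_rfl) hb)
      fun s hs0 hB => ?_
    obtain ⟨t, ht, hst⟩ := exists_liesOver_torus_point (F := F) hs0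
    rw [eval_coxPoly (mem_Reg_empty b) (hN N le_rfl) hst (torus_subset_chart _ ht)] at hB
    have hgt : g t ∈ torus F k := hbV t ht (left_ne_zero_of_mul hB)
    obtain ⟨z, hz, -⟩ := hF.exists_liesOver (g t)
    obtain ⟨h0, hs'⟩ := hFs s hs0
    rw [hP]
    refine hv _ z (fun h => h0 (L.map_eq_zero_iff.mp h)) (hz.mem_torus_iff.mp hgt) ?_
    -- `singular_of_lift` is used for `g⁻¹` at the torus point `g t`, which carries the singularity
    -- from `Fs s` forward to `L (Fs s)`.
    have hinv : (g.symm, L.symm) ∈ linearGroup F k α := inv_mem hL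
    have key := singular_of_lift hF hinv (L (Fs s)) hgt hz (z := s)
      (by rw [Equiv.symm_apply_apply]; exact hst)
    rw [LinearEquiv.symm_apply_apply] at key
    exact key hs'.1 hs'.2
  have h1 := hP w
  rw [hP0, map_zero] at h1
  have h2 : Fs w = mon E w • f := by
    apply coords_injective
    funext e
    rw [hcoords, coords_smul, Pi.smul_apply, smul_eq_mul, ← hmon e w]
    ring
  rw [h2, map_smul] at h1
  exact (eval_coords_smul_eq_zero_iff hH (hmon0 E w hw) _).mp h1.symm

lemma vanishesOnSingular_substMap (hF : F.IsComplete) [Fintype (Exps F α)]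
    {g : Equiv.Perm (Point F k)}
    {L : CoxPiece F k α ≃ₗ[k] CoxPiece F k α} (hL : (g, L) ∈ linearGroup F k α)
    {H : MvPolynomial (Exps F α) k} {d : ℕ} (hH : H.IsHomogeneous d)
    (hv : VanishesOnSingular H) :
    VanishesOnSingular (substMap (L : CoxPiece F k α →ₗ[k] CoxPiece F k α) H) := by
  intro f z hf hz hs
  rw [eval_substMap]
  exact eval_lift_eq_zero hF hL hH hv hf hz hs

lemma mk_lift_mem_discLocus (hF : F.IsComplete) {g : Equiv.Perm (Point F k)}
    {L : CoxPiece F k α ≃ₗ[k] CoxPiece F k α} (hL : (g, L) ∈ linearGroup F k α)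
    {f : CoxPiece F k α} (hf : f ≠ 0) (hLf : L f ≠ 0)
    (h : Projectivization.mk k f hf ∈ discLocus F k α) :
    Projectivization.mk k (L f) hLf ∈ discLocus F k α := by
  have := finite_exps hF α
  have := Fintype.ofFinite (Exps F α)
  rw [mem_discLocus] at h ⊢
  intro H d hH hv
  have h1 := h _ d (isHomogeneous_substMap (L : CoxPiece F k α →ₗ[k] CoxPiece F k α) hH)
    (vanishesOnSingular_substMap hF hL hH hv)
  rwa [eval_substMap] at h1

/-- The discriminant locus is invariant under `Aut_α(X)`. -/
theorem discLocus_invariant (hF : F.IsComplete) {g : Equiv.Perm (Point F k)}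
    (hg : g ∈ autClass F k α) {f f' : CoxPiece F k α} (hf : f ≠ 0) (hf' : f' ≠ 0)
    (h : pushDivisor g (divisor (F := F) (f : MvPolynomial R k)) =
      divisor (f' : MvPolynomial R k))
    (hmem : Projectivization.mk k f hf ∈ discLocus F k α) :
    Projectivization.mk k f' hf' ∈ discLocus F k α := by
  obtain ⟨L, hL⟩ := exists_lift hF ⟨f, f.2, CoxPiece.coe_ne_zero hf⟩ hg
  have hLf : L f ≠ 0 := fun h0 => hf (L.map_eq_zero_iff.mp h0)
  have h1 : divisor (F := F) (L f : MvPolynomial R k) = divisor (f' : MvPolynomial R k) :=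
    (hL.2 f hf).symm.trans h
  obtain ⟨c, hc, rfl⟩ := exists_smul_of_divisor_eq hF hLf hf' h1
  have h2 := mk_lift_mem_discLocus hF hL hf hLf hmem
  have h3 : Projectivization.mk k (L f) hLf = Projectivization.mk k (c • L f) hf' :=
    (Projectivization.mk_eq_mk_iff' k _ _ _ _).mpr ⟨c⁻¹, by rw [smul_smul, inv_mul_cancel₀ hc,
      one_smul]⟩
  rwa [← h3]

/-- The discriminant locus is the closure of the forms with a singular point over the sweep of
the torus. -/
theorem discLocus_eq_closure_sweep (hF : F.IsComplete) :
    discLocus F k α =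
      zariskiClosure {p | ∃ x ∈ sweep F k α, ∃ z : R → k, LiesOver z x ∧
        eval z (p.rep : MvPolynomial R k) = 0 ∧ GradVanishes (p.rep : MvPolynomial R k) z} := by
  refine zariskiClosure_eq ?_ ?_
  · rintro p ⟨z, hz, hs⟩
    obtain ⟨x, hx, hzx⟩ := exists_liesOver_torus_point (F := F) hz
    exact ⟨x, ⟨1, one_mem _, x, hx, rfl⟩, z, hzx, hs⟩
  · rintro p ⟨x, ⟨g, hg, t, ht, rfl⟩, z, hz, hs, hgrad⟩ H d hH hv
    obtain ⟨L, hL⟩ := exists_lift hF ⟨p.rep, p.rep.2, CoxPiece.coe_ne_zero p.rep_nonzero⟩ hg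
    obtain ⟨w, hw, -⟩ := hF.exists_liesOver t
    -- A form singular over `g t` comes from one singular on the torus, and lifts keep the latter
    -- inside every hypersurface containing the locus.
    have h1 := singular_of_lift hF hL (L.symm p.rep) ht hw hz
    rw [LinearEquiv.apply_symm_apply] at h1
    have h2 := eval_lift_eq_zero hF hL hH ((vanishesOnSingular_iff hH).mpr hv)
      (fun h => p.rep_nonzero (L.symm.map_eq_zero_iff.mp h)) (hw.mem_torus_iff.mp ht)
      (h1 hs hgrad)
    rwa [LinearEquiv.apply_symm_apply] at h2

omit [IsAlgClosed k] in
/-- Euler's relation: for `α ≠ 0` the elements of `S_α` lie in the ideal of their partial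
derivatives. -/
lemma eval_eq_zero_of_gradVanishes (hF : F.IsComplete) (hα : α ≠ 0) (f : CoxPiece F k α)
    {z : R → k} (h : GradVanishes (f : MvPolynomial R k) z) :
    eval z (f : MvPolynomial R k) = 0 := by
  classical
  by_cases hf : f = 0
  · rw [hf]; simp
  obtain ⟨e₀, he₀⟩ : ∃ e, coeff e (f : MvPolynomial R k) ≠ 0 := by
    by_contra hcon
    push Not at hcon
    exact CoxPiece.coe_ne_zero hf (MvPolynomial.ext _ _ hcon)
  have hw₀ : Finsupp.weight (varDeg F) e₀ = α := f.2 he₀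
  obtain ⟨c, hc1, hc⟩ := hF.exists_pos_relation
  have hpos : ∑ ρ, c ρ * (e₀ ρ : ℝ) ≠ 0 := by
    intro h0
    apply hα
    have h1 := (Finset.sum_eq_zero_iff_of_nonneg fun ρ _ =>
      mul_nonneg (zero_le_one.trans (hc1 ρ)) (Nat.cast_nonneg (e₀ ρ))).mp h0
    have h2 : e₀ = 0 := Finsupp.ext fun ρ => by
      have := (mul_eq_zero.mp (h1 ρ (Finset.mem_univ ρ))).resolve_left
        (zero_lt_one.trans_le (hc1 ρ)).ne'
      exact_mod_cast this
    rw [← hw₀, h2, map_zero]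
  -- The positive relation has real coefficients, which have no meaning in `k`. A `ℚ`-linear
  -- functional nonzero on the degree of `α` turns them into rational weights with nonzero total
  -- `κ`, which suffices for Euler's relation.
  obtain ⟨ψ, hψ⟩ : ∃ ψ : ℝ →ₗ[ℚ] ℚ, ψ (∑ ρ, c ρ * (e₀ ρ : ℝ)) ≠ 0 := by
    by_contra hcon
    push Not at hcon
    exact hpos ((Module.forall_dual_apply_eq_zero_iff ℚ _).mp hcon)
  have hψsum : ∀ e : R →₀ ℕ, ψ (∑ ρ, c ρ * (e ρ : ℝ)) = ∑ ρ, ψ (c ρ) * (e ρ : ℚ) := by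
    intro e
    rw [map_sum]
    refine Finset.sum_congr rfl fun ρ _ => ?_
    rw [mul_comm, ← nsmul_eq_mul, map_nsmul, nsmul_eq_mul, mul_comm]
  set κ := ψ (∑ ρ, c ρ * (e₀ ρ : ℝ)) with hκ
  have heuler : ∑ ρ, ((ψ (c ρ) : ℚ) : k) * (z ρ * eval z (pderiv ρ (f : MvPolynomial R k))) =
      (κ : k) * eval z (f : MvPolynomial R k) := by
    conv_lhs => rw [(f : MvPolynomial R k).as_sum]
    conv_rhs => rw [(f : MvPolynomial R k).as_sum]
    simp only [map_sum, Finset.mul_sum, eval_X_mul_pderiv_monomial]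
    rw [Finset.sum_comm]
    refine Finset.sum_congr rfl fun e he => ?_
    have he' : Finsupp.weight (varDeg F) e = α := f.2 (mem_support_iff.mp he)
    rw [hκ, ← pairing_relation hc (he'.trans hw₀.symm), hψsum]
    push_cast
    rw [Finset.sum_mul]
    exact Finset.sum_congr rfl fun ρ _ => by ring
  simp only [h _, mul_zero, Finset.sum_const_zero] at heuler
  exact (mul_eq_zero.mp heuler.symm).resolve_left (Rat.cast_ne_zero.mpr hψ)

theorem discLocus_eq_closure_sweep' (hF : F.IsComplete) (hα : α ≠ 0) :
    discLocus F k α =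
      zariskiClosure {p | ∃ x ∈ sweep F k α, ∃ z : R → k, LiesOver z x ∧
        GradVanishes (p.rep : MvPolynomial R k) z} := by
  rw [discLocus_eq_closure_sweep hF]
  congr 1
  ext p
  refine exists_congr fun x => and_congr_right fun _ => exists_congr fun z =>
    and_congr_right fun _ => ⟨fun h => h.2, fun h => ⟨?_, h⟩⟩
  exact eval_eq_zero_of_gradVanishes hF hα p.rep h

end Closure

/-! ### The discriminant is a semi-invariant -/

section Discriminant

variable {F : Fan n R} {α : Cl F}

lemma mem_discIdeal {P : MvPolynomial (Exps F α) k} : P ∈ discIdeal F k α ↔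
    ∀ f : CoxPiece F k α, (f = 0 ∨ ∃ hf : f ≠ 0, Projectivization.mk k f hf ∈ discLocus F k α) →
      eval (coords f) P = 0 := by
  constructor
  · intro h f hf
    exact h _ ⟨f, rfl, hf⟩
  · rintro h _ ⟨f, rfl, hf⟩
    exact h f hf

lemma scalar_mem_linearGroup {c : k} (hc : c ≠ 0) :
    ((1 : Equiv.Perm (Point F k)), LinearEquiv.smulOfNeZero k (CoxPiece F k α) c hc) ∈
      linearGroup F k α :=
  ⟨one_mem _, fun f _ => (pushDivisor_one _).trans (divisor_smul (f : MvPolynomial R k) hc).symm⟩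

lemma totalDegree_substMap_le [Fintype (Exps F α)] (A : CoxPiece F k α →ₗ[k] CoxPiece F k α)
    (P : MvPolynomial (Exps F α) k) : (substMap A P).totalDegree ≤ P.totalDegree := by
  conv_lhs => rw [← sum_homogeneousComponent P]
  rw [map_sum]
  refine (totalDegree_finsetSum _ _).trans (Finset.sup_le fun i hi => ?_)
  refine (isHomogeneous_substMap A (homogeneousComponent_isHomogeneous i P)).totalDegree_le.trans ?_
  have := Finset.mem_range.mp hi
  omega

variable [IsAlgClosed k] [CharZero k]

lemma substMap_mem_discIdeal (hF : F.IsComplete) [Fintype (Exps F α)]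
    {g : Equiv.Perm (Point F k)} {L : CoxPiece F k α ≃ₗ[k] CoxPiece F k α}
    (hL : (g, L) ∈ linearGroup F k α) {P : MvPolynomial (Exps F α) k}
    (hP : P ∈ discIdeal F k α) :
    substMap (L : CoxPiece F k α →ₗ[k] CoxPiece F k α) P ∈ discIdeal F k α := by
  rw [mem_discIdeal] at hP ⊢
  intro f hf
  rw [eval_substMap]
  refine hP (L f) ?_
  rcases hf with rfl | ⟨hf, hmem⟩
  · exact Or.inl (map_zero L)
  · exact Or.inr ⟨fun h => hf (L.map_eq_zero_iff.mp h), mk_lift_mem_discLocus hF hL hf _ hmem⟩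

omit [IsAlgClosed k] [CharZero k] in
lemma IsDiscriminant.ne_zero {Δ : MvPolynomial (Exps F α) k} (h : IsDiscriminant Δ) : Δ ≠ 0 := by
  rcases h with ⟨h1, h2⟩ | ⟨-, rfl⟩
  · rintro rfl
    rw [h2, Set.singleton_zero, Ideal.span_zero, Ideal.height_bot] at h1
    exact zero_ne_one h1
  · exact one_ne_zero

/-- The discriminant is a semi-invariant. -/
lemma IsDiscriminant.exists_factor (hF : F.IsComplete) {Δ : MvPolynomial (Exps F α) k}
    (hΔ : IsDiscriminant Δ) {g : Equiv.Perm (Point F k)}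
    {L : CoxPiece F k α ≃ₗ[k] CoxPiece F k α} (hL : (g, L) ∈ linearGroup F k α) :
    ∃ c : k, ∀ f, eval (coords (L f)) Δ = c * eval (coords f) Δ := by
  have := finite_exps hF α
  have := Fintype.ofFinite (Exps F α)
  have h0 := hΔ.ne_zero
  rcases hΔ with ⟨-, h2⟩ | ⟨-, rfl⟩
  · have h1 : Δ ∈ discIdeal F k α := by rw [h2]; exact Ideal.mem_span_singleton_self Δ
    have h3 := substMap_mem_discIdeal hF hL h1
    rw [h2, Ideal.mem_span_singleton] at h3
    obtain ⟨Q, hQ⟩ := h3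
    -- A linear substitution does not raise the degree, so the cofactor is constant.
    have hc : ∃ c, Q = C c := by
      by_cases hQ0 : Q = 0
      · exact ⟨0, by rw [hQ0, C_0]⟩
      have h4 := totalDegree_substMap_le (L : CoxPiece F k α →ₗ[k] CoxPiece F k α) Δ
      rw [hQ, totalDegree_mul_of_isDomain h0 hQ0] at h4
      exact ⟨_, totalDegree_eq_zero_iff_eq_C.mp (by omega)⟩
    obtain ⟨c, rfl⟩ := hc
    refine ⟨c, fun f => ?_⟩
    have h5 := congrArg (eval (coords f)) hQ
    rw [eval_substMap, map_mul, eval_C, mul_comm] at h5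
    exact h5
  · exact ⟨1, fun f => by simp⟩

omit [IsAlgClosed k] in
lemma exists_coords_ne_zero (hF : F.IsComplete) {Δ : MvPolynomial (Exps F α) k} (h : Δ ≠ 0) :
    ∃ f : CoxPiece F k α, eval (coords f) Δ ≠ 0 := by
  have := finite_exps hF α
  have := Fintype.ofFinite (Exps F α)
  by_contra hcon
  push Not at hcon
  refine h (MvPolynomial.funext fun v => ?_)
  have h1 := hcon ((coordsEquiv F k α).symm v)
  rwa [← coordsEquiv_apply, LinearEquiv.apply_symm_apply] at h1

/-- The discriminant is a form. -/
theorem IsDiscriminant.exists_isHomogeneous (hF : F.IsComplete) {Δ : MvPolynomial (Exps F α) k}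
    (hΔ : IsDiscriminant Δ) : ∃ d, Δ.IsHomogeneous d := by
  have := finite_exps hF α
  have := Fintype.ofFinite (Exps F α)
  have h0 := hΔ.ne_zero
  obtain ⟨c, hc⟩ := hΔ.exists_factor hF
    (scalar_mem_linearGroup (F := F) (α := α) (two_ne_zero (α := k)))
  -- Compare coefficients in `Δ(2f) = c Δ(f)`: each monomial of `Δ` satisfies `2 ^ deg = c`, and the
  -- powers of `2` are distinct in characteristic zero.
  have hG : (∑ e ∈ Δ.support, monomial e (((2 : k) ^ e.degree - c) * coeff e Δ)) = 0 := by
    refine MvPolynomial.funext fun v => ?_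
    obtain ⟨f, rfl⟩ := (coordsEquiv F k α).surjective v
    have h1 := hc f
    have h2 : coords (LinearEquiv.smulOfNeZero k (CoxPiece F k α) (2 : k) two_ne_zero f) =
        (2 : k) • coords f := coords_smul _ _
    rw [h2, eval_eq', eval_eq', Finset.mul_sum, ← sub_eq_zero, ← Finset.sum_sub_distrib] at h1
    rw [map_sum, map_zero, ← h1, coordsEquiv_apply]
    refine Finset.sum_congr rfl fun e _ => ?_
    rw [eval_monomial, Finsupp.prod_fintype _ _ fun _ => pow_zero _]
    simp only [Pi.smul_apply, smul_eq_mul, mul_pow, Finset.prod_mul_distrib,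
      Finset.prod_pow_eq_pow_sum]
    rw [Finsupp.degree_eq_sum]
    ring
  have hdeg : ∀ e ∈ Δ.support, (2 : k) ^ e.degree = c := by
    intro e he
    have h1 := congrArg (coeff e) hG
    rw [coeff_sum, coeff_zero] at h1
    simp only [coeff_monomial, Finset.sum_ite_eq', if_pos he] at h1
    exact sub_eq_zero.mp ((mul_eq_zero.mp h1).resolve_right (mem_support_iff.mp he))
  obtain ⟨e₀, he₀⟩ := support_nonempty.mpr h0
  refine ⟨e₀.degree, fun e he => ?_⟩
  have h1 := (hdeg e (mem_support_iff.mpr he)).trans (hdeg e₀ he₀).symm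
  have h2 : (2 : ℕ) ^ e.degree = 2 ^ e₀.degree := by exact_mod_cast h1
  rw [← Nat.pow_right_injective le_rfl h2, Finsupp.degree_eq_weight_one]
  rfl

/-- The character of the semi-invariant `Δ`. -/
theorem IsDiscriminant.exists_character (hF : F.IsComplete) {Δ : MvPolynomial (Exps F α) k}
    (hΔ : IsDiscriminant Δ) : ∃ χ : linearGroup F k α →* kˣ,
      (∃ P : MvPolynomial (Exps F α × Exps F α) k, ∀ p : linearGroup F k α,
        (χ p : k) = eval (entries p.1.2.symm) P) ∧
      ∀ (p : linearGroup F k α) (f : CoxPiece F k α),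
        eval (coords (p.1.2.symm f)) Δ = (χ p : k) * eval (coords f) Δ := by
  have := finite_exps hF α
  have := Fintype.ofFinite (Exps F α)
  obtain ⟨f₀, hf₀⟩ := exists_coords_ne_zero hF hΔ.ne_zero
  have hex : ∀ p : linearGroup F k α, ∃ c : k,
      ∀ f, eval (coords (p.1.2.symm f)) Δ = c * eval (coords f) Δ := fun p =>
    hΔ.exists_factor hF (g := p.1.1⁻¹) (L := p.1.2.symm) (inv_mem p.2)
  choose c hc using hex
  have hc0 : ∀ p, c p ≠ 0 := fun p h => by
    have h1 := hc p (p.1.2 f₀)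
    rw [LinearEquiv.symm_apply_apply, h, zero_mul] at h1
    exact hf₀ h1
  have hcmul : ∀ p q, c (p * q) = c p * c q := fun p q => by
    have h1 := hc (p * q) f₀
    have h2 : (p * q).1.2.symm f₀ = q.1.2.symm (p.1.2.symm f₀) := rfl
    rw [h2, hc q, hc p] at h1
    exact mul_right_cancel₀ hf₀ (by linear_combination -h1)
  -- Since `χ(g, L) = Δ(L⁻¹ f₀) / Δ(f₀)` for a fixed `f₀` with `Δ(f₀) ≠ 0`, the character is
  -- polynomial in the entries of `L⁻¹`.
  refine ⟨MonoidHom.mk' (fun p => Units.mk0 (c p) (hc0 p)) fun p q => Units.ext (hcmul p q),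
    ⟨C (eval (coords f₀) Δ)⁻¹ * aeval (fun a => ∑ b, X (a, b) * C (coords f₀ b)) Δ, fun p => ?_⟩, hc⟩
  change c p = _
  have h1 : eval (entries p.1.2.symm)
      (aeval (fun a => ∑ b, X (a, b) * C (coords f₀ b)) Δ : MvPolynomial (Exps F α × Exps F α) k) =
      eval (coords (p.1.2.symm f₀)) Δ := by
    rw [← coe_aeval_eq_eval, ← coe_aeval_eq_eval]
    change (aeval _) (aeval _ Δ) = aeval _ Δ
    rw [← AlgHom.comp_apply, comp_aeval]
    congr 2
    funext a
    have h2 := coords_map (p.1.2.symm : CoxPiece F k α →ₗ[k] CoxPiece F k α) f₀ a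
    rw [LinearEquiv.coe_coe] at h2
    rw [h2]
    simp [entries]
  rw [map_mul, eval_C, h1, hc, mul_comm (c p), inv_mul_cancel_left₀ hf₀]

end Discriminant

/-! ### Unipotent elements -/

section Unipotent

variable [CharZero k]

/-- The matrix entries of the powers of a unipotent element are polynomials in the exponent. -/
lemma exists_poly_pow {A : Type*} [Ring A] [Algebra k A] {a : A} (ha : IsNilpotent (a - 1))
    (l : A →ₗ[k] k) : ∃ p : Polynomial k, ∀ j : ℕ, p.eval (j : k) = l (a ^ j) := by
  obtain ⟨N, hN⟩ := ha
  -- The binomial expansion of `(1 + (a - 1)) ^ j` stops before the nilpotency exponent `N`, and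
  -- `j.choose i` is the polynomial `descPochhammer k i` over `i!`.
  refine ⟨∑ i ∈ Finset.range N,
    Polynomial.C (l ((a - 1) ^ i) / (i.factorial : k)) * descPochhammer k i, fun j => ?_⟩
  have h1 : a ^ j = ∑ i ∈ Finset.range N, (j.choose i : k) • (a - 1) ^ i := by
    have h2 : a ^ j = ∑ i ∈ Finset.range (j + 1), (j.choose i : k) • (a - 1) ^ i := by
      conv_lhs => rw [← sub_add_cancel a 1, (Commute.one_right (a - 1)).add_pow]
      refine Finset.sum_congr rfl fun i _ => ?_
      rw [one_pow, mul_one, Nat.cast_smul_eq_nsmul, nsmul_eq_mul, Nat.cast_comm]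
    rw [h2]
    rcases le_total N (j + 1) with h | h
    · refine (Finset.sum_subset (Finset.range_subset_range.mpr h) fun i _ hi => ?_).symm
      rw [pow_eq_zero_of_le (not_lt.mp fun h' => hi (Finset.mem_range.mpr h')) hN, smul_zero]
    · refine Finset.sum_subset (Finset.range_subset_range.mpr h) fun i _ hi => ?_
      rw [Nat.choose_eq_zero_of_lt, Nat.cast_zero, zero_smul]
      have := Finset.mem_range.not.mp hi
      omega
  rw [h1, map_sum, Polynomial.eval_finsetSum]
  refine Finset.sum_congr rfl fun i _ => ?_
  rw [Polynomial.eval_mul, Polynomial.eval_C, descPochhammer_eval_eq_descFactorial, map_smul,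
    smul_eq_mul, Nat.descFactorial_eq_factorial_mul_choose, Nat.cast_mul]
  have := Nat.cast_ne_zero (R := k).mpr i.factorial_ne_zero
  field_simp

lemma poly_eq_of_eventually {p q : Polynomial k} {N : ℕ}
    (h : ∀ j : ℕ, N ≤ j → p.eval (j : k) = q.eval (j : k)) : p = q := by
  refine Polynomial.eq_of_infinite_eval_eq p q ?_
  refine Set.Infinite.mono (s := (fun j : ℕ => ((j + N : ℕ) : k)) '' Set.univ) ?_ ?_
  · rintro _ ⟨j, -, rfl⟩
    exact h _ (Nat.le_add_left N j)
  · exact Set.infinite_univ.image fun a _ b _ hab => by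
      simpa using hab

lemma eventually_eval_ne_zero {B : Polynomial k} (hB : B ≠ 0) :
    ∃ N : ℕ, ∀ j : ℕ, N ≤ j → B.eval (j : k) ≠ 0 := by
  classical
  have hfin : {j : ℕ | B.eval (j : k) = 0}.Finite := by
    refine Set.Finite.subset ((B.roots.toFinset.finite_toSet).preimage
      (f := fun j : ℕ => (j : k)) fun a _ b _ hab => Nat.cast_injective hab) fun j hj => ?_
    rw [Set.mem_preimage, Finset.mem_coe, Multiset.mem_toFinset, Polynomial.mem_roots hB]
    exact hj
  obtain ⟨N, hN⟩ := hfin.bddAbove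
  exact ⟨N + 1, fun j hj h => by have := hN h; omega⟩

/-- An exponential function is not a rational function. -/
lemma eq_one_of_pow_mul_eval_eq {c : k} {p q : Polynomial k} (hp : p ≠ 0) (hq : q ≠ 0) {N : ℕ}
    (h : ∀ j : ℕ, N ≤ j → c ^ j * p.eval (j : k) = q.eval (j : k)) : c = 1 := by
  -- Dividing the relations for consecutive `j` removes the exponential and leaves a polynomial
  -- identity. The shift keeps leading coefficients, so comparing them gives `c = 1`.
  have h1 : Polynomial.C c * p.comp (Polynomial.X + 1) * q = p * q.comp (Polynomial.X + 1) := by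
    refine poly_eq_of_eventually (N := N) fun j hj => ?_
    have e1 := h j hj
    have e2 := h (j + 1) (by omega)
    push_cast at e2
    simp only [Polynomial.eval_mul, Polynomial.eval_C, Polynomial.eval_comp, Polynomial.eval_add,
      Polynomial.eval_X, Polynomial.eval_one, ← e1, ← e2]
    ring
  have hlc : ∀ p : Polynomial k, (p.comp (Polynomial.X + 1)).leadingCoeff = p.leadingCoeff := by
    intro p
    have h2 : (Polynomial.X + 1 : Polynomial k) = Polynomial.X + Polynomial.C 1 := by simp
    rw [Polynomial.leadingCoeff_comp (by rw [h2, Polynomial.natDegree_X_add_C]; exact one_ne_zero),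
      h2, Polynomial.leadingCoeff_X_add_C, one_pow, mul_one]
  have h2 := congrArg Polynomial.leadingCoeff h1
  rw [Polynomial.leadingCoeff_mul, Polynomial.leadingCoeff_mul, Polynomial.leadingCoeff_mul,
    Polynomial.leadingCoeff_C, hlc, hlc, mul_assoc] at h2
  exact (mul_eq_right₀ (mul_ne_zero (Polynomial.leadingCoeff_ne_zero.mpr hp)
    (Polynomial.leadingCoeff_ne_zero.mpr hq))).mp h2

variable {V : Type*} [AddCommGroup V] [Module k V] [FiniteDimensional k V]

lemma IsUnipotentMap.trace {L : V ≃ₗ[k] V} (h : IsUnipotentMap L) :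
    LinearMap.trace k V L = Module.finrank k V := by
  have h1 := (LinearMap.isNilpotent_trace_of_isNilpotent h).eq_zero
  rw [map_sub, sub_eq_zero] at h1
  rw [h1, LinearMap.trace_id]

omit [CharZero k] in
lemma IsUnipotentMap.det {L : V ≃ₗ[k] V} (h : IsUnipotentMap L) :
    LinearMap.det (L : V →ₗ[k] V) = 1 := by
  have h1 : IsNilpotent (LinearMap.id - (L : V →ₗ[k] V) : Module.End k V) := by
    rw [← neg_sub]
    exact h.neg
  have h2 := congrArg (Polynomial.eval 1) h1.charpoly_eq_X_pow_finrank
  rw [LinearMap.eval_charpoly, Polynomial.eval_pow, Polynomial.eval_X, one_pow, map_one] at h2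
  rwa [Module.End.one_eq_id, sub_sub_cancel] at h2

omit [CharZero k] in
/-- A linear map whose only eigenvalue is `1` is unipotent. -/
lemma isUnipotentMap_of_eigenvalues [IsAlgClosed k] {L : V ≃ₗ[k] V}
    (h : ∀ (c : k) (v : V), v ≠ 0 → L v = c • v → c = 1) : IsUnipotentMap L := by
  have h1 := Module.End.iSup_maxGenEigenspace_eq_top (L : Module.End k V)
  have h2 : ∀ c : k, c ≠ 1 → Module.End.maxGenEigenspace (L : Module.End k V) c = ⊥ := by
    intro c hc
    have hinj : Function.Injective ((L : Module.End k V) - c • (1 : Module.End k V)) := by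
      rw [injective_iff_map_eq_zero]
      intro v hv
      by_contra hv0
      exact hc (h c v hv0 (sub_eq_zero.mp hv))
    rw [eq_bot_iff]
    intro v hv
    obtain ⟨j, hj⟩ := (Module.End.mem_maxGenEigenspace _ _ _).mp hv
    rw [Module.End.pow_apply] at hj
    exact (hinj.iterate j) (hj.trans (Function.iterate_fixed (map_zero _) j).symm)
  have h3 : Module.End.maxGenEigenspace (L : Module.End k V) 1 = ⊤ := by
    rw [← h1]
    refine le_antisymm (le_iSup _ 1) (iSup_le fun c => ?_)
    by_cases hc : c = 1
    · rw [hc]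
    · rw [h2 c hc]; exact bot_le
  rw [Module.End.maxGenEigenspace_eq_genEigenspace_finrank] at h3
  refine ⟨Module.finrank k V, LinearMap.ext fun v => ?_⟩
  have h4 : v ∈ Module.End.genEigenspace (L : Module.End k V) 1 (Module.finrank k V) := by
    rw [h3]; trivial
  rw [Module.End.mem_genEigenspace_nat, one_smul] at h4
  exact h4

end Unipotent

/-! ### Unipotent groups of automorphisms -/

section Radical

variable {F : Fan n R} {α : Cl F} [CharZero k]

/-- The coordinates of `h ^ j` for a unipotent matrix `h` are polynomials in `j`. -/
lemma exists_poly_evalAt₂ {r : ℕ} {h : GL (Fin r) k}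
    (hh : IsNilpotent ((h : Matrix (Fin r) (Fin r) k) - 1)) {σ : Finset R}
    (Q : F.dual σ →₀ MvPolynomial (Fin r × Fin r) k) (x : Point F k) :
    ∃ q : Polynomial k, ∀ j : ℕ, q.eval (j : k) = evalAt₂ Q (h ^ j) x := by
  choose p hp using fun ij : Fin r × Fin r => exists_poly_pow hh (Matrix.entryLinearMap k k ij.1 ij.2)
  refine ⟨Q.sum fun m c => aeval p c * Polynomial.C (x.val m), fun j => ?_⟩
  rw [evalAt₂, Finsupp.sum, Finsupp.sum, Polynomial.eval_finsetSum]
  refine Finset.sum_congr rfl fun m _ => ?_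
  rw [Polynomial.eval_mul, Polynomial.eval_C]
  congr 1
  rw [← Polynomial.coe_aeval_eq_eval, ← coe_aeval_eq_eval]
  change (Polynomial.aeval (j : k)) (aeval p _) = aeval _ _
  rw [← AlgHom.comp_apply, comp_aeval]
  congr 2
  funext ij
  rw [Polynomial.coe_aeval_eq_eval, hp, Units.val_pow_eq_pow_val]
  rfl

/-- Along the orbit of a unipotent automorphism the functions on the torus are rational. -/
lemma exists_poly_orbit {r : ℕ} {H : Subgroup (GL (Fin r) k)} {act : H →* Equiv.Perm (Point F k)}
    (hact : IsAlgebraicAction act) {h : H}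
    (hh : IsNilpotent (((h : GL (Fin r) k) : Matrix (Fin r) (Fin r) k) - 1)) {x : Point F k}
    (hx : x ∈ torus F k) (φ : CharAlg n k) :
    ∃ A B : Polynomial k, B.eval 0 ≠ 0 ∧ ∀ j : ℕ, B.eval (j : k) ≠ 0 →
      act (h ^ j) x ∈ torus F k ∧ pev (act (h ^ j) x) φ * B.eval (j : k) = A.eval (j : k) := by
  have hsingle : ∀ m (c : k), ∃ A B : Polynomial k, B.eval 0 ≠ 0 ∧ ∀ j : ℕ, B.eval (j : k) ≠ 0 →
      act (h ^ j) x ∈ torus F k ∧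
      pev (act (h ^ j) x) (AddMonoidAlgebra.single m c) * B.eval (j : k) = A.eval (j : k) := by
    intro m c
    -- Algebraicity is used at the identity with target chart `T`; the denominator is nonzero there,
    -- which is why `B` does not vanish at `0`.
    obtain ⟨σ, hσ, hxσ, P, Q, hQ, hPQ⟩ := hact 1 x ∅ F.empty_mem
      (by rw [map_one]; exact torus_subset_chart _ hx) m
      (fun ρ hρ => absurd hρ (Finset.notMem_empty ρ))
    obtain ⟨p, hp⟩ := exists_poly_evalAt₂ hh P x
    obtain ⟨q, hq⟩ := exists_poly_evalAt₂ hh Q x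
    refine ⟨Polynomial.C c * p, q, ?_, fun j hj => ?_⟩
    · have h1 := hq 0
      rw [pow_zero, Nat.cast_zero] at h1
      rw [h1]
      exact hQ
    · rw [hq] at hj
      have h1 := hPQ (h ^ j) x hxσ (by rw [Subgroup.coe_pow]; exact hj)
      rw [Subgroup.coe_pow] at h1
      refine ⟨by rw [torus_eq_chart]; exact h1.1, ?_⟩
      rw [pev_single, hq, mul_assoc, h1.2, Polynomial.eval_mul, Polynomial.eval_C, hp]
  induction φ using AddMonoidAlgebra.induction_linear with
  | zero =>
    obtain ⟨A, B, hB, h1⟩ := hsingle 0 0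
    refine ⟨A, B, hB, fun j hj => ?_⟩
    have h2 := h1 j hj
    rwa [AddMonoidAlgebra.single_zero] at h2
  | single m c => exact hsingle m c
  | add p q hp hq =>
    obtain ⟨A, B, hB, h1⟩ := hp
    obtain ⟨A', B', hB', h2⟩ := hq
    refine ⟨A * B' + A' * B, B * B', by rw [Polynomial.eval_mul]; exact mul_ne_zero hB hB',
      fun j hj => ?_⟩
    rw [Polynomial.eval_mul] at hj
    obtain ⟨h3, h4⟩ := h1 j (left_ne_zero_of_mul hj)
    obtain ⟨-, h5⟩ := h2 j (right_ne_zero_of_mul hj)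
    refine ⟨h3, ?_⟩
    rw [map_add, Polynomial.eval_add, Polynomial.eval_mul, Polynomial.eval_mul,
      Polynomial.eval_mul, ← h4, ← h5]
    ring

omit [CharZero k] in
lemma pow_apply_eq_smul {L : CoxPiece F k α ≃ₗ[k] CoxPiece F k α} {f : CoxPiece F k α} {c : k}
    (h : L f = c • f) (j : ℕ) : (L ^ j) f = c ^ j • f := by
  induction j with
  | zero => simp
  | succ j ih => rw [pow_succ, LinearEquiv.mul_apply, h, map_smul, ih, smul_smul, pow_succ']

variable [IsAlgClosed k]

/-- The lift of a unipotent automorphism has only one eigenvalue. -/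
lemma eigenvalue_unique (hF : F.IsComplete) {r : ℕ} {H : Subgroup (GL (Fin r) k)}
    {act : H →* Equiv.Perm (Point F k)} (hact : IsAlgebraicAction act) {h : H}
    (hh : IsNilpotent (((h : GL (Fin r) k) : Matrix (Fin r) (Fin r) k) - 1))
    {L : CoxPiece F k α ≃ₗ[k] CoxPiece F k α} (hL : (act h, L) ∈ linearGroup F k α)
    {f f' : CoxPiece F k α} (hf : f ≠ 0) (hf' : f' ≠ 0) {c c' : k} (hc : L f = c • f)
    (hc' : L f' = c' • f') : c = c' := by
  have hc0' : c' ≠ 0 := by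
    rintro rfl
    rw [zero_smul] at hc'
    exact hf' (L.map_eq_zero_iff.mp hc')
  obtain ⟨b, hb⟩ := QuotientAddGroup.mk_surjective α
  have hb0 : ∀ ρ ∈ (∅ : Finset R), b ρ = 0 := fun ρ hρ => absurd hρ (Finset.notMem_empty ρ)
  obtain ⟨φ, -, hφ, -⟩ := exists_dehom hb hb0 f.2
  obtain ⟨φ', -, hφ', -⟩ := exists_dehom hb hb0 f'.2
  obtain ⟨x₁, -, h1⟩ := exists_pev_ne_zero_of_dehom (CoxPiece.coe_ne_zero hf) hφ
  obtain ⟨x₂, -, h2⟩ := exists_pev_ne_zero_of_dehom (CoxPiece.coe_ne_zero hf') hφ'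
  obtain ⟨x, hx, hφx⟩ := exists_torus_pev_ne_zero hF
    (mul_ne_zero (ne_zero_of_pev h1) (ne_zero_of_pev h2))
  rw [pev_mul_torus _ _ hx] at hφx
  have hφ0 := left_ne_zero_of_mul hφx
  have hφ0' := right_ne_zero_of_mul hφx
  obtain ⟨w, hw, -⟩ := hF.exists_liesOver x
  obtain ⟨A, B, hB, hAB⟩ := exists_poly_orbit hact hh hx φ
  obtain ⟨A', B', hB', hAB'⟩ := exists_poly_orbit hact hh hx φ'
  have hne : ∀ {P : Polynomial k}, P.eval 0 ≠ 0 → P ≠ 0 := by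
    rintro P hP rfl
    exact hP Polynomial.eval_zero
  have hA0 : ∀ {φ : CharAlg n k} {A B : Polynomial k}, B.eval 0 ≠ 0 → pev x φ ≠ 0 →
      (∀ j : ℕ, B.eval (j : k) ≠ 0 → act (h ^ j) x ∈ torus F k ∧
        pev (act (h ^ j) x) φ * B.eval (j : k) = A.eval (j : k)) → A.eval 0 ≠ 0 := by
    intro φ A B hB hφ hAB
    have h3 := (hAB 0 (by rwa [Nat.cast_zero])).2
    rw [pow_zero, map_one, Nat.cast_zero] at h3
    rw [← h3]
    exact mul_ne_zero hφ hB
  have hA := hA0 hB hφ0 hAB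
  have hA' := hA0 hB' hφ0' hAB'
  obtain ⟨N, hN⟩ := eventually_eval_ne_zero (mul_ne_zero (hne hB) (hne hB'))
  -- By `lift_rel` for `h ^ j`, the value of `f / f'` at `h ^ j x` is `(c' / c) ^ j` times its value
  -- at `x`, yet it is a rational function of `j`. Both forms are nonzero over `x`, so the
  -- polynomials involved are nonzero.
  have key : c / c' = 1 := by
    refine eq_one_of_pow_mul_eval_eq (p := A * B' * Polynomial.C (pev x φ'))
      (q := A' * B * Polynomial.C (pev x φ)) (N := N) (hne ?_) (hne ?_) fun j hj => ?_
    · rw [Polynomial.eval_mul, Polynomial.eval_mul, Polynomial.eval_C]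
      exact mul_ne_zero (mul_ne_zero hA hB') hφ0'
    · rw [Polynomial.eval_mul, Polynomial.eval_mul, Polynomial.eval_C]
      exact mul_ne_zero (mul_ne_zero hA' hB) hφ0
    have h3 := hN j hj
    rw [Polynomial.eval_mul] at h3
    obtain ⟨hy, h4⟩ := hAB j (left_ne_zero_of_mul h3)
    obtain ⟨-, h5⟩ := hAB' j (right_ne_zero_of_mul h3)
    obtain ⟨z, hz, -⟩ := hF.exists_liesOver (act (h ^ j) x)
    have hLj : (act (h ^ j), L ^ j) ∈ linearGroup F k α := by
      rw [map_pow]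
      exact pow_mem hL j
    have h6 := lift_rel hF hLj f f' hx hy hw hz
    rw [pow_apply_eq_smul hc, pow_apply_eq_smul hc', Submodule.coe_smul, Submodule.coe_smul,
      smul_eval, smul_eval, ← hφ x (torus_subset_chart _ hx) w hw,
      ← hφ _ (torus_subset_chart _ hy) z hz, ← hφ' x (torus_subset_chart _ hx) w hw,
      ← hφ' _ (torus_subset_chart _ hy) z hz] at h6
    have hwb : ∏ ρ, w ρ ^ b ρ ≠ 0 := Finset.prod_ne_zero_iff.mpr fun ρ _ =>
      zpow_ne_zero _ (hw.mem_torus_iff.mp hx ρ)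
    have hzb : ∏ ρ, z ρ ^ b ρ ≠ 0 := Finset.prod_ne_zero_iff.mpr fun ρ _ =>
      zpow_ne_zero _ (hz.mem_torus_iff.mp hy ρ)
    have h7 : c ^ j * pev (act (h ^ j) x) φ * pev x φ' =
        c' ^ j * pev (act (h ^ j) x) φ' * pev x φ :=
      mul_right_cancel₀ (mul_ne_zero hwb hzb) (by linear_combination h6)
    simp only [Polynomial.eval_mul, Polynomial.eval_C]
    rw [← h4, ← h5, div_pow, div_mul_eq_mul_div, div_eq_iff (pow_ne_zero j hc0')]
    linear_combination B.eval (j : k) * B'.eval (j : k) * h7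
  exact (div_eq_one_iff_eq hc0').mp key

/-- A unipotent automorphism has a unipotent lift. -/
lemma exists_unipotent_lift (hF : F.IsComplete) (hα : ∃ f ∈ CoxPiece F k α, f ≠ 0) {r : ℕ}
    {H : Subgroup (GL (Fin r) k)} {act : H →* Equiv.Perm (Point F k)}
    (hact : IsAlgebraicAction act) {h : H}
    (hh : IsNilpotent (((h : GL (Fin r) k) : Matrix (Fin r) (Fin r) k) - 1))
    (hG : act h ∈ autClass F k α) : ∃ L, (act h, L) ∈ linearGroup F k α ∧ IsUnipotentMap L := by
  have := finite_exps hF α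
  have := Fintype.ofFinite (Exps F α)
  have := finite_coxPiece (F := F) (k := k) (α := α)
  have : Nontrivial (CoxPiece F k α) := by
    obtain ⟨f, hf, hf0⟩ := hα
    exact ⟨⟨f, hf⟩, 0, fun h => hf0 (congrArg Subtype.val h)⟩
  obtain ⟨L, hL⟩ := exists_lift hF hα hG
  obtain ⟨c, hc⟩ := Module.End.exists_eigenvalue (L : Module.End k (CoxPiece F k α))
  obtain ⟨v, hv⟩ := hc.exists_hasEigenvector
  have hLv : L v = c • v := hv.apply_eq_smul
  have hc0 : c ≠ 0 := by
    rintro rfl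
    rw [zero_smul] at hLv
    exact hv.2 (L.map_eq_zero_iff.mp hLv)
  -- Divide an arbitrary lift by one of its eigenvalues; the only eigenvalue left is `1`.
  refine ⟨LinearEquiv.smulOfNeZero k _ c⁻¹ (inv_ne_zero hc0) * L, ?_,
    isUnipotentMap_of_eigenvalues fun c' v' hv' hLv' => ?_⟩
  · have := mul_mem (scalar_mem_linearGroup (F := F) (α := α) (inv_ne_zero hc0)) hL
    rwa [Prod.mk_mul_mk, one_mul] at this
  · have h1 : c⁻¹ • L v' = c' • v' := hLv'
    have h2 : L v' = (c * c') • v' := by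
      rw [mul_smul, ← h1, smul_smul, mul_inv_cancel₀ hc0, one_smul]
    have h3 := eigenvalue_unique hF hact hh hL hv' hv.2 h2 hLv
    exact (mul_eq_left₀ hc0).mp h3

/-- Lifts differ by a scalar, and both traces equal `dim S_α`, which is nonzero in characteristic
zero. -/
lemma unipotent_lift_unique (hF : F.IsComplete) (hα : ∃ f ∈ CoxPiece F k α, f ≠ 0)
    {g : Equiv.Perm (Point F k)} {L L' : CoxPiece F k α ≃ₗ[k] CoxPiece F k α}
    (hL : (g, L) ∈ linearGroup F k α) (hL' : (g, L') ∈ linearGroup F k α)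
    (hu : IsUnipotentMap L) (hu' : IsUnipotentMap L') : L' = L := by
  have := finite_exps hF α
  have := Fintype.ofFinite (Exps F α)
  have := finite_coxPiece (F := F) (k := k) (α := α)
  have : Nontrivial (CoxPiece F k α) := by
    obtain ⟨f, hf, hf0⟩ := hα
    exact ⟨⟨f, hf⟩, 0, fun h => hf0 (congrArg Subtype.val h)⟩
  obtain ⟨c, -, hc⟩ := lift_unique hF hα hL hL'
  have h1 : (L' : CoxPiece F k α →ₗ[k] CoxPiece F k α) = c • (L : _ →ₗ[k] _) := LinearMap.ext hc
  have h2 := hu'.trace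
  rw [h1, map_smul, hu.trace, smul_eq_mul] at h2
  have hN : (Module.finrank k (CoxPiece F k α) : k) ≠ 0 :=
    Nat.cast_ne_zero.mpr Module.finrank_pos.ne'
  have h3 : c = 1 := (mul_eq_right₀ hN).mp h2
  exact LinearEquiv.ext fun f => by rw [hc, h3, one_smul]

/-- If the automorphisms `g g' ^ j` have unipotent lifts, then the product of the unipotent lifts
of `g` and `g'` is unipotent. -/
lemma isUnipotentMap_mul (hF : F.IsComplete) (hα : ∃ f ∈ CoxPiece F k α, f ≠ 0)
    {g g' : Equiv.Perm (Point F k)} {L L' : CoxPiece F k α ≃ₗ[k] CoxPiece F k α}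
    (hL : (g, L) ∈ linearGroup F k α) (hL' : (g', L') ∈ linearGroup F k α)
    (hu : IsUnipotentMap L) (hu' : IsUnipotentMap L')
    (hex : ∀ j : ℕ, ∃ M, (g * g' ^ j, M) ∈ linearGroup F k α ∧ IsUnipotentMap M) :
    IsUnipotentMap (L * L') := by
  have := finite_exps hF α
  have := Fintype.ofFinite (Exps F α)
  have := finite_coxPiece (F := F) (k := k) (α := α)
  have : Nontrivial (CoxPiece F k α) := by
    obtain ⟨f, hf, hf0⟩ := hα
    exact ⟨⟨f, hf⟩, 0, fun h => hf0 (congrArg Subtype.val h)⟩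
  set N := Module.finrank k (CoxPiece F k α) with hNdef
  have hN0 : N ≠ 0 := Module.finrank_pos.ne'
  have hN : (N : k) ≠ 0 := Nat.cast_ne_zero.mpr hN0
  choose M hM hMu using hex
  have hmem : ∀ j, (g * g' ^ j, L * L' ^ j) ∈ linearGroup F k α := fun j =>
    mul_mem hL (pow_mem hL' j)
  -- Write `L L'^j = c_j M_j` with `M_j` unipotent. Determinants give `c_j ^ N = 1`, while traces
  -- make `N c_j` a polynomial in `j`. Its `N`-th power is constant, so `c_j` is constant, and `j =
  -- 0` shows that it is `1`.
  choose c hc0 hc using fun j => lift_unique hF hα (hM j) (hmem j)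
  have heq : ∀ j, ((L : Module.End k (CoxPiece F k α)) * (L' : Module.End k _) ^ j) =
      c j • (M j : Module.End k (CoxPiece F k α)) := fun j => by
    have h1 : ((L' ^ j : CoxPiece F k α ≃ₗ[k] CoxPiece F k α) : Module.End k (CoxPiece F k α)) =
        (L' : Module.End k (CoxPiece F k α)) ^ j := by
      induction j with
      | zero => rfl
      | succ j ih =>
        rw [pow_succ, pow_succ, ← ih]
        rfl
    rw [← h1]
    exact LinearMap.ext (hc j)
  have hdet : ∀ j, c j ^ N = 1 := fun j => by
    have h1 := congrArg LinearMap.det (heq j)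
    rw [map_mul, map_pow, hu.det, hu'.det, LinearMap.det_smul, (hMu j).det, one_pow, one_mul,
      mul_one] at h1
    exact h1.symm
  obtain ⟨p, hp⟩ := exists_poly_pow (A := Module.End k (CoxPiece F k α)) (a := L')
    (show IsNilpotent ((L' : Module.End k (CoxPiece F k α)) - 1) from hu')
    (LinearMap.trace k (CoxPiece F k α) ∘ₗ LinearMap.mulLeft k (L : Module.End k (CoxPiece F k α)))
  have hpc : ∀ j : ℕ, p.eval (j : k) = c j * N := fun j => by
    rw [hp, LinearMap.comp_apply, LinearMap.mulLeft_apply, heq, map_smul, (hMu j).trace,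
      smul_eq_mul]
  have hconst : p ^ N = Polynomial.C ((N : k) ^ N) := by
    refine poly_eq_of_eventually (N := 0) fun j _ => ?_
    rw [Polynomial.eval_pow, hpc, mul_pow, hdet, one_mul, Polynomial.eval_C]
  have hdeg : p.natDegree = 0 := by
    have h1 := congrArg Polynomial.natDegree hconst
    rw [Polynomial.natDegree_pow, Polynomial.natDegree_C] at h1
    exact (mul_eq_zero.mp h1).resolve_left hN0
  have hc01 : c 1 = c 0 := by
    have h0 := hpc 0
    have h1 := hpc 1
    rw [Polynomial.eq_C_of_natDegree_eq_zero hdeg, Polynomial.eval_C] at h0 h1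
    exact mul_right_cancel₀ hN (h1.symm.trans h0)
  have hc0' : c 0 = 1 := by
    have h1 := congrArg (LinearMap.trace k (CoxPiece F k α)) (heq 0)
    rw [pow_zero, mul_one, map_smul, (hMu 0).trace, hu.trace, smul_eq_mul] at h1
    exact ((mul_eq_right₀ hN).mp h1.symm)
  have h1 : L * L' = M 1 := LinearEquiv.ext fun f => by
    have := hc 1 f
    rwa [pow_one, hc01, hc0', one_smul] at this
  rw [h1]
  exact hMu 1

/-- Unipotent lifts leave the discriminant invariant. -/
lemma IsDiscriminant.eval_unipotent (hF : F.IsComplete) {Δ : MvPolynomial (Exps F α) k}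
    (hΔ : IsDiscriminant Δ) {g : Equiv.Perm (Point F k)}
    {L : CoxPiece F k α ≃ₗ[k] CoxPiece F k α} (hL : (g, L) ∈ linearGroup F k α)
    (hu : IsUnipotentMap L) (f : CoxPiece F k α) :
    eval (coords (L f)) Δ = eval (coords f) Δ := by
  have := finite_exps hF α
  have := Fintype.ofFinite (Exps F α)
  obtain ⟨f₀, hf₀⟩ := exists_coords_ne_zero hF hΔ.ne_zero
  obtain ⟨c, hc⟩ := hΔ.exists_factor hF hL
  let l : Exps F α → Module.End k (CoxPiece F k α) →ₗ[k] k := fun a =>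
    LinearMap.proj a ∘ₗ (coordsEquiv F k α).toLinearMap ∘ₗ LinearMap.applyₗ f₀
  -- The coordinates of `L ^ j f₀` are polynomials in `j`, so `c ^ j Δ(f₀) = Δ(L ^ j f₀)` is one
  -- too, which forces `c = 1`.
  choose p hp using fun a => exists_poly_pow (A := Module.End k (CoxPiece F k α)) (a := L)
    (show IsNilpotent ((L : Module.End k (CoxPiece F k α)) - 1) from hu) (l a)
  have hpow : ∀ j : ℕ, eval (coords (((L : Module.End k (CoxPiece F k α)) ^ j) f₀)) Δ =
      c ^ j * eval (coords f₀) Δ := by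
    intro j
    induction j with
    | zero => simp
    | succ j ih =>
      have h1 : ((L : Module.End k (CoxPiece F k α)) ^ (j + 1)) f₀ =
          L (((L : Module.End k (CoxPiece F k α)) ^ j) f₀) := by
        rw [pow_succ']; rfl
      rw [h1, hc, ih, pow_succ']
      ring
  have heval : ∀ j : ℕ, c ^ j * (Polynomial.C (eval (coords f₀) Δ)).eval (j : k) =
      (aeval p Δ : Polynomial k).eval (j : k) := by
    intro j
    rw [Polynomial.eval_C, ← hpow, ← Polynomial.coe_aeval_eq_eval, ← coe_aeval_eq_eval]
    change aeval _ _ = (Polynomial.aeval (j : k)) (aeval p Δ)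
    rw [← AlgHom.comp_apply, comp_aeval]
    congr 2
    funext a
    rw [Polynomial.coe_aeval_eq_eval, hp]
    rfl
  have hc1 : c = 1 := by
    refine eq_one_of_pow_mul_eval_eq (Polynomial.C_ne_zero.mpr hf₀) (fun h => ?_) (N := 0)
      fun j _ => heval j
    have h1 := heval 0
    rw [h, Polynomial.eval_zero, pow_zero, one_mul, Polynomial.eval_C] at h1
    exact hf₀ h1
  rw [hc, hc1, one_mul]

/-- The linear action of the unipotent radical. -/
theorem exists_unipotent_action (hF : F.IsComplete) (hα : ∃ f ∈ CoxPiece F k α, f ≠ 0)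
    {U : Subgroup (Equiv.Perm (Point F k))} (hU : U ≤ autClass F k α)
    (hUu : IsUnipotentAlgebraic U) :
    ∃ Λ : U →* (CoxPiece F k α ≃ₗ[k] CoxPiece F k α), ∀ u : U,
      ((u : Equiv.Perm (Point F k)), Λ u) ∈ linearGroup F k α ∧ IsUnipotentMap (Λ u) := by
  have hex : ∀ u : U, ∃ L, ((u : Equiv.Perm (Point F k)), L) ∈ linearGroup F k α ∧
      IsUnipotentMap L := by
    obtain ⟨r, H, act, -, hnil, hact, hr⟩ := hUu
    rintro ⟨u, hu⟩
    have hu' : u ∈ act.range := by rwa [hr]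
    obtain ⟨h, rfl⟩ := hu'
    exact exists_unipotent_lift hF hα hact (hnil h h.2) (hU hu)
  choose Λ hΛ hΛu using hex
  -- All the elements `u v^j` lie in `U` and so have unipotent lifts; this makes `Λ u * Λ v`
  -- unipotent, and uniqueness identifies it with `Λ (u * v)`.
  have hmul : ∀ u v, Λ (u * v) = Λ u * Λ v := by
    intro u v
    have h1 : ∀ j : ℕ, ((u : Equiv.Perm (Point F k)) * (v : Equiv.Perm (Point F k)) ^ j,
        Λ (u * v ^ j)) ∈ linearGroup F k α := fun j => by
      have := hΛ (u * v ^ j)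
      rwa [Subgroup.coe_mul, Subgroup.coe_pow] at this
    have h2 := isUnipotentMap_mul hF hα (hΛ u) (hΛ v) (hΛu u) (hΛu v) fun j =>
      ⟨_, h1 j, hΛu (u * v ^ j)⟩
    have h3 := hΛ (u * v)
    rw [Subgroup.coe_mul] at h3
    have h4 : ((u : Equiv.Perm (Point F k)) * (v : Equiv.Perm (Point F k)), Λ u * Λ v) ∈
        linearGroup F k α := mul_mem (hΛ u) (hΛ v)
    exact unipotent_lift_unique hF hα h4 h3 h2 (hΛu (u * v))
  exact ⟨MonoidHom.mk' Λ hmul, fun u => ⟨hΛ u, hΛu u⟩⟩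

end Radical

end

end ToricDiscriminant

/-! ### The theorem -/

theorem mainTheorem3 {k : Type*} [Field k] [IsAlgClosed k] [CharZero k]
    {n : ℕ} {R : Type*} [Fintype R] [DecidableEq R]
    (F : Fan n R) (hF : F.IsComplete) (α : Cl F) (hα : ∃ f ∈ CoxPiece F k α, f ≠ 0) :
    -- `∇_A` is the closure of the set of the `[f]` that are singular at some point of `G · T`
    discLocus F k α =
      zariskiClosure {p | ∃ x ∈ sweep F k α, ∃ z : R → k, LiesOver z x ∧
        eval z (p.rep : MvPolynomial R k) = 0 ∧ GradVanishes (p.rep : MvPolynomial R k) z} ∧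
    -- if `α ≠ 0`, it suffices to ask for the vanishing of the partial derivatives
    (α ≠ 0 → discLocus F k α =
      zariskiClosure {p | ∃ x ∈ sweep F k α, ∃ z : R → k, LiesOver z x ∧
        GradVanishes (p.rep : MvPolynomial R k) z}) ∧
    -- `G` acts on `|α| = ℙ(S_α)` by projective linear transformations
    (∀ g ∈ autClass F k α, ∃ L, (g, L) ∈ linearGroup F k α ∧
      ∀ L', (g, L') ∈ linearGroup F k α → ∃ c : k, c ≠ 0 ∧ ∀ f, L' f = c • L f) ∧
    -- `∇_A` is invariant under `G`
    (∀ g ∈ autClass F k α, ∀ (f f' : CoxPiece F k α) (hf : f ≠ 0) (hf' : f' ≠ 0),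
      pushDivisor g (divisor (F := F) (f : MvPolynomial R k)) =
          divisor (f' : MvPolynomial R k) →
        (Projectivization.mk k f hf ∈ discLocus F k α ↔
          Projectivization.mk k f' hf' ∈ discLocus F k α)) ∧
    -- `Δ_A` is a form and a semi-invariant for an algebraic character
    (∀ Δ : MvPolynomial (Exps F α) k, IsDiscriminant Δ →
      (∃ d : ℕ, Δ.IsHomogeneous d) ∧
      ∃ χ : linearGroup F k α →* kˣ,
        (∃ P : MvPolynomial (Exps F α × Exps F α) k, ∀ p : linearGroup F k α,
          (χ p : k) = eval (entries p.1.2.symm) P) ∧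
        ∀ (p : linearGroup F k α) (f : CoxPiece F k α),
          eval (coords (p.1.2.symm f)) Δ = (χ p : k) * eval (coords f) Δ) ∧
    -- the unipotent radical `U` has a unique linear action on `S_α` by unipotent maps that lifts
    -- its action on `ℙ(S_α)`, and `Δ_A` is invariant under it
    (∀ U : Subgroup (Equiv.Perm (Point F k)), IsUnipotentRadical (autClass F k α) U →
      ∃ Λ : U →* (CoxPiece F k α ≃ₗ[k] CoxPiece F k α),
        (∀ u : U, ((u : Equiv.Perm (Point F k)), Λ u) ∈ linearGroup F k α ∧
          IsUnipotentMap (Λ u)) ∧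
        (∀ (u : U) (L : CoxPiece F k α ≃ₗ[k] CoxPiece F k α),
          ((u : Equiv.Perm (Point F k)), L) ∈ linearGroup F k α → IsUnipotentMap L →
            L = Λ u) ∧
        ∀ Δ : MvPolynomial (Exps F α) k, IsDiscriminant Δ →
          ∀ (u : U) (f : CoxPiece F k α),
            eval (coords ((Λ u).symm f)) Δ = eval (coords f) Δ) := by
  refine ⟨discLocus_eq_closure_sweep hF, fun hα0 => discLocus_eq_closure_sweep' hF hα0,
    fun g hg => ?_, fun g hg f f' hf hf' h => ⟨discLocus_invariant hF hg hf hf' h,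
      discLocus_invariant hF (inv_mem hg) hf' hf ?_⟩,
    fun Δ hΔ => ⟨hΔ.exists_isHomogeneous hF, hΔ.exists_character hF⟩, fun U hU => ?_⟩
  · obtain ⟨L, hL⟩ := exists_lift hF hα hg
    exact ⟨L, hL, fun L' hL' => lift_unique hF hα hL hL'⟩
  · rw [← h, ← pushDivisor_mul, inv_mul_cancel, pushDivisor_one]
  · obtain ⟨Λ, hΛ⟩ := exists_unipotent_action hF hα hU.1.1 hU.1.2.2
    refine ⟨Λ, hΛ, fun u L hL hLu => unipotent_lift_unique hF hα (hΛ u).1 hL (hΛ u).2 hLu,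
      fun Δ hΔ u f => ?_⟩
    have h1 := hΔ.eval_unipotent hF (hΛ u⁻¹).1 (hΛ u⁻¹).2 f
    rw [map_inv] at h1
    exact h1
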